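/- **Model.** Consider a slotted multihop wireless network with a finite node set $\mathcal N$, a set of links $\mathcal L\subseteq\mathcal N\times\mathcal N$, and a finite nonempty set $\mathcal R$ of available rate vectors $r=[r_{ij}]_{(i,j)\in\mathcal L}$ (in whole packets per slot) such that links of a schedule may be left silent (setting some coordinates of $r\in\mathcal R$ to $0$ gives an element of $\mathcal R$). Each source $s$ of a set $\mathcal U\subseteq\mathcal N$ sends files to one destination $d(s)\ne s$; $\mathcal D=d(\mathcal U)$. Routes are fixed and acyclic: $R^{(d)}_{ij}=1$ if $j$ is the next hop of $i$ for destination $d$, packets eventually reach their destination and leave the network there, and every link has $R^{(d)}_{ij}=1$ for some $d\in\mathcal D$. The numbers $a_s(t)$ of files that arrive at the sources are i.i.d. over time and independent across sources, with means $\kappa_s$ and finite second moments. A file at $s$ has type $i\in\{1,\dots,K\}$ with probability $p_{si}$, and a file of type $i$ has a geometric number of packets (on $\{1,2,\dots\}$) with mean $1/\eta_i$, $0<\eta_i\le1$. The load is $\rho_s=\kappa_s\sum_i p_{si}/\eta_i$. A file holds packets in the MAC-layer ingress queue of its source (its congestion window) and keeps the others at the Transport layer; it departs when all its packets have left the ingress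 queue. Let $q_n^{(d)}$ be the number of packets of destination $d$ at the MAC layer of node $n$. Let $g(x)=\log(1+x)/h(x)$, where $h$ is increasing on $[0,\infty)$ with $h(0)>0$ and is such that $g$ is increasing and concave on $[0,\infty)$, continuously differentiable on $(0,\infty)$, and $g(x)\to\infty$ as $x\to\infty$. In each slot: 1. With $w_{ij}^{(d)}=g(q_i^{(d)})-g(q_j^{(d)})$ and $w_{ij}=\max_{d\in\mathcal D:R_{ij}^{(d)}=1}w_{ij}^{(d)}$, a rate vector $\tilde x\in\mathcal R$ that maximizes $\sum_{(i,j)\in\mathcal L}r_{ij}w_{ij}$ over $r\in\mathcal R$ is used, and each link $(i,j)$ serves a destination $d$ that attains $w_{ij}$, transmitting $\min\{\tilde x_{ij},q_i^{(d)}\}$ packets of it (ties are broken arbitrarily, possibly at random). 2. New files arrive. 3. Each file gets a window size in $[1,W_{cong}]$, and its packets are injected from the Transport layer into the ingress queue until its window is full or it has no packets left at the Transport layer. Which packets of a queue are transmitted is decided by an arbitrary nonidling service discipline, and the window sizes by an arbitrary congestion control. Tie-breaking, discipline and congestion control may be randomized and may use everything in the state of the network except the remaining file sizes at the Transport layer (of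 a file they know only whether any packets remain there), and in addition a memory (for example the order of packets in queues, or delayed queue lengths) that has only finitely many possible values for each observed configuration. The state (configuration and memory) is then a discrete-time Markov chain. The capacity region $\mathcal C$ is the set of all load vectors $\rho$ under which the total queues can be stabilized, that is: for some arrival process of packets that is i.i.d. over time with mean $\rho_s$ at each source $s$, some choice of schedules in $\mathcal R$ and of transmissions along the routes keeps the total queue size bounded in probability uniformly in time. A load $\rho$ is strictly inside $\mathcal C$ if there is $\rho'\in\mathcal C$ with $\rho_s<\rho'_s$ for all $s\in\mathcal U$. **Theorem 1.** For every load $\rho$ strictly inside $\mathcal C$, every $W_{cong}$, every congestion control with window sizes in $[1,W_{cong}]$ and every nonidling service discipline, the network is stable: from every initial state, the network Markov chain almost surely reaches a positive recurrent state, and the total number of packets (at MAC and Transport layers) and of files in the network remains finite, i.e. is bounded in probability uniformly in time. -/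

import Mathlib

open Set Filter Topology MeasureTheory ProbabilityTheory
open scoped ENNReal

noncomputable section

namespace FlowNet

/-! ### Discrete-time Markov chains on a discrete state space -/

section Chain

variable {S : Type*}

/-- Law of the chain with transition law `step` at time `t`, started at `x`. -/
def law (step : S → PMF S) : ℕ → S → PMF S
  | 0, x => PMF.pure x
  | t + 1, x => (step x).bind (law step t)

open Classical in
/-- `stayOut step A n x` is the probability that the chain started at `x`
is outside of `A` at each of the times `1, …, n`. -/
def stayOut (step : S → PMF S) (A : Set S) : ℕ → S → ℝ≥0∞
  | 0, _ => 1
  | n + 1, x => ∑' y, step x y * (if y ∈ A then 0 else stayOut step A n y)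

/-- A state is positive recurrent if its expected return time
`E τ = ∑ₙ P(τ > n)` is finite. -/
def PositiveRecurrent (step : S → PMF S) (x : S) : Prop :=
  ∑' n, stayOut step {x} n x ≠ ∞

/-- Started at `x`, the chain almost surely reaches a positive recurrent state. -/
def ReachesPositiveRecurrent (step : S → PMF S) (x : S) : Prop :=
  Tendsto (fun n => stayOut step {y | PositiveRecurrent step y} n x) atTop (𝓝 0)

/-- Started at `x`, the quantity `size` remains finite: it is bounded in probability
uniformly in time. -/
def RemainsFinite (step : S → PMF S) (size : S → ℕ) (x : S) : Prop :=
  ∀ ε : ℝ≥0∞, 0 < ε → ∃ B : ℕ, ∀ t, (law step t x).toOuterMeasure {y | B < size y} ≤ ε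

end Chain

/-! ### Elementary laws -/

/-- Geometric law on `{0, 1, …}` with success probability `η`. -/
def geometricZero (η : ℝ) (h0 : 0 < η) (h1 : η ≤ 1) : PMF ℕ :=
  ⟨fun k => ENNReal.ofReal ((1 - η) ^ k * η), by
    have h := (hasSum_geometric_of_lt_one (sub_nonneg.mpr h1) (sub_lt_self 1 h0)).mul_right η
    rw [sub_sub_cancel, inv_mul_cancel₀ h0.ne'] at h
    have hn : ∀ k : ℕ, 0 ≤ (1 - η) ^ k * η := fun k =>
      mul_nonneg (pow_nonneg (sub_nonneg.mpr h1) k) h0.le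
    have := ENNReal.ofReal_tsum_of_nonneg hn h.summable
    rw [h.tsum_eq, ENNReal.ofReal_one] at this
    rw [this]
    exact ENNReal.summable.hasSum⟩

/-- Geometric law on `{1, 2, …}` with mean `1 / η`: the mass at `k` is `(1 - η) ^ (k - 1) * η`. -/
def geometric (η : ℝ) (h0 : 0 < η) (h1 : η ≤ 1) : PMF ℕ :=
  (geometricZero η h0 h1).map fun k => k + 1

/-- Law of a family of independent random variables `X i` with laws `f i`. -/
def indep {ι α : Type*} [Fintype ι] [Countable α] (f : ι → PMF α) : PMF (ι → α) :=
  ⟨fun x => ∏ i, f i (x i), by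
    let _ : MeasurableSpace α := ⊤
    have h := (Measure.pi (fun i => (f i).toMeasure)).toPMF.tsum_coe
    have e : ∀ x : ι → α, (Measure.pi (fun i => (f i).toMeasure)).toPMF x = ∏ i, f i (x i) := by
      intro x
      rw [Measure.toPMF_apply, Measure.pi_singleton]
      exact Finset.prod_congr rfl fun i _ =>
        PMF.toMeasure_apply_singleton _ _ (measurableSet_singleton _)
    simp_rw [e] at h
    rw [← h]
    exact ENNReal.summable.hasSum⟩

/-- Law of a list of `k` independent random variables with the common law `f`. -/
def iidList {α : Type*} (f : PMF α) : ℕ → PMF (List α)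
  | 0 => PMF.pure []
  | k + 1 => f.bind fun a => (iidList f k).map fun l => a :: l

/-! ### The network and its traffic -/

/-- A multihop wireless network with fixed acyclic routes. -/
structure Network (V : Type*) where
  /-- the links `(i, j)` -/
  links : Finset (V × V)
  /-- the available rate vectors (transmission schedules), in packets per slot -/
  rates : Finset (V → V → ℕ)
  /-- the source nodes -/
  sources : Finset V
  /-- the destination of a source (irrelevant at other nodes) -/
  dest : V → V
  /-- `next d i` is the next hop of node `i` for packets of destination `d`, if there is one -/
  next : V → V → Option V
  rates_nonempty : rates.Nonempty
  rates_support : ∀ r ∈ rates, ∀ i j, (i, j) ∉ links → r i j = 0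
  /-- links of a schedule may be left silent -/
  rates_switchOff : ∀ r ∈ rates, ∀ r' : V → V → ℕ,
    (∀ i j, r' i j = r i j ∨ r' i j = 0) → r' ∈ rates
  dest_ne : ∀ s ∈ sources, dest s ≠ s
  next_dest : ∀ s ∈ sources, next (dest s) (dest s) = none
  next_link : ∀ s ∈ sources, ∀ i j, next (dest s) i = some j → (i, j) ∈ links
  /-- forwarded packets eventually reach their destination -/
  next_reaches : ∀ s ∈ sources, ∀ i j, next (dest s) i = some j →
    Relation.ReflTransGen (fun a b => next (dest s) a = some b) j (dest s)
  source_reaches : ∀ s ∈ sources,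
    Relation.ReflTransGen (fun a b => next (dest s) a = some b) s (dest s)
  /-- every link is used for some destination -/
  link_used : ∀ i j, (i, j) ∈ links → ∃ s ∈ sources, next (dest s) i = some j

/-- File arrivals at the nodes (only sources matter) and file sizes. -/
structure Traffic (V : Type*) (K : ℕ) where
  /-- law of the number of files that arrive at a node in a slot -/
  arrivals : V → PMF ℕ
  /-- law of the type of a file that arrives at a node -/
  fileType : V → PMF (Fin K)
  /-- files of type `i` have a geometric size with mean `1 / η i` -/
  η : Fin K → ℝ
  η_pos : ∀ i, 0 < η i
  η_le_one : ∀ i, η i ≤ 1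
  secondMoment : ∀ s, ∑' k : ℕ, arrivals s k * (k : ℝ≥0∞) ^ 2 ≠ ∞

namespace Traffic

variable {V : Type*} {K : ℕ} (T : Traffic V K)

/-- File arrival rate `κ_s`. -/
def arrivalRate (s : V) : ℝ := ∑' k : ℕ, (T.arrivals s k).toReal * k

/-- Mean file size `m_s`. -/
def meanSize (s : V) : ℝ := ∑ i, (T.fileType s i).toReal / T.η i

/-- Load `ρ_s = κ_s m_s`. -/
def load (s : V) : ℝ := T.arrivalRate s * T.meanSize s

/-- Law of the type and the size of a new file at node `s`. -/
def newFile (s : V) : PMF (Fin K × ℕ) :=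
  (T.fileType s).bind fun i =>
    (geometric (T.η i) (T.η_pos i) (T.η_le_one i)).map fun size => (i, size)

open Classical in
/-- Law of the new files (type and size) at all nodes in a slot. -/
def newFiles [Fintype V] (sources : Finset V) : PMF (V → List (Fin K × ℕ)) :=
  indep fun s =>
    if s ∈ sources then (T.arrivals s).bind fun k => iidList (T.newFile s) k
    else PMF.pure []

end Traffic

/-! ### Configurations -/

/-- A file in the network. -/
structure FileRec (K : ℕ) where
  /-- its type -/
  type : Fin K
  /-- its current congestion window size -/
  window : ℕ
  /-- number of its packets in the ingress MAC-layer queue of its source -/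
  inMac : ℕ
  /-- number of its packets that are still at the Transport layer -/
  rest : ℕ

/-- What is known of a file without knowledge of its remaining size: `active` tells whether
there are packets left at the Transport layer. -/
structure FileObs (K : ℕ) where
  type : Fin K
  window : ℕ
  inMac : ℕ
  active : Bool

def FileRec.obs {K : ℕ} (f : FileRec K) : FileObs K :=
  ⟨f.type, f.window, f.inMac, decide (0 < f.rest)⟩

/-- Configuration of the network: `transit n d` is the number of packets of destination `d` at
the MAC layer of the relay `n` that have come from other nodes, `files n` are the files that
originate at `n`, in the order of their arrival. -/
structure Config (V : Type*) (K : ℕ) where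
  transit : V → V → ℕ
  files : V → List (FileRec K)

/-- Configuration without the remaining file sizes at the Transport layer. -/
structure ConfigObs (V : Type*) (K : ℕ) where
  transit : V → V → ℕ
  files : V → List (FileObs K)

def Config.obs {V : Type*} {K : ℕ} (c : Config V K) : ConfigObs V K :=
  ⟨c.transit, fun n => (c.files n).map FileRec.obs⟩

/-- Total number of packets (at MAC and Transport layers) and of files in the network. -/
def Config.size {V : Type*} [Fintype V] {K : ℕ} (c : Config V K) : ℕ :=
  (∑ n, ∑ d, c.transit n d)
    + (∑ n, ((c.files n).map fun f => f.inMac + f.rest).sum)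
    + ∑ n, (c.files n).length

/-- A scheduling decision: a rate vector, and for every link the destination that it serves. -/
structure Decision (V : Type*) where
  rate : V → V → ℕ
  serves : V → V → V

namespace Network

variable {V : Type*} [Fintype V] [DecidableEq V] {K : ℕ} (N : Network V)

/-- The destinations. -/
def dests : Finset V := N.sources.image N.dest

/-- The destinations `d` whose packets are routed from `i` to `j`, i.e. `R^{(d)}_{ij} = 1`. -/
def carried (i j : V) : Finset V := N.dests.filter fun d => N.next d i = some j

/-- The length `q_n^{(d)}` of a MAC-layer queue. -/
def queue (o : ConfigObs V K) (n d : V) : ℕ :=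
  o.transit n d
    + if n ∈ N.sources ∧ d = N.dest n then ((o.files n).map FileObs.inMac).sum else 0

/-- The configurations that can occur: packets are on the routes of their sources, windows lie
in `[1, Wcong]`, a window is full as long as its file has packets at the Transport layer, and
a file without packets in the ingress queue has departed. -/
structure Valid (T : Traffic V K) (Wcong : ℕ) (c : Config V K) : Prop where
  transit_route : ∀ n d, c.transit n d ≠ 0 → n ≠ d ∧ ∃ s ∈ N.sources, N.dest s = d ∧
    Relation.ReflTransGen (fun a b => N.next d a = some b) s n
  files_source : ∀ n, n ∉ N.sources → c.files n = []
  window_pos : ∀ n, ∀ f ∈ c.files n, 1 ≤ f.window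
  window_le : ∀ n, ∀ f ∈ c.files n, f.window ≤ Wcong
  inMac_pos : ∀ n, ∀ f ∈ c.files n, 1 ≤ f.inMac
  inMac_le : ∀ n, ∀ f ∈ c.files n, f.inMac ≤ Wcong
  window_full : ∀ n, ∀ f ∈ c.files n, 0 < f.rest → f.window ≤ f.inMac
  /-- files with `η = 1` have one packet only -/
  rest_type : ∀ n, ∀ f ∈ c.files n, 0 < f.rest → T.η f.type < 1

/-! ### Max-weight scheduling -/

/-- The weight `w_ij^{(d)} = g(q_i^{(d)}) - g(q_j^{(d)})`. -/
def destWeight (g : ℝ → ℝ) (o : ConfigObs V K) (i j d : V) : ℝ :=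
  g (N.queue o i d) - g (N.queue o j d)

/-- The weight `w_ij`: the maximum of `w_ij^{(d)}` over the destinations `d` that are carried
by the link (there is one for every link). -/
def linkWeight (g : ℝ → ℝ) (o : ConfigObs V K) (i j : V) : ℝ :=
  if h : (N.carried i j).Nonempty then (N.carried i j).sup' h (N.destWeight g o i j) else 0

/-- A decision of the max-weight algorithm: the rate vector maximizes the total weight, and
every link serves a destination of maximal weight. -/
structure IsMaxWeight (g : ℝ → ℝ) (o : ConfigObs V K) (D : Decision V) : Prop where
  rate_mem : D.rate ∈ N.rates
  rate_max : ∀ r ∈ N.rates,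
    ∑ l ∈ N.links, (r l.1 l.2 : ℝ) * N.linkWeight g o l.1 l.2
      ≤ ∑ l ∈ N.links, (D.rate l.1 l.2 : ℝ) * N.linkWeight g o l.1 l.2
  serves_mem : ∀ i j, (i, j) ∈ N.links → D.serves i j ∈ N.carried i j
  serves_max : ∀ i j, (i, j) ∈ N.links →
    N.destWeight g o i j (D.serves i j) = N.linkWeight g o i j

/-- The scheduled rate for packets of destination `d` out of node `n`. -/
def rateOut (D : Decision V) (n d : V) : ℕ :=
  match N.next d n with
  | some j => if D.serves n j = d then D.rate n j else 0
  | none => 0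

/-- The number of packets of destination `d` that node `n` transmits. -/
def sent (o : ConfigObs V K) (D : Decision V) (n d : V) : ℕ :=
  min (N.rateOut D n d) (N.queue o n d)

/-- `k n` lists how many packets of each file at node `n` are transmitted from its ingress
queue. A nonidling discipline transmits `sent` packets of each queue; the ones that
do not belong to files at `n` are relayed packets. -/
structure IsService (o : ConfigObs V K) (D : Decision V) (k : V → List ℕ) : Prop where
  le_inMac : ∀ n, List.Forall₂ (fun a f => a ≤ FileObs.inMac f) (k n) (o.files n)
  le_sent : ∀ n ∈ N.sources, (k n).sum ≤ N.sent o D n (N.dest n)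
  sent_le : ∀ n ∈ N.sources,
    N.sent o D n (N.dest n) ≤ (k n).sum + o.transit n (N.dest n)

/-- Relayed packets after the transmissions. -/
def transitAfter (o : ConfigObs V K) (D : Decision V) (k : V → List ℕ) (n d : V) : ℕ :=
  o.transit n d
    - (N.sent o D n d - if n ∈ N.sources ∧ d = N.dest n then (k n).sum else 0)
    + ∑ i, if N.next d i = some n ∧ n ≠ d then N.sent o D i d else 0

/-- The files at a node after the transmissions; files without remaining packets depart. -/
def serveFiles (fs : List (FileRec K)) (k : List ℕ) : List (FileRec K) :=
  (List.zipWith (fun (f : FileRec K) a => { f with inMac := f.inMac - a }) fs k).filter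
    fun f => decide (0 < f.inMac ∨ 0 < f.rest)

/-- The configuration after transmissions and file arrivals, before packets are injected
into the MAC layer. New files get their windows afterwards. -/
def afterArrivals (c : Config V K) (D : Decision V) (k : V → List ℕ)
    (new : V → List (Fin K × ℕ)) : Config V K where
  transit := N.transitAfter c.obs D k
  files n := serveFiles (c.files n) (k n) ++ (new n).map fun a => ⟨a.1, 0, 0, a.2⟩

end Network

/-- Injection of packets into the MAC layer until the window `w` is full or no packet is left
at the Transport layer. -/
def FileRec.inject {K : ℕ} (f : FileRec K) (w : ℕ) : FileRec K where
  type := f.type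
  window := w
  inMac := f.inMac + min (w - f.inMac) f.rest
  rest := f.rest - min (w - f.inMac) f.rest

def Config.inject {V : Type*} {K : ℕ} (c : Config V K) (w : V → List ℕ) : Config V K where
  transit := c.transit
  files n := List.zipWith FileRec.inject (c.files n) (w n)

/-! ### Operation of the network -/

/-- All rules by which a network is run: tie-breaking in the max-weight algorithm with weight
function `g`, a nonidling service discipline, and a window congestion control with window sizes
in `[1, Wcong]`. Each may be randomized and use everything that is observed except the
remaining file sizes at the Transport layer, and also a memory (such as the order of packets in
the queues, or delayed queue lengths) which has finitely many possible values
in each observed configuration. -/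
structure Control {V : Type*} [Fintype V] [DecidableEq V] (N : Network V) (K : ℕ)
    (g : ℝ → ℝ) (Wcong : ℕ) where
  Mem : Type
  /-- the possible values of the memory -/
  info : ConfigObs V K → Set Mem
  info_finite : ∀ o, (info o).Finite
  /-- scheduling -/
  schedule : ConfigObs V K → Mem → PMF (Decision V)
  schedule_maxWeight : ∀ o m, ∀ D ∈ (schedule o m).support, N.IsMaxWeight g o D
  /-- service discipline -/
  serve : ConfigObs V K → Mem → Decision V → PMF (V → List ℕ)
  serve_nonidling : ∀ o m D, ∀ k ∈ (serve o m D).support, N.IsService o D k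
  /-- window sizes of all files after the transmissions and arrivals
  (the last argument is the configuration at this moment) -/
  window : ConfigObs V K → Mem → Decision V → (V → List ℕ) → ConfigObs V K →
    PMF (V → List ℕ)
  window_length : ∀ o m D k mid, ∀ w ∈ (window o m D k mid).support,
    ∀ n, (w n).length = (mid.files n).length
  window_mem : ∀ o m D k mid, ∀ w ∈ (window o m D k mid).support,
    ∀ n, ∀ a ∈ w n, 1 ≤ a ∧ a ≤ Wcong
  /-- update of the memory (the last two arguments are the configurations after the
  arrivals and at the end of the slot) -/
  update : ConfigObs V K → Mem → Decision V → (V → List ℕ) → ConfigObs V K →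
    ConfigObs V K → PMF Mem
  update_mem : ∀ o m D k mid fin, ∀ m' ∈ (update o m D k mid fin).support, m' ∈ info fin

/-- The transition law of the network Markov chain: scheduling and transmissions, then file
arrivals, then injection of packets into the MAC layer. -/
def Control.step {V : Type*} [Fintype V] [DecidableEq V] {N : Network V} {K : ℕ}
    {g : ℝ → ℝ} {Wcong : ℕ} (C : Control N K g Wcong) (T : Traffic V K)
    (x : Config V K × C.Mem) : PMF (Config V K × C.Mem) :=
  (C.schedule x.1.obs x.2).bind fun D =>
  (C.serve x.1.obs x.2 D).bind fun k =>
  (T.newFiles N.sources).bind fun new =>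
  (C.window x.1.obs x.2 D k (N.afterArrivals x.1 D k new).obs).bind fun w =>
  (C.update x.1.obs x.2 D k (N.afterArrivals x.1 D k new).obs
      ((N.afterArrivals x.1 D k new).inject w).obs).map fun m' =>
    ((N.afterArrivals x.1 D k new).inject w, m')

/-- The network is stable: from every initial state, the network Markov chain almost surely
reaches a positive recurrent state, and the number of packets (at MAC and Transport layers) and
of files in the network remains finite. -/
def Control.Stable {V : Type*} [Fintype V] [DecidableEq V] {N : Network V} {K : ℕ}
    {g : ℝ → ℝ} {Wcong : ℕ} (C : Control N K g Wcong) (T : Traffic V K) : Prop :=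
  ∀ x : Config V K × C.Mem, N.Valid T Wcong x.1 → x.2 ∈ C.info x.1.obs →
    ReachesPositiveRecurrent (C.step T) x ∧
    RemainsFinite (C.step T) (fun y => y.1.size) x

/-! ### The capacity region -/

/-- The load vector `ρ` can be stabilized: `A t s` packets, i.i.d. over time with mean `ρ s`,
are brought to source `s` in slot `t`, and some choice of schedules `r t` and of the numbers
`z t n d` of packets of destination `d` sent by node `n` to its next hop keeps
the total queues `Q t n d` finite. -/
structure StabilizedBy {V : Type*} [Fintype V] [DecidableEq V] (N : Network V) (ρ : V → ℝ)
    {Ω : Type} [MeasurableSpace Ω] (P : Measure Ω) (A : ℕ → Ω → V → ℕ)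
    (r : ℕ → Ω → V → V → ℕ) (z Q : ℕ → Ω → V → V → ℕ) : Prop where
  measurable_A : ∀ t, Measurable (A t)
  measurable_r : ∀ t, Measurable (r t)
  measurable_z : ∀ t, Measurable (z t)
  measurable_Q : ∀ t, Measurable (Q t)
  indep_A : iIndepFun A P
  identDistrib_A : ∀ t, IdentDistrib (A t) (A 0) P P
  integrable_A : ∀ s ∈ N.sources, Integrable (fun ω => (A 0 ω s : ℝ)) P
  mean_A : ∀ s ∈ N.sources, ∫ ω, (A 0 ω s : ℝ) ∂P = ρ s
  rate_mem : ∀ t ω, r t ω ∈ N.rates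
  sent_le_queue : ∀ t ω n d, z t ω n d ≤ Q t ω n d
  sent_route : ∀ t ω n, ∀ d ∈ N.dests, N.next d n = none → z t ω n d = 0
  sent_le_rate : ∀ t ω i j, (i, j) ∈ N.links → ∑ d ∈ N.carried i j, z t ω i d ≤ r t ω i j
  queue_dest : ∀ t ω, ∀ d ∈ N.dests, Q t ω d d = 0
  queue_succ : ∀ t ω n, ∀ d ∈ N.dests, n ≠ d →
    Q (t + 1) ω n d + z t ω n d = Q t ω n d
      + (∑ i, if N.next d i = some n then z t ω i d else 0)
      + if n ∈ N.sources ∧ d = N.dest n then A t ω n else 0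
  queue_finite : ∀ ε : ℝ≥0∞, 0 < ε → ∃ B : ℕ, ∀ t,
    P {ω | B < ∑ n, ∑ d ∈ N.dests, Q t ω n d} ≤ ε

/-- The capacity region: the load vectors that can be stabilized. -/
def Network.capacityRegion {V : Type*} [Fintype V] [DecidableEq V] (N : Network V) :
    Set (V → ℝ) :=
  {ρ | ∃ (Ω : Type) (_ : MeasurableSpace Ω) (P : Measure Ω) (_ : IsProbabilityMeasure P)
      (A : ℕ → Ω → V → ℕ) (r : ℕ → Ω → V → V → ℕ) (z Q : ℕ → Ω → V → V → ℕ),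
      StabilizedBy N ρ P A r z Q}

/-- `ρ` is strictly inside the capacity region: a load vector that is larger at every source is
still in the region. -/
def Network.StrictlyInside {V : Type*} [Fintype V] [DecidableEq V] (N : Network V)
    (ρ : V → ℝ) : Prop :=
  ∃ ρ' ∈ N.capacityRegion, ∀ s ∈ N.sources, ρ s < ρ' s

/-- The log-type function `g(x) = log (1 + x) / h(x)`. -/
def logType (h : ℝ → ℝ) (x : ℝ) : ℝ := Real.log (1 + x) / h x

end FlowNet

end

open FlowNet

/-! The proof is a Foster–Lyapunov argument for the part of the network that the control can see.
The control knows whether a file still has packets at the Transport layer, but not how many.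
Geometric sizes have no memory, so given the observed past the unseen remainders of the active files
stay independent and geometric. The observed configuration with the memory is therefore itself a
Markov chain (`Control.obsStep`), and the full chain started from the hidden law is intertwined with
it (`obsStep_bind_hiddenState`). A given initial configuration has positive mass under the hidden
law of its observation, so estimates for the observed chain pass to the full chain at the price of a
constant factor (`dominated_of_obs`).

The Lyapunov function is the sum of G(x) over all queues, where G is the primitive of g and x is the
expected queue: MAC packets plus 1/η for every active file at its source. Injection into the MAC
layer does not change the mean of x; transmissions and arrivals change it by inflow minus outflow
plus load. Every file holds at least one packet in its ingress queue. Hence x lies between the real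
queue q and a fixed multiple of q, and logarithmic growth makes g(x) - g(q) bounded, so that
scheduling by q is as good as scheduling by x (`sum_first_order_le`). The injection noise has
variance of the order of the number of files, which is at most x, while the curvature of G is of
order 1/(1+x); the second-order term is therefore bounded (`hidden_mean_primitive`,
`newFiles_mean_quadratic`).

It remains to compare the load with the weight that max-weight scheduling serves. Pairing the queues
of a stabilizing policy with a nonnegative potential u and using the law of large numbers yields an
inequality dual to multicommodity flow (`sum_load_le_of_mem_capacityRegion`). Taking for u the
maximum of g(q) downstream on the route turns the slack δ in the load into a gain δ g(q) at any
queue that a route visits (`sum_load_add_le`). The drift is thus at most a constant minus δ g(q) for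
every such queue, and below -1 outside of a finite set.

Foster's criterion is used in the form `dominated_of_drift`: all laws of the chain lie below one
finite measure. This single property gives tightness as well as the almost sure visit to a positive
recurrent state, and it needs no irreducibility. -/

noncomputable section

namespace FlowNet

/-! ### Discrete Markov chains: domination, positive recurrence, Foster's criterion. -/

section Chain

variable {S : Type*}

/-- The laws of the chain started at `x` are dominated by a finite measure. -/
def Dominated (step : S → PMF S) (x : S) : Prop :=
  ∃ m : S → ℝ≥0∞, ∑' y, m y ≠ ∞ ∧ ∀ t y, law step t x y ≤ m y

lemma law_zero_apply (step : S → PMF S) (x y : S) [Decidable (y = x)] :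
    law step 0 x y = if y = x then 1 else 0 := by
  simp [law, PMF.pure_apply]

lemma law_succ_apply (step : S → PMF S) (t : ℕ) (x y : S) :
    law step (t + 1) x y = ∑' z, step x z * law step t z y := rfl

lemma toOuterMeasure_compl_le {p : PMF S} {m : S → ℝ≥0∞} (h : ∀ y, p y ≤ m y)
    {A : Set S} {F : Finset S} (hA : ∀ y ∈ F, y ∉ A) :
    p.toOuterMeasure A ≤ ∑' y : {y // y ∉ F}, m y := by
  classical
  rw [PMF.toOuterMeasure_apply]
  change _ ≤ ∑' y : ↥({y | y ∉ F} : Set S), m y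
  rw [tsum_subtype {y | y ∉ F} m]
  refine ENNReal.tsum_le_tsum fun y => ?_
  by_cases hy : y ∈ A
  · have : y ∉ F := fun hF => hA y hF hy
    simp [hy, this, h y]
  · simp [hy]

lemma exists_finset_tsum_compl_le {m : S → ℝ≥0∞} (hm : ∑' y, m y ≠ ∞) {ε : ℝ≥0∞} (hε : 0 < ε) :
    ∃ F : Finset S, ∑' y : {y // y ∉ F}, m y ≤ ε :=
  (((ENNReal.tendsto_nhds_zero).1 (ENNReal.tendsto_tsum_compl_atTop_zero hm)) ε hε).exists

/-- All but ε of the dominating measure sits on a finite set, on which `size` is bounded. -/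
lemma Dominated.remainsFinite {step : S → PMF S} {x : S} (h : Dominated step x) (size : S → ℕ) :
    RemainsFinite step size x := by
  obtain ⟨m, hm, hle⟩ := h
  intro ε hε
  obtain ⟨F, hF⟩ := exists_finset_tsum_compl_le hm hε
  refine ⟨F.sup size, fun t => (toOuterMeasure_compl_le (hle t) ?_).trans hF⟩
  intro y hy hy'
  exact absurd (Finset.le_sup (f := size) hy) (not_le.2 hy')

lemma stayOut_zero (step : S → PMF S) (A : Set S) (x : S) : stayOut step A 0 x = 1 := rfl

open Classical in
lemma stayOut_succ (step : S → PMF S) (A : Set S) (n : ℕ) (x : S) :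
    stayOut step A (n + 1) x = ∑' y, step x y * (if y ∈ A then 0 else stayOut step A n y) := by
  rw [stayOut]

lemma tsum_mul_le_of_le_one (p : PMF S) {f : S → ℝ≥0∞} (hf : ∀ y, f y ≤ 1) :
    ∑' y, p y * f y ≤ 1 := by
  calc ∑' y, p y * f y ≤ ∑' y, p y * 1 :=
        ENNReal.tsum_le_tsum fun y => mul_le_mul_right (hf y) _
    _ = 1 := by simp [p.tsum_coe]

lemma stayOut_antitone (step : S → PMF S) (A : Set S) (x : S) :
    Antitone fun n => stayOut step A n x := by
  classical
  refine antitone_nat_of_succ_le fun n => ?_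
  induction n generalizing x with
  | zero =>
    rw [stayOut_succ, stayOut_zero]
    refine tsum_mul_le_of_le_one _ fun y => ?_
    split_ifs <;> simp [stayOut_zero]
  | succ n ih =>
    rw [stayOut_succ, stayOut_succ]
    refine ENNReal.tsum_le_tsum fun y => ?_
    gcongr
    split_ifs
    · exact le_rfl
    · exact ih y

lemma stayOut_le_law (step : S → PMF S) (A : Set S) (n : ℕ) (x : S) :
    stayOut step A (n + 1) x ≤ (law step (n + 1) x).toOuterMeasure Aᶜ := by
  classical
  induction n generalizing x with
  | zero =>
    rw [stayOut_succ, PMF.toOuterMeasure_apply]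
    have : law step (0 + 1) x = step x := by
      change (step x).bind PMF.pure = _
      exact PMF.bind_pure _
    rw [this]
    refine ENNReal.tsum_le_tsum fun y => ?_
    by_cases hy : y ∈ A <;> simp [hy, stayOut_zero]
  | succ n ih =>
    rw [stayOut_succ]
    change _ ≤ ((step x).bind (law step (n + 1))).toOuterMeasure Aᶜ
    rw [PMF.toOuterMeasure_bind_apply]
    refine ENNReal.tsum_le_tsum fun y => ?_
    gcongr
    split_ifs
    · exact zero_le
    · exact ih y

open Classical in
/-- Decomposition at the last visit of `y` up to time `T`. -/
lemma sum_law_mul_stayOut_le (step : S → PMF S) (y : S) (T : ℕ) (x : S) :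
    ∑ t ∈ Finset.range (T + 1), law step t x y * stayOut step {y} (T - t) y
      + (if x = y then 0 else stayOut step {y} T x) ≤ 1 := by
  induction T generalizing x with
  | zero =>
    by_cases hx : x = y
    · simp [hx, law_zero_apply, stayOut_zero]
    · simp [hx, law_zero_apply, stayOut_zero, Ne.symm hx]
  | succ T ih =>
    -- Averaging the induction hypothesis over the first step accounts for the last visits at times
    -- 1, …, T + 1. The `if` there becomes `stayOut` over T + 1 steps, which is the event of no
    -- visit after time 0.
    have key : ∑ t ∈ Finset.range (T + 1), law step (t + 1) x y * stayOut step {y} (T - t) y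
        + stayOut step {y} (T + 1) x ≤ 1 := by
      have h1 : ∑ t ∈ Finset.range (T + 1), law step (t + 1) x y * stayOut step {y} (T - t) y
          = ∑' z, step x z *
            ∑ t ∈ Finset.range (T + 1), law step t z y * stayOut step {y} (T - t) y := by
        simp_rw [law_succ_apply, Finset.mul_sum, ← ENNReal.tsum_mul_right]
        rw [Summable.tsum_finsetSum (fun _ _ => ENNReal.summable)]
        simp_rw [mul_assoc]
      rw [h1, stayOut_succ, ← ENNReal.tsum_add]
      simp_rw [← mul_add]
      refine tsum_mul_le_of_le_one _ fun z => ?_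
      simpa using ih z
    rw [Finset.sum_range_succ']
    simp only [Nat.add_sub_add_right, Nat.sub_zero]
    refine le_trans (le_of_eq ?_) key
    rw [add_assoc]
    congr 1
    -- The event of no visit after time 0 is a last visit at time 0 if x = y, and no visit at all
    -- otherwise.
    by_cases hx : x = y
    · simp [hx, law_zero_apply]
    · simp [hx, law_zero_apply, Ne.symm hx]

/-- The expected number of visits of `y` before time `M` is controlled by the truncated mean
return time. -/
lemma sum_law_mul_sum_stayOut_le (step : S → PMF S) (y x : S) (M : ℕ) :
    (∑ t ∈ Finset.range M, law step t x y) * ∑ s ∈ Finset.range M, stayOut step {y} s y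
      ≤ 2 * M := by
  -- The last-visit inequality is summed over the horizons T < 2M. A pair of a visit time t and an
  -- excursion length s, both below M, occurs in it with T = t + s.
  have h : ∑ T ∈ Finset.range (2 * M),
      ∑ t ∈ Finset.range (T + 1), law step t x y * stayOut step {y} (T - t) y ≤ 2 * M := by
    calc _ ≤ ∑ T ∈ Finset.range (2 * M), (1 : ℝ≥0∞) :=
          Finset.sum_le_sum fun T _ => le_self_add.trans (sum_law_mul_stayOut_le step y T x)
      _ = _ := by simp
  refine le_trans ?_ h
  rw [Finset.sum_mul_sum, ← Finset.sum_product', Finset.sum_sigma']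
  have hinj : Set.InjOn (fun p : ℕ × ℕ => (⟨p.1 + p.2, p.1⟩ : Σ _ : ℕ, ℕ))
      (Finset.range M ×ˢ Finset.range M : Finset (ℕ × ℕ)) := by
    rintro ⟨a, b⟩ _ ⟨a', b'⟩ _ hab
    simp only [Sigma.mk.injEq, heq_eq_eq] at hab
    ext <;> simp <;> omega
  have := Finset.sum_image (f := fun p : Σ _ : ℕ, ℕ =>
    law step p.2 x y * stayOut step {y} (p.1 - p.2) y) hinj
  simp only [Nat.add_sub_cancel_left] at this
  rw [← this]
  refine Finset.sum_le_sum_of_subset fun p hp => ?_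
  simp only [Finset.mem_image, Finset.mem_product, Finset.mem_range] at hp
  obtain ⟨q, hq, rfl⟩ := hp
  simp only [Finset.mem_sigma, Finset.mem_range]
  omega

/-- A state with infinite mean return time is visited only o(M) times on average before time M. Up
to a small tail the laws live on a finite set, so the states that are not positive recurrent carry a
small share of the time on average. Since `stayOut` decreases in time, it lies below this average.
-/
lemma Dominated.reachesPositiveRecurrent {step : S → PMF S} {x : S} (h : Dominated step x) :
    ReachesPositiveRecurrent step x := by
  classical
  obtain ⟨m, hm, hle⟩ := h
  set A := {y | PositiveRecurrent step y} with hA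
  refine ENNReal.tendsto_nhds_zero.2 fun ε hε => ?_
  rcases eq_or_ne ε ∞ with rfl | hε'
  · simp
  -- One δ pays for the tail outside of F and one for the visits to F; both are doubled when M + 1
  -- is replaced by 2M.
  have hδ : 0 < ε / 4 := ENNReal.div_pos hε.ne' (by simp)
  obtain ⟨F, hF⟩ := exists_finset_tsum_compl_le hm hδ
  set δ := ε / 4 with hδdef
  -- K is a level that the truncated mean return times exceed eventually. Each bad state of F is
  -- then visited at most 2(M + 1)/K times on average, and Kδ > 2|F| makes the total smaller than
  -- δ(M + 1).
  obtain ⟨K, hK⟩ := ENNReal.exists_nat_mul_gt hδ.ne'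
    (show (2 * F.card : ℝ≥0∞) ≠ ∞ from ENNReal.mul_ne_top (by simp) (by simp))
  have hK0 : (K : ℝ≥0∞) ≠ 0 := by
    rintro h0
    simp [h0] at hK
  have hH : ∀ᶠ M in atTop, ∀ y ∈ F.filter (· ∉ A),
      (K : ℝ≥0∞) ≤ ∑ s ∈ Finset.range M, stayOut step {y} s y := by
    rw [Filter.eventually_all_finset]
    intro y hy
    have hy' : ∑' n, stayOut step {y} n y = ∞ := by
      by_contra hne
      exact (Finset.mem_filter.1 hy).2 hne
    have ht := ENNReal.tendsto_nat_tsum fun s => stayOut step {y} s y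
    rw [hy'] at ht
    exact (ht.eventually (lt_mem_nhds (ENNReal.natCast_lt_top K))).mono fun _ => le_of_lt
  have hH' := (tendsto_add_atTop_nat 1).eventually hH
  filter_upwards [hH', eventually_ge_atTop 1] with M hM hM1
  have h1 : (M : ℝ≥0∞) * stayOut step A M x
      ≤ ∑ t ∈ Finset.range M, (law step (t + 1) x).toOuterMeasure Aᶜ := by
    calc (M : ℝ≥0∞) * stayOut step A M x = ∑ t ∈ Finset.range M, stayOut step A M x := by simp
      _ ≤ _ := Finset.sum_le_sum fun t ht =>
        (stayOut_antitone step A x (Finset.mem_range.1 ht)).trans (stayOut_le_law step A t x)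
  have h2 : ∀ t, (law step t x).toOuterMeasure Aᶜ
      ≤ ∑ y ∈ F.filter (· ∉ A), law step t x y + δ := by
    intro t
    have hsub : Aᶜ ⊆ ((F.filter (· ∉ A) : Finset S) : Set S) ∪ (Aᶜ \ F) := by
      intro y hy
      by_cases hyF : y ∈ F
      · left; simpa [hyF] using hy
      · right; exact ⟨hy, hyF⟩
    refine (measure_mono hsub).trans ((measure_union_le _ _).trans ?_)
    refine add_le_add (PMF.toOuterMeasure_apply_finset _ _).le ?_
    exact (toOuterMeasure_compl_le (hle t) (fun y hy hy' => hy'.2 hy)).trans hF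
  have h3 : ∀ y ∈ F.filter (· ∉ A),
      (∑ t ∈ Finset.range (M + 1), law step t x y) * K ≤ 2 * (M + 1 : ℕ) := fun y hy =>
    le_trans (by gcongr; exact hM y hy) (sum_law_mul_sum_stayOut_le step y x (M + 1))
  have h4 : (K : ℝ≥0∞) * (M * stayOut step A M x) ≤ K * M * ε := by
    calc (K : ℝ≥0∞) * (M * stayOut step A M x)
        ≤ K * ∑ t ∈ Finset.range (M + 1), (∑ y ∈ F.filter (· ∉ A), law step t x y + δ) := by
          gcongr
          refine h1.trans ((Finset.sum_le_sum fun t _ => h2 (t + 1)).trans ?_)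
          rw [Finset.sum_range_succ' (n := M)]
          exact le_self_add
      _ = ∑ y ∈ F.filter (· ∉ A), (∑ t ∈ Finset.range (M + 1), law step t x y) * K
            + K * ((M + 1 : ℕ) * δ) := by
          rw [Finset.sum_add_distrib, Finset.sum_comm, mul_add, Finset.mul_sum]
          simp [mul_comm]
      _ ≤ ∑ y ∈ F.filter (· ∉ A), (2 * (M + 1 : ℕ) : ℝ≥0∞) + K * ((M + 1 : ℕ) * δ) := by
          exact add_le_add (Finset.sum_le_sum h3) le_rfl
      _ ≤ F.card * (2 * (M + 1 : ℕ) : ℝ≥0∞) + K * ((M + 1 : ℕ) * δ) := by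
          rw [Finset.sum_const, nsmul_eq_mul]
          gcongr
          exact Finset.filter_subset _ _
      _ = (2 * F.card) * (M + 1 : ℕ) + K * δ * (M + 1 : ℕ) := by ring
      _ ≤ K * δ * (M + 1 : ℕ) + K * δ * (M + 1 : ℕ) := by gcongr
      _ ≤ K * δ * (2 * M : ℕ) + K * δ * (2 * M : ℕ) := by
          gcongr <;> omega
      _ = K * M * (δ * 4) := by push_cast; ring
      _ = K * M * ε := by rw [hδdef, ENNReal.div_mul_cancel (by simp) (by simp)]
  rw [← mul_assoc] at h4
  have hM0 : (K : ℝ≥0∞) * M ≠ 0 := mul_ne_zero hK0 (by simp; omega)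
  exact (ENNReal.mul_le_mul_iff_right hM0 (ENNReal.mul_ne_top (by simp) (by simp))).1 h4

open Classical in
/-- `taboo step F u x y` is the probability that the chain started at `x` is in `y` at time `u`
and outside of `F` at each of the times `1, …, u`. -/
def taboo (step : S → PMF S) (F : Set S) : ℕ → S → S → ℝ≥0∞
  | 0, x, y => if y = x then 1 else 0
  | u + 1, x, y => ∑' z, step x z * (if z ∈ F then 0 else taboo step F u z y)

open Classical in
lemma taboo_succ (step : S → PMF S) (F : Set S) (u : ℕ) (x y : S) :
    taboo step F (u + 1) x y = ∑' z, step x z * (if z ∈ F then 0 else taboo step F u z y) := by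
  rw [taboo]

lemma tsum_taboo (step : S → PMF S) (F : Set S) (u : ℕ) (x : S) :
    ∑' y, taboo step F u x y = stayOut step F u x := by
  classical
  induction u generalizing x with
  | zero => simp [taboo, stayOut_zero]
  | succ u ih =>
    simp_rw [taboo_succ, stayOut_succ]
    rw [ENNReal.tsum_comm]
    refine tsum_congr fun z => ?_
    rw [ENNReal.tsum_mul_left]
    split_ifs
    · simp
    · rw [ih]

open Classical in
/-- Decomposition at the last visit of `F` up to time `t`. -/
lemma law_le_taboo (step : S → PMF S) (F : Finset S) (t : ℕ) (x y : S) :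
    law step t x y ≤ (if x ∈ F then 0 else taboo step F t x y)
      + ∑ s ∈ Finset.range (t + 1), ∑ z ∈ F, law step s x z * taboo step F (t - s) z y := by
  induction t generalizing x with
  | zero =>
    by_cases hx : x ∈ F
    · rw [Finset.sum_range_one]
      refine le_add_left ((le_of_eq ?_).trans
        (Finset.single_le_sum (f := fun z => law step 0 x z * taboo step F (0 - 0) z y)
          (fun _ _ => zero_le) hx))
      simp [law_zero_apply, taboo]
    · simp [hx, law_zero_apply, taboo]
  | succ t ih =>
    rw [Finset.sum_range_succ', law_succ_apply]
    have h0 : taboo step F (t + 1) x y ≤ (if x ∈ F then 0 else taboo step F (t + 1) x y)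
        + ∑ z ∈ F, law step 0 x z * taboo step F (t + 1 - 0) z y := by
      by_cases hx : x ∈ F
      · refine le_add_left ((le_of_eq ?_).trans
          (Finset.single_le_sum (f := fun z => law step 0 x z * taboo step F (t + 1 - 0) z y)
            (fun _ _ => zero_le) hx))
        simp [law_zero_apply]
      · simp [hx]
    have h1 : ∑ s ∈ Finset.range (t + 1), ∑ z ∈ F, law step (s + 1) x z * taboo step F (t - s) z y
        = ∑' w, step x w *
          ∑ s ∈ Finset.range (t + 1), ∑ z ∈ F, law step s w z * taboo step F (t - s) z y := by
      simp_rw [law_succ_apply, Finset.mul_sum, ← ENNReal.tsum_mul_right]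
      rw [Summable.tsum_finsetSum (fun _ _ => ENNReal.summable)]
      refine Finset.sum_congr rfl fun s _ => ?_
      rw [Summable.tsum_finsetSum (fun _ _ => ENNReal.summable)]
      simp_rw [mul_assoc]
    calc _ ≤ ∑' w, step x w * ((if w ∈ F then 0 else taboo step F t w y)
        + ∑ s ∈ Finset.range (t + 1), ∑ z ∈ F, law step s w z * taboo step F (t - s) z y) :=
          ENNReal.tsum_le_tsum fun w => by gcongr; exact ih w
      _ = taboo step F (t + 1) x y + ∑ s ∈ Finset.range (t + 1),
          ∑ z ∈ F, law step (s + 1) x z * taboo step F (t - s) z y := by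
        simp_rw [mul_add]
        rw [ENNReal.tsum_add, h1, taboo_succ]
        simp
      _ ≤ _ := by
        simp only [Nat.add_sub_add_right]
        rw [add_comm (∑ k ∈ Finset.range (t + 1), _), ← add_assoc]
        gcongr

/-- Foster's criterion. -/
theorem dominated_of_drift {step : S → PMF S} {I F : Set S} {V : S → ℝ≥0∞}
    (hI : ∀ x ∈ I, ∀ y ∈ (step x).support, y ∈ I) (hF : F.Finite) (hFI : F ⊆ I)
    (hfin : ∀ x ∈ I, ∑' y, step x y * V y ≠ ∞)
    (hdrift : ∀ x ∈ I, x ∉ F → ∑' y, step x y * V y + 1 ≤ V x) {x : S} (hx : x ∈ I) :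
    Dominated step x := by
  classical
  -- Outside of F each step lowers V by at least 1 on average, so V bounds the truncated mean
  -- hitting time of F.
  have hout : ∀ n, ∀ x ∈ I, x ∉ F → ∑ u ∈ Finset.range n, stayOut step F u x ≤ V x := by
    intro n
    induction n with
    | zero => simp
    | succ n ih =>
      intro x hx hxF
      refine le_trans ?_ (hdrift x hx hxF)
      rw [Finset.sum_range_succ', stayOut_zero]
      gcongr
      simp_rw [stayOut_succ]
      rw [← Summable.tsum_finsetSum (fun _ _ => ENNReal.summable)]
      refine ENNReal.tsum_le_tsum fun y => ?_
      rw [← Finset.mul_sum]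
      by_cases hy : step x y = 0
      · simp [hy]
      gcongr
      by_cases hyF : y ∈ F
      · simp [hyF]
      · simpa [hyF] using ih y (hI x hx y hy) hyF
  -- From an arbitrary state only the first step is uncontrolled, and V has finite mean after it.
  have hall : ∀ x ∈ I, ∑' u, stayOut step F u x ≠ ∞ := by
    intro x hx
    refine ne_top_of_le_ne_top (ENNReal.add_ne_top.2 ⟨hfin x hx, ENNReal.one_ne_top⟩) ?_
    rw [ENNReal.tsum_eq_iSup_nat]
    refine iSup_le fun n => ?_
    refine (Finset.sum_le_sum_of_subset (Finset.range_mono (Nat.le_succ n))).trans ?_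
    rw [Finset.sum_range_succ', stayOut_zero]
    gcongr
    simp_rw [stayOut_succ]
    rw [← Summable.tsum_finsetSum (fun _ _ => ENNReal.summable)]
    refine ENNReal.tsum_le_tsum fun y => ?_
    rw [← Finset.mul_sum]
    by_cases hy : step x y = 0
    · simp [hy]
    gcongr
    by_cases hyF : y ∈ F
    · simp [hyF]
    · simpa [hyF] using hout n y (hI x hx y hy) hyF
  have htot : ∀ x ∈ I, ∑' y, ∑' u, taboo step F u x y ≠ ∞ := by
    intro x hx
    rw [ENNReal.tsum_comm]
    simp_rw [tsum_taboo]
    exact hall x hx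
  obtain ⟨F, rfl⟩ := hF.exists_finset_coe
  -- The dominating measure is the expected occupation before the next visit of F, from x and from
  -- every state of F. In the last-visit decomposition the probability of being in z ∈ F is simply
  -- bounded by 1.
  refine ⟨fun y => ∑' u, taboo step F u x y + ∑ z ∈ F, ∑' u, taboo step F u z y, ?_, ?_⟩
  · rw [ENNReal.tsum_add, Summable.tsum_finsetSum (fun _ _ => ENNReal.summable)]
    exact ENNReal.add_ne_top.2 ⟨htot x hx, ENNReal.sum_ne_top.2 fun z hz => htot z (hFI hz)⟩
  · intro t y
    refine (law_le_taboo step F t x y).trans (add_le_add ?_ ?_)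
    · split_ifs
      · exact zero_le
      · exact ENNReal.le_tsum t
    · rw [Finset.sum_comm]
      refine Finset.sum_le_sum fun z _ => ?_
      calc _ ≤ ∑ s ∈ Finset.range (t + 1), taboo step F (t + 1 - 1 - s) z y := by
            refine Finset.sum_le_sum fun s _ => ?_
            calc _ ≤ 1 * taboo step F (t - s) z y := by gcongr; exact PMF.coe_le_one _ _
              _ = _ := by simp
        _ = ∑ s ∈ Finset.range (t + 1), taboo step F s z y :=
            Finset.sum_range_reflect (fun s => taboo step F s z y) (t + 1)
        _ ≤ _ := ENNReal.sum_le_tsum _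

end Chain

/-! ### Composed laws, products and the geometric law. -/

section Laws

variable {α β γ : Type*}

lemma bind_congr_support {p : PMF α} {f g : α → PMF β} (h : ∀ a ∈ p.support, f a = g a) :
    p.bind f = p.bind g := by
  ext b
  rw [PMF.bind_apply, PMF.bind_apply]
  refine tsum_congr fun a => ?_
  by_cases ha : p a = 0
  · simp [ha]
  · rw [h a ha]

lemma tsum_bind_mul (p : PMF α) (q : α → PMF β) (f : β → ℝ≥0∞) :
    ∑' b, p.bind q b * f b = ∑' a, p a * ∑' b, q a b * f b := by
  simp_rw [PMF.bind_apply, ← ENNReal.tsum_mul_right, ← ENNReal.tsum_mul_left]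
  rw [ENNReal.tsum_comm]
  simp_rw [mul_assoc]

lemma tsum_pure_mul (a : α) (f : α → ℝ≥0∞) : ∑' b, PMF.pure a b * f b = f a := by
  rw [tsum_eq_single a]
  · simp
  · intro b hb; simp [hb]

lemma tsum_map_mul (p : PMF α) (φ : α → β) (f : β → ℝ≥0∞) :
    ∑' b, p.map φ b * f b = ∑' a, p a * f (φ a) := by
  rw [PMF.map, tsum_bind_mul]
  simp_rw [Function.comp, tsum_pure_mul]

/-! ### Independent families -/

lemma prod_tsum_pi {ι α : Type*} [Fintype ι] (F : ι → α → ℝ≥0∞) :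
    ∏ i, ∑' a, F i a = ∑' x : ι → α, ∏ i, F i (x i) := by
  classical
  refine Fintype.induction_empty_option
    (P := fun ι [Fintype ι] => ∀ F : ι → α → ℝ≥0∞,
      ∏ i, ∑' a, F i a = ∑' x : ι → α, ∏ i, F i (x i)) ?_ ?_ ?_ ι F
  · intro ι κ _ e h F
    let _ := Fintype.ofEquiv _ e.symm
    rw [← e.prod_comp, h, ← (e.arrowCongr (Equiv.refl α)).tsum_eq]
    refine tsum_congr fun x => ?_
    rw [← e.prod_comp]
    simp
  · intro F
    simp
  · intro ι _ h F
    rw [Fintype.prod_option, h, ← ENNReal.tsum_mul_right]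
    simp_rw [← ENNReal.tsum_mul_left]
    rw [← ENNReal.tsum_prod, ← (Equiv.piOptionEquivProd (β := fun _ : Option ι => α)).tsum_eq]
    refine tsum_congr fun x => ?_
    rw [Fintype.prod_option]
    rfl

section Indep

variable {ι : Type*} [Fintype ι] [Countable α] [Countable β]

lemma indep_apply (f : ι → PMF α) (x : ι → α) : indep f x = ∏ i, f i (x i) := rfl

/-- Independent kernels act coordinate by coordinate. This reduces identities for the whole network
to single nodes. -/
lemma indep_bind (f : ι → PMF α) (g : ι → α → PMF β) :
    (indep f).bind (fun x => indep fun i => g i (x i)) = indep fun i => (f i).bind (g i) := by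
  ext z
  simp only [PMF.bind_apply, indep_apply]
  rw [prod_tsum_pi]
  simp_rw [Finset.prod_mul_distrib]

lemma indep_pure (x : ι → α) : (indep fun i => PMF.pure (x i)) = PMF.pure x := by
  classical
  ext y
  rw [indep_apply, PMF.pure_apply]
  simp only [PMF.pure_apply]
  rw [Finset.prod_ite_zero]
  simp [funext_iff]

lemma indep_map (f : ι → PMF α) (φ : ι → α → β) :
    (indep f).map (fun x i => φ i (x i)) = indep fun i => (f i).map (φ i) := by
  simp_rw [PMF.map, Function.comp_def]
  rw [← indep_bind]
  simp_rw [indep_pure]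

lemma indep_map_apply (f : ι → PMF α) (i : ι) : (indep f).map (fun x => x i) = f i := by
  classical
  ext a
  rw [PMF.map_apply]
  have h : ∀ x : ι → α, (if a = x i then indep f x else 0)
      = ∏ j, (f j (x j) * if j = i then (if a = x j then 1 else 0) else 1) := by
    intro x
    rw [Finset.prod_mul_distrib, Finset.prod_ite_eq' ]
    simp [indep_apply]
  simp_rw [h]
  rw [← prod_tsum_pi fun j b => f j b * if j = i then (if a = b then 1 else 0) else 1]
  rw [Finset.prod_eq_single i]
  · simp only [if_true]
    rw [tsum_eq_single a]
    · simp
    · intro b hb; simp [Ne.symm hb]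
  · intro j _ hj
    simp [hj, PMF.tsum_coe]
  · simp

lemma mem_support_indep {f : ι → PMF α} {x : ι → α} :
    x ∈ (indep f).support ↔ ∀ i, x i ∈ (f i).support := by
  simp [PMF.mem_support_iff, indep_apply, Finset.prod_eq_zero_iff]

end Indep

/-! ### Geometric laws -/

section Geometric

variable {η : ℝ} (h0 : 0 < η) (h1 : η ≤ 1)

lemma tsum_geometric_mul (F : ℕ → ℝ≥0∞) :
    ∑' r, geometric η h0 h1 r * F r
      = ∑' k : ℕ, ENNReal.ofReal ((1 - η) ^ k * η) * F (k + 1) :=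
  tsum_map_mul _ _ _

/-- Decomposition of a geometric law at the first trial. -/
lemma tsum_geometric_mul_eq (F : ℕ → ℝ≥0∞) :
    ∑' r, geometric η h0 h1 r * F r = ENNReal.ofReal η * F 1
      + ENNReal.ofReal (1 - η) * ∑' r, geometric η h0 h1 r * F (r + 1) := by
  rw [tsum_geometric_mul, tsum_geometric_mul h0 h1 fun r => F (r + 1),
    tsum_eq_zero_add' ENNReal.summable, ← ENNReal.tsum_mul_left]
  congr 1
  · simp
  · refine tsum_congr fun k => ?_
    rw [← mul_assoc, ← ENNReal.ofReal_mul (sub_nonneg.2 h1)]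
    congr 2
    ring

lemma pos_of_mem_support_geometric {r : ℕ} (hr : r ∈ (geometric η h0 h1).support) : 0 < r := by
  rw [geometric, PMF.mem_support_map_iff] at hr
  obtain ⟨k, _, rfl⟩ := hr
  exact Nat.succ_pos k

lemma mem_support_geometric (hη : η < 1) {r : ℕ} (hr : 0 < r) :
    r ∈ (geometric η h0 h1).support := by
  rw [geometric, PMF.mem_support_map_iff]
  refine ⟨r - 1, ?_, by omega⟩
  rw [PMF.mem_support_iff]
  change ENNReal.ofReal _ ≠ 0
  have : 0 < (1 - η) ^ (r - 1) * η := by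
    have := sub_pos.2 hη
    positivity
  simpa using this

lemma eq_one_of_mem_support_geometric_one {r : ℕ} (hη : ¬ η < 1)
    (hr : r ∈ (geometric η h0 h1).support) : r = 1 := by
  rw [geometric, PMF.mem_support_map_iff] at hr
  obtain ⟨k, hk, rfl⟩ := hr
  rw [PMF.mem_support_iff] at hk
  change ENNReal.ofReal _ ≠ 0 at hk
  have : η = 1 := le_antisymm h1 (not_lt.1 hη)
  subst this
  by_contra hne
  have : k ≠ 0 := by omega
  simp [this] at hk

/-- Geometric laws have no memory. -/
lemma geometric_memoryless {β : Type*} (j : ℕ) (F H : ℕ → β) :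
    ((geometric η h0 h1).bind fun r =>
      if r ≤ j then PMF.pure (F r) else (geometric η h0 h1).map H)
      = (geometric η h0 h1).map fun r => if r ≤ j then F r else H (r - j) := by
  classical
  ext z
  change _ = ((geometric η h0 h1).bind fun r =>
    PMF.pure (if r ≤ j then F r else H (r - j))) z
  rw [PMF.bind_apply, PMF.bind_apply]
  induction j generalizing F with
  | zero =>
    have e : ∀ G : ℕ → PMF β, ∑' r, geometric η h0 h1 r * (if r ≤ 0 then PMF.pure (F r) else G r) z
        = ∑' r, geometric η h0 h1 r * G r z := by
      intro G
      refine tsum_congr fun r => ?_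
      by_cases hr : geometric η h0 h1 r = 0
      · simp [hr]
      · have := pos_of_mem_support_geometric h0 h1 hr
        rw [if_neg (by omega)]
    rw [e fun _ => (geometric η h0 h1).map H, ENNReal.tsum_mul_right, PMF.tsum_coe, one_mul]
    have e2 := e fun r => PMF.pure (H (r - 0))
    calc _ = ∑' r, geometric η h0 h1 r * (PMF.pure (H (r - 0)) : PMF β) z := by
            rw [PMF.map, PMF.bind_apply]; rfl
      _ = _ := by
            rw [← e2]
            refine tsum_congr fun r => ?_
            split_ifs <;> rfl
  | succ j ih =>
    -- The first trial is split off on both sides. A success contributes equally, and after a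
    -- failure the claim for j remains, with F shifted and H unchanged.
    rw [tsum_geometric_mul_eq h0 h1, tsum_geometric_mul_eq h0 h1
      fun r => (PMF.pure (if r ≤ j + 1 then F r else H (r - (j + 1))) : PMF β) z]
    simp only [Nat.add_le_add_iff_right, Nat.add_sub_add_right]
    rw [ih fun r => F (r + 1)]
    congr 1

/-- A geometric law has mean `1 / η`, also when it is revealed only up to `j`. -/
lemma tsum_geometric_mul_truncated (j : ℕ) :
    ∑' r, geometric η h0 h1 r
        * ENNReal.ofReal ((min j r : ℕ) + if j < r then 1 / η else 0)
      = ENNReal.ofReal (1 / η) := by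
  induction j with
  | zero =>
    calc _ = ∑' r, geometric η h0 h1 r * ENNReal.ofReal (1 / η) := by
          refine tsum_congr fun r => ?_
          by_cases hr : geometric η h0 h1 r = 0
          · simp [hr]
          · have := pos_of_mem_support_geometric h0 h1 hr
            simp [this]
      _ = _ := by rw [ENNReal.tsum_mul_right, PMF.tsum_coe, one_mul]
  | succ j ih =>
    rw [tsum_geometric_mul_eq h0 h1]
    have hη : 0 < 1 / η := by positivity
    have e : ∀ r, ENNReal.ofReal ((min (j + 1) (r + 1) : ℕ) + if j + 1 < r + 1 then 1 / η else 0)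
        = 1 + ENNReal.ofReal ((min j r : ℕ) + if j < r then 1 / η else 0) := by
      intro r
      rw [← ENNReal.ofReal_one, ← ENNReal.ofReal_add zero_le_one (by positivity)]
      congr 1
      have : min (j + 1) (r + 1) = min j r + 1 := by omega
      simp [this]
      ring
    have e1 : ENNReal.ofReal ((min (j + 1) 1 : ℕ) + if j + 1 < 1 then 1 / η else 0) = 1 := by
      simp
    rw [e1]
    simp_rw [e, mul_add]
    rw [ENNReal.tsum_add, ih]
    simp only [mul_one, PMF.tsum_coe]
    rw [← ENNReal.ofReal_one, ← ENNReal.ofReal_add zero_le_one hη.le,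
      ← ENNReal.ofReal_mul (sub_nonneg.2 h1),
      ← ENNReal.ofReal_add h0.le (mul_nonneg (sub_nonneg.2 h1) (by positivity))]
    congr 1
    field_simp
    ring

end Geometric

end Laws

/-! ### The law of the hidden file sizes -/

instance (K : ℕ) : Countable (FileRec K) :=
  Function.Injective.countable (f := fun f : FileRec K => (f.type, f.window, f.inMac, f.rest))
    (by rintro ⟨⟩ ⟨⟩ h; simp_all)

instance (K : ℕ) : Countable (FileObs K) :=
  Function.Injective.countable (f := fun f : FileObs K => (f.type, f.window, f.inMac, f.active))
    (by rintro ⟨⟩ ⟨⟩ h; simp_all)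

section Hidden

variable {V : Type*} {K : ℕ} (T : Traffic V K)

/-- Law of the file behind an observation: active files have geometric remaining sizes. -/
def hiddenFile (f : FileObs K) : PMF (FileRec K) :=
  if f.active then (geometric (T.η f.type) (T.η_pos _) (T.η_le_one _)).map
    fun r => ⟨f.type, f.window, f.inMac, r⟩
  else PMF.pure ⟨f.type, f.window, f.inMac, 0⟩

/-- Law of the files behind a list of observations. -/
def hiddenList : List (FileObs K) → PMF (List (FileRec K))
  | [] => PMF.pure []
  | f :: fs => (hiddenFile T f).bind fun a => (hiddenList fs).map fun l => a :: l

/-- Law of the configuration behind an observation. -/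
def hidden [Fintype V] (o : ConfigObs V K) : PMF (Config V K) :=
  (indep fun n => hiddenList T (o.files n)).map fun fs => ⟨o.transit, fs⟩

lemma obs_of_mem_hiddenFile {f : FileObs K} {a : FileRec K}
    (h : a ∈ (hiddenFile T f).support) : a.obs = f := by
  unfold hiddenFile at h
  split_ifs at h with hf
  · rw [PMF.mem_support_map_iff] at h
    obtain ⟨r, hr, rfl⟩ := h
    have := pos_of_mem_support_geometric _ _ hr
    rcases f with ⟨t, w, i, b⟩
    simp_all [FileRec.obs]
  · rw [PMF.mem_support_pure_iff] at h
    subst h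
    rcases f with ⟨t, w, i, b⟩
    simp_all [FileRec.obs]

lemma obs_of_mem_hiddenList {fs : List (FileObs K)} {l : List (FileRec K)}
    (h : l ∈ (hiddenList T fs).support) : l.map FileRec.obs = fs := by
  induction fs generalizing l with
  | nil =>
    rw [hiddenList, PMF.mem_support_pure_iff] at h
    simp [h]
  | cons f fs ih =>
    rw [hiddenList, PMF.mem_support_bind_iff] at h
    obtain ⟨a, ha, h⟩ := h
    rw [PMF.mem_support_map_iff] at h
    obtain ⟨l, hl, rfl⟩ := h
    simp [obs_of_mem_hiddenFile T ha, ih hl]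

lemma obs_of_mem_hidden [Fintype V] {o : ConfigObs V K} {c : Config V K}
    (h : c ∈ (hidden T o).support) : c.obs = o := by
  rw [hidden, PMF.mem_support_map_iff] at h
  obtain ⟨fs, hfs, rfl⟩ := h
  rw [mem_support_indep] at hfs
  rcases o with ⟨t, g⟩
  simp only [Config.obs, ConfigObs.mk.injEq, true_and]
  exact funext fun n => obs_of_mem_hiddenList T (hfs n)

/-- For η = 1 the geometric law charges only the value 1, so larger remainders have to be excluded.
Positive mass is what permits conditioning on a given configuration. -/
lemma mem_hiddenFile {f : FileRec K} (h : 0 < f.rest → T.η f.type < 1) :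
    f ∈ (hiddenFile T f.obs).support := by
  unfold hiddenFile
  split_ifs with hf
  · have hr : 0 < f.rest := by simpa [FileRec.obs] using hf
    rw [PMF.mem_support_map_iff]
    exact ⟨f.rest, mem_support_geometric _ _ (h hr) hr, rfl⟩
  · have hr : f.rest = 0 := by simpa [FileRec.obs] using hf
    rw [PMF.mem_support_pure_iff]
    rcases f with ⟨t, w, i, b⟩
    simp_all [FileRec.obs]

lemma mem_hiddenList {l : List (FileRec K)} (h : ∀ f ∈ l, 0 < f.rest → T.η f.type < 1) :
    l ∈ (hiddenList T (l.map FileRec.obs)).support := by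
  induction l with
  | nil => simp [hiddenList]
  | cons f l ih =>
    rw [List.map_cons, hiddenList, PMF.mem_support_bind_iff]
    refine ⟨f, mem_hiddenFile T (h f (by simp)), ?_⟩
    rw [PMF.mem_support_map_iff]
    exact ⟨l, ih fun f hf => h f (by simp [hf]), rfl⟩

lemma mem_hidden [Fintype V] {c : Config V K}
    (h : ∀ n, ∀ f ∈ c.files n, 0 < f.rest → T.η f.type < 1) :
    c ∈ (hidden T c.obs).support := by
  rw [hidden, PMF.mem_support_map_iff]
  exact ⟨c.files, mem_support_indep.2 fun n => mem_hiddenList T (h n), rfl⟩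

lemma hiddenList_append (fs gs : List (FileObs K)) :
    hiddenList T (fs ++ gs)
      = (hiddenList T fs).bind fun l => (hiddenList T gs).map fun l' => l ++ l' := by
  induction fs with
  | nil =>
    rw [List.nil_append, hiddenList, PMF.pure_bind]
    exact (PMF.map_id _).symm
  | cons f fs ih =>
    rw [List.cons_append, hiddenList, hiddenList, ih]
    simp only [PMF.bind_bind, PMF.map_bind, PMF.bind_map, PMF.map_comp, Function.comp_def,
      List.cons_append]

/-- Observation of the files at a node after transmissions. -/
def serveObs (fs : List (FileObs K)) (k : List ℕ) : List (FileObs K) :=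
  (List.zipWith (fun (f : FileObs K) a => { f with inMac := f.inMac - a }) fs k).filter
    fun f => decide (0 < f.inMac ∨ f.active)

lemma serveFiles_cons (f : FileRec K) (fs : List (FileRec K)) (a : ℕ) (k : List ℕ) :
    Network.serveFiles (f :: fs) (a :: k)
      = if 0 < f.inMac - a ∨ 0 < f.rest then
          { f with inMac := f.inMac - a } :: Network.serveFiles fs k
        else Network.serveFiles fs k := by
  simp only [Network.serveFiles, List.zipWith_cons_cons, List.filter_cons]
  simp

lemma serveObs_cons (f : FileObs K) (fs : List (FileObs K)) (a : ℕ) (k : List ℕ) :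
    serveObs (f :: fs) (a :: k)
      = if 0 < f.inMac - a ∨ f.active then
          { f with inMac := f.inMac - a } :: serveObs fs k
        else serveObs fs k := by
  simp only [serveObs, List.zipWith_cons_cons, List.filter_cons]
  simp

lemma hiddenFile_map_serve (f : FileObs K) (a : ℕ) :
    (hiddenFile T f).map (fun f => { f with inMac := f.inMac - a })
      = hiddenFile T { f with inMac := f.inMac - a } := by
  unfold hiddenFile
  simp only
  split_ifs
  · simp [PMF.map_comp, Function.comp_def]
  · simp [PMF.pure_map]

lemma map_map_cons {α β : Type*} (p : PMF (List α)) (q : List α → List β) (b : β) :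
    p.map (fun l => b :: q l) = (p.map q).map fun l => b :: l := by
  simp [PMF.map_comp, Function.comp_def]

/-- Service alters only `inMac`, and whether a file departs depends on `inMac` and `active`. Both
are observed, so nothing is learned about the remainders. -/
lemma hiddenList_map_serve (fs : List (FileObs K)) (k : List ℕ) :
    (hiddenList T fs).map (fun l => Network.serveFiles l k) = hiddenList T (serveObs fs k) := by
  induction fs generalizing k with
  | nil => simp [hiddenList, serveObs, Network.serveFiles, PMF.pure_map]
  | cons f fs ih =>
    cases k with
    | nil =>
      simp only [Network.serveFiles, serveObs, List.zipWith_nil_right, List.filter_nil, hiddenList]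
      exact PMF.map_const _ _
    | cons a k =>
      rw [hiddenList, PMF.map_bind]
      simp only [PMF.map_comp, Function.comp_def]
      have h1 : ∀ b ∈ (hiddenFile T f).support,
          (hiddenList T fs).map (fun l => Network.serveFiles (b :: l) (a :: k))
          = if 0 < f.inMac - a ∨ f.active then
              (hiddenList T (serveObs fs k)).map
                fun l => (fun f => { f with inMac := f.inMac - a }) b :: l
            else hiddenList T (serveObs fs k) := by
        intro b hb
        have := obs_of_mem_hiddenFile T hb
        subst this
        simp only [serveFiles_cons, ← ih k]
        simp only [FileRec.obs, decide_eq_true_eq]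
        split_ifs
        · rw [map_map_cons]
        · rfl
      rw [bind_congr_support h1, serveObs_cons]
      split_ifs
      · rw [hiddenList, ← hiddenFile_map_serve, PMF.bind_map]
        rfl
      · rw [PMF.bind_const]

lemma hiddenFile_active (t : Fin K) (w i : ℕ) : hiddenFile T ⟨t, w, i, true⟩
    = (geometric (T.η t) (T.η_pos t) (T.η_le_one t)).map fun r => ⟨t, w, i, r⟩ := rfl

lemma hiddenFile_inactive (t : Fin K) (w i : ℕ) :
    hiddenFile T ⟨t, w, i, false⟩ = PMF.pure ⟨t, w, i, 0⟩ := rfl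

lemma inject_mk (t : Fin K) (u i r w : ℕ) : (⟨t, u, i, r⟩ : FileRec K).inject w
    = if r ≤ w - i then ⟨t, w, i + r, 0⟩ else ⟨t, w, i + (w - i), r - (w - i)⟩ := by
  unfold FileRec.inject
  split_ifs with h
  · simp [min_eq_right h]
  · simp [min_eq_left (not_le.1 h).le]

lemma obs_inject_mk (t : Fin K) (u i r w : ℕ) : ((⟨t, u, i, r⟩ : FileRec K).inject w).obs
    = if r ≤ w - i then ⟨t, w, i + r, false⟩ else ⟨t, w, i + (w - i), true⟩ := by
  rw [inject_mk]
  split_ifs with h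
  · simp [FileRec.obs]
  · have : 0 < r - (w - i) := by omega
    simp [FileRec.obs, this]

/-- Filling the window reveals whether the remainder exceeds the free space. If it does, the excess
is again geometric. -/
lemma hiddenFile_map_inject (f : FileObs K) (w : ℕ) :
    (hiddenFile T f).map (fun a => a.inject w)
      = ((hiddenFile T f).map fun a => (a.inject w).obs).bind (hiddenFile T) := by
  rcases f with ⟨t, u, i, b⟩
  cases b with
  | false =>
    rw [hiddenFile_inactive, PMF.pure_map, PMF.pure_map, PMF.pure_bind, obs_inject_mk, inject_mk]
    simp [hiddenFile_inactive]
  | true =>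
    rw [hiddenFile_active, PMF.map_comp, PMF.map_comp, PMF.bind_map]
    simp only [Function.comp_def, obs_inject_mk]
    simp only [inject_mk]
    -- The free space `w - i` is a truncated difference: if the new window lies below `inMac`,
    -- nothing is injected and nothing is revealed.
    rw [← geometric_memoryless _ _ (w - i) (fun r => (⟨t, w, i + r, 0⟩ : FileRec K))
      fun r => ⟨t, w, i + (w - i), r⟩]
    congr 1
    funext r
    split_ifs
    · rw [hiddenFile_inactive]
    · rw [hiddenFile_active]

lemma hiddenList_map_inject (fs : List (FileObs K)) (w : List ℕ) :
    (hiddenList T fs).map (fun l => List.zipWith FileRec.inject l w)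
      = ((hiddenList T fs).map fun l => (List.zipWith FileRec.inject l w).map FileRec.obs).bind
          (hiddenList T) := by
  induction fs generalizing w with
  | nil => simp [hiddenList, PMF.pure_map, PMF.pure_bind]
  | cons f fs ih =>
    cases w with
    | nil =>
      simp only [List.zipWith_nil_right, List.map_nil]
      have e : ∀ {β : Type _} (p : PMF (List (FileRec K))) (b : β),
        p.map (fun _ => b) = PMF.pure b := fun p b => PMF.map_const _ _
      rw [e, e, PMF.pure_bind, hiddenList]
    | cons a w =>
      simp only [hiddenList, PMF.map_bind, PMF.map_comp, Function.comp_def,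
        List.zipWith_cons_cons, List.map_cons, PMF.bind_map, PMF.bind_bind]
      have h1 : ∀ b : FileRec K, (hiddenList T fs).map
          (fun l => b.inject a :: List.zipWith FileRec.inject l w)
          = ((hiddenList T fs).map fun l => (List.zipWith FileRec.inject l w).map FileRec.obs).bind
            fun l' => (hiddenList T l').map fun l => b.inject a :: l := by
        intro b
        rw [map_map_cons _ (fun l => List.zipWith FileRec.inject l w), ih w, PMF.map_bind]
      simp_rw [h1]
      -- The observation of the other files is drawn first, so that the first file can be resampled
      -- with everything else fixed.
      rw [PMF.bind_comm]
      have h2 : ∀ l', ((hiddenFile T f).bind fun b =>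
          (hiddenList T l').map fun l => b.inject a :: l)
          = (hiddenFile T f).bind fun b => (hiddenFile T (b.inject a).obs).bind fun b' =>
            (hiddenList T l').map fun l => b' :: l := by
        intro l'
        have := congrArg (fun p => PMF.bind p fun b' => (hiddenList T l').map fun l => b' :: l)
          (hiddenFile_map_inject T f a)
        simpa only [PMF.bind_map, PMF.bind_bind, Function.comp_def] using this
      simp_rw [h2, PMF.bind_map, Function.comp_def]
      rw [PMF.bind_comm]

end Hidden

/-! ### The observed Markov chain and its intertwining with the network chain. -/

section Observed

variable {V : Type*} {K : ℕ} (T : Traffic V K)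

/-- Observation of a file that has just arrived. -/
def newObs (a : Fin K × ℕ) : FileObs K := ⟨a.1, 0, 0, decide (0 < a.2)⟩

/-- The record of a file that has just arrived. -/
def newRec (a : Fin K × ℕ) : FileRec K := ⟨a.1, 0, 0, a.2⟩

/-- A new file is almost surely nonempty, so its observation discloses the type only, and its size
may be drawn afresh. -/
lemma newFile_map_newRec (s : V) :
    (T.newFile s).map newRec = (T.newFile s).bind fun a => hiddenFile T (newObs a) := by
  rw [Traffic.newFile, PMF.map_bind, PMF.bind_bind]
  congr 1
  funext i
  rw [PMF.map_comp, PMF.bind_map]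
  have : ∀ r ∈ (geometric (T.η i) (T.η_pos i) (T.η_le_one i)).support,
      ((fun a => hiddenFile T (newObs a)) ∘ fun size => (i, size)) r
        = hiddenFile T ⟨i, 0, 0, true⟩ := by
    intro r hr
    simp [newObs, pos_of_mem_support_geometric _ _ hr]
  rw [bind_congr_support this, PMF.bind_const]
  rfl

lemma iidList_map_newRec (s : V) (k : ℕ) :
    (iidList (T.newFile s) k).map (fun l => l.map newRec)
      = (iidList (T.newFile s) k).bind fun l => hiddenList T (l.map newObs) := by
  induction k with
  | zero => simp [iidList, PMF.pure_map, PMF.pure_bind, hiddenList]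
  | succ k ih =>
    simp only [iidList, PMF.map_bind, PMF.map_comp, PMF.bind_bind, PMF.bind_map, Function.comp_def,
      List.map_cons, hiddenList]
    have h1 : ∀ b : Fin K × ℕ, (iidList (T.newFile s) k).map (fun l => newRec b :: l.map newRec)
        = (iidList (T.newFile s) k).bind fun l =>
          (hiddenList T (l.map newObs)).map fun l' => newRec b :: l' := by
      intro b
      rw [map_map_cons _ (fun l => l.map newRec), ih, PMF.map_bind]
    simp_rw [h1]
    rw [PMF.bind_comm]
    have h2 : ∀ l : List (Fin K × ℕ), ((T.newFile s).bind fun a =>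
        (hiddenList T (l.map newObs)).map fun l' => newRec a :: l')
        = (T.newFile s).bind fun a => (hiddenFile T (newObs a)).bind fun b =>
          (hiddenList T (l.map newObs)).map fun l' => b :: l' := by
      intro l
      have := congrArg (fun p => PMF.bind p fun b =>
        (hiddenList T (l.map newObs)).map fun l' => b :: l') (newFile_map_newRec T s)
      simpa only [PMF.bind_map, PMF.bind_bind, Function.comp_def] using this
    simp_rw [h2]
    rw [PMF.bind_comm]

open Classical in
/-- Law of the new files at a node. -/
def newFilesAt (sources : Finset V) (s : V) : PMF (List (Fin K × ℕ)) :=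
  if s ∈ sources then (T.arrivals s).bind fun k => iidList (T.newFile s) k else PMF.pure []

lemma newFiles_eq [Fintype V] (sources : Finset V) :
    T.newFiles sources = indep (newFilesAt T sources) := rfl

lemma newFilesAt_map_newRec (sources : Finset V) (s : V) :
    (newFilesAt T sources s).map (fun l => l.map newRec)
      = (newFilesAt T sources s).bind fun l => hiddenList T (l.map newObs) := by
  unfold newFilesAt
  split_ifs
  · rw [PMF.map_bind, PMF.bind_bind]
    simp_rw [iidList_map_newRec]
  · simp [PMF.pure_map, PMF.pure_bind, hiddenList]

variable [Fintype V]

lemma hidden_map_inject (o : ConfigObs V K) (w : V → List ℕ) :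
    (hidden T o).map (fun c => c.inject w)
      = ((hidden T o).map fun c => (c.inject w).obs).bind (hidden T) := by
  have h1 : (hidden T o).map (fun c => c.inject w)
      = (indep fun n => (hiddenList T (o.files n)).map fun l =>
          List.zipWith FileRec.inject l (w n)).map fun fs => ⟨o.transit, fs⟩ := by
    rw [← indep_map _ fun n l => List.zipWith FileRec.inject l (w n), hidden, PMF.map_comp,
      PMF.map_comp]
    rfl
  have h2 : (hidden T o).map (fun c => (c.inject w).obs)
      = (indep fun n => (hiddenList T (o.files n)).map fun l =>
          (List.zipWith FileRec.inject l (w n)).map FileRec.obs).map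
            fun fs => ⟨o.transit, fs⟩ := by
    rw [← indep_map _ fun n l => (List.zipWith FileRec.inject l (w n)).map FileRec.obs, hidden,
      PMF.map_comp, PMF.map_comp]
    rfl
  rw [h1, h2, PMF.bind_map]
  simp_rw [hiddenList_map_inject]
  rw [← indep_bind, PMF.map_bind]
  rfl

variable [DecidableEq V] {N : Network V}

/-- Observed configuration after transmissions and file arrivals. -/
def afterObs (N : Network V) (o : ConfigObs V K) (D : Decision V) (k : V → List ℕ)
    (new : V → List (Fin K × ℕ)) : ConfigObs V K where
  transit := N.transitAfter o D k
  files n := serveObs (o.files n) (k n) ++ (new n).map newObs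

lemma hidden_afterArrivals (o : ConfigObs V K) (D : Decision V) (k : V → List ℕ) :
    ((hidden T o).bind fun c => (T.newFiles N.sources).map fun new => N.afterArrivals c D k new)
      = (T.newFiles N.sources).bind fun new => hidden T (afterObs N o D k new) := by
  have h1 : ∀ c ∈ (hidden T o).support,
      ((T.newFiles N.sources).map fun new => N.afterArrivals c D k new)
        = ((T.newFiles N.sources).map fun new n =>
            Network.serveFiles (c.files n) (k n) ++ (new n).map newRec).map
              fun fs => ⟨N.transitAfter o D k, fs⟩ := by
    intro c hc
    rw [PMF.map_comp, ← obs_of_mem_hidden T hc]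
    rfl
  rw [bind_congr_support h1, ← PMF.map_bind]
  have h2 : ∀ new, hidden T (afterObs N o D k new)
      = (indep fun n => hiddenList T (serveObs (o.files n) (k n) ++ (new n).map newObs)).map
          fun fs => ⟨N.transitAfter o D k, fs⟩ := fun new => rfl
  simp_rw [h2]
  rw [← PMF.map_bind]
  congr 1
  rw [newFiles_eq, hidden, PMF.bind_map]
  simp only [Function.comp_def]
  rw [indep_bind (newFilesAt T N.sources)
    fun n (l : List (Fin K × ℕ)) =>
      hiddenList T (serveObs (o.files n) (k n) ++ l.map newObs)]
  have h3 : ∀ fs : V → List (FileRec K), ((indep (newFilesAt T N.sources)).map fun new n =>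
      Network.serveFiles (fs n) (k n) ++ (new n).map newRec)
      = indep fun n => (newFilesAt T N.sources n).map fun l =>
          Network.serveFiles (fs n) (k n) ++ l.map newRec := fun fs =>
    indep_map _ fun n (l : List (Fin K × ℕ)) => Network.serveFiles (fs n) (k n) ++ l.map newRec
  simp_rw [h3]
  rw [indep_bind (fun n => hiddenList T (o.files n)) fun n a =>
    (newFilesAt T N.sources n).map fun l => Network.serveFiles a (k n) ++ l.map newRec]
  congr 1
  funext n
  simp_rw [hiddenList_append, ← hiddenList_map_serve]
  rw [PMF.bind_comm]
  rw [PMF.bind_map]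
  congr 1
  funext a
  have := congrArg (fun p => PMF.map (fun l => Network.serveFiles a (k n) ++ l) p)
    (newFilesAt_map_newRec T N.sources n)
  simpa only [PMF.map_comp, PMF.map_bind, Function.comp_def] using this

variable {g : ℝ → ℝ} {Wcong : ℕ} (C : Control N K g Wcong)

/-- The observed part of the network, when the remaining sizes of active files are geometric,
is a Markov chain with this transition law. -/
def Control.obsStep (x : ConfigObs V K × C.Mem) : PMF (ConfigObs V K × C.Mem) :=
  (C.schedule x.1 x.2).bind fun D =>
  (C.serve x.1 x.2 D).bind fun k =>
  (T.newFiles N.sources).bind fun new =>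
  (C.window x.1 x.2 D k (afterObs N x.1 D k new)).bind fun w =>
  ((hidden T (afterObs N x.1 D k new)).map fun c => (c.inject w).obs).bind fun fin =>
  (C.update x.1 x.2 D k (afterObs N x.1 D k new) fin).map fun m' => (fin, m')

/-- Law of the network state behind an observed state. -/
def hiddenState {M : Type*} (x : ConfigObs V K × M) : PMF (Config V K × M) :=
  (hidden T x.1).map fun c => (c, x.2)

/-- Every rule of the control sees observations only. On the support of the hidden law these are
fixed, so decisions can be drawn before the hidden sizes; service, arrivals and injection then carry
hidden laws into mixtures of hidden laws. -/
lemma obsStep_bind_hiddenState (x : ConfigObs V K × C.Mem) :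
    (hiddenState T x).bind (C.step T) = (C.obsStep T x).bind (hiddenState T) := by
  obtain ⟨o, m⟩ := x
  rw [hiddenState, PMF.bind_map]
  set X : Decision V → (V → List ℕ) → Config V K → PMF (Config V K × C.Mem) := fun D k mid =>
    (C.window o m D k mid.obs).bind fun w =>
      (C.update o m D k mid.obs (mid.inject w).obs).map fun m' => (mid.inject w, m') with hX
  have h1 : ∀ c ∈ (hidden T o).support, (C.step T ∘ fun c => (c, m)) c
      = (C.schedule o m).bind fun D => (C.serve o m D).bind fun k =>
        ((T.newFiles N.sources).map fun new => N.afterArrivals c D k new).bind (X D k) := by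
    intro c hc
    simp only [Function.comp_apply, Control.step, obs_of_mem_hidden T hc, PMF.bind_map, hX]
    rfl
  rw [bind_congr_support h1, PMF.bind_comm]
  simp only [Control.obsStep, PMF.bind_bind]
  congr 1
  funext D
  rw [PMF.bind_comm]
  congr 1
  funext k
  rw [← PMF.bind_bind, hidden_afterArrivals, PMF.bind_bind]
  congr 1
  funext new
  set mid := afterObs N o D k new
  have h2 : ∀ c ∈ (hidden T mid).support, X D k c = (C.window o m D k mid).bind fun w =>
      (C.update o m D k mid (c.inject w).obs).map fun m' => (c.inject w, m') := by
    intro c hc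
    simp only [hX, obs_of_mem_hidden T hc]
  rw [bind_congr_support h2, PMF.bind_comm]
  congr 1
  funext w
  -- After injection only the final observation is kept and the remainders are resampled from its
  -- hidden law; the memory update depends on that observation alone.
  have h3 := congrArg (fun p => PMF.bind p fun fin : Config V K =>
    (C.update o m D k mid fin.obs).map fun m' => (fin, m')) (hidden_map_inject T mid w)
  simp only [PMF.bind_map, PMF.bind_bind, Function.comp_def] at h3
  rw [h3]
  simp only [PMF.bind_map, Function.comp_def, hiddenState]
  congr 1
  funext c
  set fin := (c.inject w).obs
  have h4 : ∀ a ∈ (hidden T fin).support,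
      ((C.update o m D k mid a.obs).map fun m' => (a, m'))
        = (C.update o m D k mid fin).map fun m' => (a, m') := by
    intro a ha
    rw [obs_of_mem_hidden T ha]
  rw [bind_congr_support h4]
  simp only [PMF.map, Function.comp_def]
  rw [PMF.bind_comm]

lemma law_bind_hiddenState (t : ℕ) (x : ConfigObs V K × C.Mem) :
    (hiddenState T x).bind (law (C.step T) t) = (law (C.obsStep T) t x).bind (hiddenState T) := by
  induction t generalizing x with
  | zero => exact (PMF.bind_pure _).trans (PMF.pure_bind _ _).symm
  | succ t ih =>
    change ((hiddenState T x).bind fun y => (C.step T y).bind (law (C.step T) t))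
      = ((C.obsStep T x).bind (law (C.obsStep T) t)).bind (hiddenState T)
    rw [← PMF.bind_bind, obsStep_bind_hiddenState, PMF.bind_bind, PMF.bind_bind]
    simp_rw [ih]

/-- Domination for the observed chain carries over to the network chain. -/
lemma dominated_of_obs {c : Config V K} {m : C.Mem}
    (hc : ∀ n, ∀ f ∈ c.files n, 0 < f.rest → T.η f.type < 1)
    (h : Dominated (C.obsStep T) (c.obs, m)) : Dominated (C.step T) (c, m) := by
  obtain ⟨μ, hμ, hle⟩ := h
  -- The chain started at c is the chain started from the hidden law, conditioned on an event of
  -- probability p > 0. This costs a factor 1/p, uniformly in time.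
  set p := hiddenState T (c.obs, m) (c, m) with hp
  have hp0 : p ≠ 0 := by
    have : (c, m) ∈ (hiddenState T (c.obs, m)).support := by
      rw [hiddenState, PMF.mem_support_map_iff]
      exact ⟨c, mem_hidden T hc, rfl⟩
    exact this
  have hpt : p ≠ ∞ := PMF.apply_ne_top _ _
  refine ⟨fun y => p⁻¹ * ∑' x, μ x * hiddenState T x y, ?_, fun t y => ?_⟩
  · rw [ENNReal.tsum_mul_left, ENNReal.tsum_comm]
    simp_rw [ENNReal.tsum_mul_left, PMF.tsum_coe, mul_one]
    exact ENNReal.mul_ne_top (ENNReal.inv_ne_top.2 hp0) hμ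
  · have h1 : p * law (C.step T) t (c, m) y ≤ ∑' x, μ x * hiddenState T x y := by
      calc _ ≤ ((hiddenState T (c.obs, m)).bind (law (C.step T) t)) y := by
            rw [PMF.bind_apply]
            exact ENNReal.le_tsum (f := fun x => hiddenState T (c.obs, m) x * law (C.step T) t x y) _
        _ = ∑' x, law (C.obsStep T) t (c.obs, m) x * hiddenState T x y := by
            rw [law_bind_hiddenState, PMF.bind_apply]
        _ ≤ _ := ENNReal.tsum_le_tsum fun x => by gcongr; exact hle t x
    calc _ = p⁻¹ * (p * law (C.step T) t (c, m) y) := by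
          rw [← mul_assoc, ENNReal.inv_mul_cancel hp0 hpt, one_mul]
      _ ≤ _ := mul_le_mul_right h1 _

end Observed

/-! ### Invariance of the valid configurations; finiteness for bounded queues. -/

section Validity

variable {V : Type*} {K : ℕ} {T : Traffic V K}

lemma exists_of_mem_zipWith {α β γ : Type*} {f : α → β → γ} {l : List α} {l' : List β} {c : γ}
    (h : c ∈ List.zipWith f l l') : ∃ a ∈ l, ∃ b ∈ l', c = f a b := by
  induction l generalizing l' with
  | nil => simp at h
  | cons a l ih =>
    cases l' with
    | nil => simp at h
    | cons b l' =>
      rw [List.zipWith_cons_cons, List.mem_cons] at h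
      rcases h with rfl | h
      · exact ⟨a, by simp, b, by simp, rfl⟩
      · obtain ⟨a', ha, b', hb, rfl⟩ := ih h
        exact ⟨a', by simp [ha], b', by simp [hb], rfl⟩

lemma exists_of_mem_serveFiles {fs : List (FileRec K)} {k : List ℕ} {f : FileRec K}
    (h : f ∈ Network.serveFiles fs k) :
    (∃ f₀ ∈ fs, ∃ a, f = { f₀ with inMac := f₀.inMac - a }) ∧ (0 < f.inMac ∨ 0 < f.rest) := by
  rw [Network.serveFiles, List.mem_filter] at h
  obtain ⟨f₀, h₀, a, -, rfl⟩ := exists_of_mem_zipWith h.1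
  exact ⟨⟨f₀, h₀, a, rfl⟩, by simpa using h.2⟩

lemma mem_support_newFile {s : V} {a : Fin K × ℕ} (h : a ∈ (T.newFile s).support) :
    a.2 ∈ (geometric (T.η a.1) (T.η_pos a.1) (T.η_le_one a.1)).support := by
  rw [Traffic.newFile, PMF.mem_support_bind_iff] at h
  obtain ⟨i, -, h⟩ := h
  rw [PMF.mem_support_map_iff] at h
  obtain ⟨r, hr, rfl⟩ := h
  exact hr

lemma mem_support_of_mem_iidList {α : Type*} {p : PMF α} {k : ℕ} {l : List α}
    (h : l ∈ (iidList p k).support) : ∀ a ∈ l, a ∈ p.support := by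
  induction k generalizing l with
  | zero =>
    rw [iidList, PMF.mem_support_pure_iff] at h
    simp [h]
  | succ k ih =>
    rw [iidList, PMF.mem_support_bind_iff] at h
    obtain ⟨a, ha, h⟩ := h
    rw [PMF.mem_support_map_iff] at h
    obtain ⟨l, hl, rfl⟩ := h
    intro b hb
    rcases List.mem_cons.1 hb with rfl | hb
    · exact ha
    · exact ih hl b hb

lemma mem_support_newFilesAt {sources : Finset V} {s : V} {l : List (Fin K × ℕ)}
    (h : l ∈ (newFilesAt T sources s).support) {a : Fin K × ℕ} (ha : a ∈ l) :
    s ∈ sources ∧ a.2 ∈ (geometric (T.η a.1) (T.η_pos a.1) (T.η_le_one a.1)).support := by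
  unfold newFilesAt at h
  split_ifs at h with hs
  · rw [PMF.mem_support_bind_iff] at h
    obtain ⟨k, -, h⟩ := h
    exact ⟨hs, mem_support_newFile (mem_support_of_mem_iidList h a ha)⟩
  · rw [PMF.mem_support_pure_iff] at h
    simp [h] at ha

variable {N : Network V} {Wcong : ℕ}

/-- The routes of the packets of destination `d`. -/
def Network.Route (N : Network V) (d a b : V) : Prop :=
  Relation.ReflTransGen (fun a b => N.next d a = some b) a b

/-- Validity depends on the remaining sizes only through their being positive. -/
lemma Network.Valid.congr_obs {c c' : Config V K} (hc : N.Valid T Wcong c)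
    (h : c'.obs = c.obs) : N.Valid T Wcong c' := by
  rcases c with ⟨t, fs⟩
  rcases c' with ⟨t', fs'⟩
  simp only [Config.obs, ConfigObs.mk.injEq] at h
  obtain ⟨rfl, hfs⟩ := h
  have key : ∀ n, ∀ f ∈ fs' n, ∃ f' ∈ fs n, f'.obs = f.obs := by
    intro n f hf
    have : f.obs ∈ (fs' n).map FileRec.obs := List.mem_map_of_mem hf
    rw [congrFun hfs n] at this
    exact List.mem_map.1 this
  constructor
  · exact hc.transit_route
  · intro n hn
    have h1 := congrFun hfs n
    have h2 : fs n = [] := hc.files_source n hn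
    simpa [h2] using h1
  all_goals
    intro n f hf
    obtain ⟨f', hf', he⟩ := key n f hf
    simp only [FileRec.obs, FileObs.mk.injEq, decide_eq_decide] at he
    obtain ⟨h1, h2, h3, h4⟩ := he
  · exact h2 ▸ hc.window_pos n f' hf'
  · exact h2 ▸ hc.window_le n f' hf'
  · exact h3 ▸ hc.inMac_pos n f' hf'
  · exact h3 ▸ hc.inMac_le n f' hf'
  · exact fun hr => h2 ▸ h3 ▸ hc.window_full n f' hf' (h4.2 hr)
  · exact fun hr => h1 ▸ hc.rest_type n f' hf' (h4.2 hr)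

section

variable [DecidableEq V]

lemma Network.Valid.queue_route {c : Config V K} (hc : N.Valid T Wcong c) {n d : V}
    (h : N.queue c.obs n d ≠ 0) : n ≠ d ∧ ∃ s ∈ N.sources, N.dest s = d ∧ N.Route d s n := by
  by_cases ht : c.transit n d = 0
  · rw [Network.queue] at h
    have ht' : c.obs.transit n d = 0 := ht
    by_cases hn : n ∈ N.sources ∧ d = N.dest n
    · obtain ⟨hn, rfl⟩ := hn
      exact ⟨(N.dest_ne n hn).symm, n, hn, rfl, Relation.ReflTransGen.refl⟩
    · rw [if_neg hn, ht'] at h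
      exact absurd rfl h
  · exact hc.transit_route n d ht

end

variable [Fintype V] [DecidableEq V]

lemma Network.transitAfter_route {c : Config V K} (hc : N.Valid T Wcong c) (D : Decision V)
    (k : V → List ℕ) {n d : V} (h : N.transitAfter c.obs D k n d ≠ 0) :
    n ≠ d ∧ ∃ s ∈ N.sources, N.dest s = d ∧ N.Route d s n := by
  by_cases ht : c.transit n d = 0
  · have ht' : c.obs.transit n d = 0 := ht
    rw [Network.transitAfter, ht', Nat.zero_sub, zero_add] at h
    obtain ⟨i, -, hi⟩ := Finset.exists_ne_zero_of_sum_ne_zero h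
    split_ifs at hi with hin
    · have hq : N.queue c.obs i d ≠ 0 := by
        intro h0
        simp [Network.sent, h0] at hi
      obtain ⟨-, s, hs, hd, hr⟩ := hc.queue_route hq
      exact ⟨hin.2, s, hs, hd, hr.tail hin.1⟩
    · exact absurd rfl hi
  · exact hc.transit_route n d ht

/-- Validity is preserved in a slot. -/
lemma Network.Valid.step {c : Config V K} (hc : N.Valid T Wcong c) (D : Decision V)
    (k : V → List ℕ) {new : V → List (Fin K × ℕ)} (hnew : new ∈ (T.newFiles N.sources).support)
    {w : V → List ℕ} (hw : ∀ n, ∀ a ∈ w n, 1 ≤ a ∧ a ≤ Wcong) :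
    N.Valid T Wcong ((N.afterArrivals c D k new).inject w) := by
  rw [newFiles_eq, mem_support_indep] at hnew
  have key : ∀ n, ∀ f ∈ ((N.afterArrivals c D k new).inject w).files n,
      ∃ f' : FileRec K, ∃ a, f = f'.inject a ∧ 1 ≤ a ∧ a ≤ Wcong ∧ n ∈ N.sources ∧
        f'.inMac ≤ Wcong ∧ (0 < f'.inMac ∨ 0 < f'.rest) ∧
        (0 < f'.rest → T.η f'.type < 1 ∨ f'.rest = 1 ∧ f'.inMac = 0) := by
    intro n f hf
    obtain ⟨f', hf', a, ha, rfl⟩ := exists_of_mem_zipWith hf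
    refine ⟨f', a, rfl, (hw n a ha).1, (hw n a ha).2, ?_⟩
    change f' ∈ Network.serveFiles (c.files n) (k n) ++ (new n).map newRec at hf'
    rcases List.mem_append.1 hf' with h | h
    · obtain ⟨⟨f₀, h₀, b, rfl⟩, h'⟩ := exists_of_mem_serveFiles h
      refine ⟨?_, (Nat.sub_le _ _).trans (hc.inMac_le n f₀ h₀), h',
        fun hr => Or.inl (hc.rest_type n f₀ h₀ hr)⟩
      by_contra hn
      simp [hc.files_source n hn] at h₀
    · obtain ⟨b, hb, rfl⟩ := List.mem_map.1 h
      obtain ⟨hs, hg⟩ := mem_support_newFilesAt (hnew n) hb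
      refine ⟨hs, Nat.zero_le _, Or.inr (pos_of_mem_support_geometric _ _ hg), fun _ => ?_⟩
      by_cases hη : T.η b.1 < 1
      · exact Or.inl hη
      · exact Or.inr ⟨eq_one_of_mem_support_geometric_one _ _ hη hg, rfl⟩
  constructor
  · exact fun n d h => Network.transitAfter_route hc D k h
  · intro n hn
    by_contra hne
    obtain ⟨f, hf⟩ := List.exists_mem_of_ne_nil _ hne
    obtain ⟨_, _, _, _, _, hs, _⟩ := key n f hf
    exact hn hs
  all_goals
    intro n f hf
    obtain ⟨f', a, rfl, ha1, haW, -, hW, hpos, hη⟩ := key n f hf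
    simp only [FileRec.inject]
    try omega
  -- The condition on η is left. The exceptional case is a new file with η = 1: its only packet is
  -- injected at once, because windows are at least 1.
  intro hr
  have hr' : 0 < f'.rest := by omega
  rcases hη hr' with h | h
  · exact h
  · omega

/-- The observations of valid configurations. -/
def ObsValid (N : Network V) (T : Traffic V K) (Wcong : ℕ) (o : ConfigObs V K) : Prop :=
  ∃ c : Config V K, N.Valid T Wcong c ∧ c.obs = o

variable {g : ℝ → ℝ} (C : Control N K g Wcong)

lemma Control.valid_of_mem_step {x y : Config V K × C.Mem} (hx : N.Valid T Wcong x.1)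
    (hy : y ∈ (C.step T x).support) : N.Valid T Wcong y.1 ∧ y.2 ∈ C.info y.1.obs := by
  simp only [Control.step, PMF.mem_support_bind_iff, PMF.mem_support_map_iff] at hy
  obtain ⟨D, -, k, -, new, hnew, w, hw, m', hm', rfl⟩ := hy
  exact ⟨hx.step D k hnew (C.window_mem _ _ _ _ _ w hw), C.update_mem _ _ _ _ _ _ m' hm'⟩

/-- The observed states that can occur. -/
def Control.obsStates (T : Traffic V K) : Set (ConfigObs V K × C.Mem) :=
  {x | ObsValid N T Wcong x.1 ∧ x.2 ∈ C.info x.1}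

/-- By the intertwining relation an observed transition lifts to a transition of the network chain,
where validity is known to be preserved. -/
lemma Control.obsStates_invariant {x y : ConfigObs V K × C.Mem} (hx : x ∈ C.obsStates T)
    (hy : y ∈ (C.obsStep T x).support) : y ∈ C.obsStates T := by
  obtain ⟨⟨c, hc, hco⟩, -⟩ := hx
  obtain ⟨c', hc'⟩ := (hidden T y.1).support_nonempty
  have h1 : (c', y.2) ∈ ((C.obsStep T x).bind (hiddenState T)).support := by
    rw [PMF.mem_support_bind_iff]
    refine ⟨y, hy, ?_⟩
    rw [hiddenState, PMF.mem_support_map_iff]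
    exact ⟨c', hc', rfl⟩
  rw [← obsStep_bind_hiddenState, PMF.mem_support_bind_iff] at h1
  obtain ⟨z, hz, hs⟩ := h1
  rw [hiddenState, PMF.mem_support_map_iff] at hz
  obtain ⟨c₀, hc₀, rfl⟩ := hz
  have hv : N.Valid T Wcong c₀ := hc.congr_obs ((obs_of_mem_hidden T hc₀).trans hco.symm)
  obtain ⟨h2, h3⟩ := C.valid_of_mem_step hv hs
  have h4 := obs_of_mem_hidden T hc'
  exact ⟨⟨c', h2, h4⟩, h4 ▸ h3⟩

lemma finite_lists {α : Type*} {s : Set α} (hs : s.Finite) (n : ℕ) :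
    {l : List α | l.length ≤ n ∧ ∀ a ∈ l, a ∈ s}.Finite := by
  have : Finite s := hs
  refine ((List.finite_length_le s n).image (List.map Subtype.val)).subset ?_
  rintro l ⟨hl, hs⟩
  exact ⟨l.attach.map fun a => ⟨a.1, hs a.1 a.2⟩, by simpa using hl, by simp⟩

lemma length_le_sum_inMac {l : List (FileObs K)} (h : ∀ f ∈ l, 1 ≤ f.inMac) :
    l.length ≤ (l.map FileObs.inMac).sum := by
  induction l with
  | nil => simp
  | cons f l ih =>
    have h1 := ih fun f hf => h f (by simp [hf])
    have h2 := h f (by simp)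
    simp only [List.length_cons, List.map_cons, List.sum_cons]
    omega

/-- There are finitely many observed states with bounded queues. -/
lemma Control.finite_obsStates (T : Traffic V K) (B : ℕ) :
    {x ∈ C.obsStates T | ∀ n d, N.queue x.1 n d ≤ B}.Finite := by
  have hobs : {f : FileObs K | f.window ≤ Wcong ∧ f.inMac ≤ Wcong}.Finite := by
    refine (Set.Finite.image (fun p : (Fin K × Bool) × ℕ × ℕ =>
      (⟨p.1.1, p.2.1, p.2.2, p.1.2⟩ : FileObs K))
      (Set.finite_univ.prod ((Set.finite_Iic Wcong).prod (Set.finite_Iic Wcong)))).subset ?_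
    rintro ⟨t, w, i, b⟩ ⟨hw, hi⟩
    exact ⟨((t, b), w, i), by simpa using ⟨hw, hi⟩, rfl⟩
  have h1 : {o : ConfigObs V K | ObsValid N T Wcong o ∧ ∀ n d, N.queue o n d ≤ B}.Finite := by
    have hA : (Set.univ.pi fun _ : V => Set.univ.pi fun _ : V => Set.Iic B).Finite :=
      Set.Finite.pi fun _ => Set.Finite.pi fun _ => Set.finite_Iic B
    have hB : (Set.univ.pi fun _ : V => {l : List (FileObs K) | l.length ≤ B ∧
        ∀ a ∈ l, a ∈ {f : FileObs K | f.window ≤ Wcong ∧ f.inMac ≤ Wcong}}).Finite :=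
      Set.Finite.pi fun _ => finite_lists hobs B
    refine ((hA.prod hB).image fun p => (⟨p.1, p.2⟩ : ConfigObs V K)).subset ?_
    rintro o ⟨⟨c, hc, rfl⟩, hq⟩
    refine ⟨(c.obs.transit, c.obs.files), ⟨?_, ?_⟩, rfl⟩
    · intro n _ d _
      exact le_trans (Nat.le_add_right _ _) (hq n d)
    · intro n _
      refine ⟨?_, ?_⟩
      · by_cases hn : n ∈ N.sources
        · have h2 := hq n (N.dest n)
          rw [Network.queue, if_pos ⟨hn, rfl⟩] at h2
          -- Each file keeps a packet in the ingress queue, so a bounded queue bounds the number of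
          -- files.
          have h3 : (c.obs.files n).length ≤ _ := length_le_sum_inMac (l := c.obs.files n) (by
            intro f hf
            obtain ⟨f', hf', rfl⟩ := List.mem_map.1 hf
            exact hc.inMac_pos n f' hf')
          exact h3.trans (le_trans (Nat.le_add_left _ _) h2)
        · simp [Config.obs, hc.files_source n hn]
      · intro f hf
        obtain ⟨f', hf', rfl⟩ := List.mem_map.1 hf
        exact ⟨hc.window_le n f' hf', hc.inMac_le n f' hf'⟩
  refine (h1.biUnion fun o _ => (C.info_finite o).image fun m => (o, m)).subset ?_
  rintro ⟨o, m⟩ ⟨⟨hv, hm⟩, hq⟩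
  exact Set.mem_biUnion (x := o) ⟨hv, hq⟩ ⟨m, hm, rfl⟩

end Validity

/-! ### Upper bounds of means -/

section Mean

variable {α β : Type*} {p : PMF α} {f f' : α → ℝ} {a a' b c : ℝ}

/-- The mean of `f` under `p` is at most `a`, for a function `f` that is bounded below. -/
def MeanLE (p : PMF α) (f : α → ℝ) (a : ℝ) : Prop :=
  ∃ b : ℝ, (∀ x ∈ p.support, -b ≤ f x) ∧ -b ≤ a ∧
    ∑' x, p x * ENNReal.ofReal (f x + b) ≤ ENNReal.ofReal (a + b)

lemma tsum_congr_support {F F' : α → ℝ≥0∞} (h : ∀ x ∈ p.support, F x = F' x) :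
    ∑' x, p x * F x = ∑' x, p x * F' x := by
  refine tsum_congr fun x => ?_
  by_cases hx : p x = 0
  · simp [hx]
  · rw [h x hx]

lemma tsum_le_support {F F' : α → ℝ≥0∞} (h : ∀ x ∈ p.support, F x ≤ F' x) :
    ∑' x, p x * F x ≤ ∑' x, p x * F' x := by
  refine ENNReal.tsum_le_tsum fun x => ?_
  by_cases hx : p x = 0
  · simp [hx]
  · exact mul_le_mul_right (h x hx) _

lemma tsum_mul_add_const (F : α → ℝ≥0∞) (c : ℝ≥0∞) :
    ∑' x, p x * (F x + c) = ∑' x, p x * F x + c := by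
  simp_rw [mul_add]
  rw [ENNReal.tsum_add, ENNReal.tsum_mul_right, p.tsum_coe, one_mul]

lemma tsum_ofReal_shift {b b' : ℝ} (hb : ∀ x ∈ p.support, -b ≤ f x) (h : b ≤ b') :
    ∑' x, p x * ENNReal.ofReal (f x + b')
      = ∑' x, p x * ENNReal.ofReal (f x + b) + ENNReal.ofReal (b' - b) := by
  rw [← tsum_mul_add_const]
  refine tsum_congr_support fun x hx => ?_
  rw [← ENNReal.ofReal_add (by linarith [hb x hx]) (by linarith)]
  congr 1
  ring

/-- The lower bound in `MeanLE` is immaterial: changing it moves both sides by the same finite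
constant, which can be added or cancelled. -/
lemma MeanLE.shift (h : MeanLE p f a) (hb : ∀ x ∈ p.support, -b ≤ f x) :
    -b ≤ a ∧ ∑' x, p x * ENNReal.ofReal (f x + b) ≤ ENNReal.ofReal (a + b) := by
  obtain ⟨b₀, h0, ha, hs⟩ := h
  rcases le_total b₀ b with hle | hle
  · refine ⟨by linarith, ?_⟩
    rw [tsum_ofReal_shift h0 hle]
    calc _ ≤ ENNReal.ofReal (a + b₀) + ENNReal.ofReal (b - b₀) := by gcongr
      _ = _ := by
        rw [← ENNReal.ofReal_add (by linarith) (by linarith)]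
        congr 1; ring
  · rw [tsum_ofReal_shift hb hle] at hs
    have h1 : b₀ - b ≤ a + b₀ :=
      (ENNReal.ofReal_le_ofReal_iff (by linarith)).1 (le_add_self.trans hs)
    refine ⟨by linarith, ?_⟩
    have h2 : ENNReal.ofReal (a + b₀) = ENNReal.ofReal (a + b) + ENNReal.ofReal (b₀ - b) := by
      rw [← ENNReal.ofReal_add (by linarith) (by linarith)]
      congr 1; ring
    rw [h2] at hs
    exact (ENNReal.add_le_add_iff_right ENNReal.ofReal_ne_top).1 hs

lemma MeanLE.tsum_ofReal_le (h : MeanLE p f a) (hf : ∀ x ∈ p.support, 0 ≤ f x) :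
    ∑' x, p x * ENNReal.ofReal (f x) ≤ ENNReal.ofReal a := by
  simpa using (h.shift (b := 0) (by simpa using hf)).2

lemma MeanLE.of_tsum_le (hf : ∀ x ∈ p.support, 0 ≤ f x) (ha : 0 ≤ a)
    (h : ∑' x, p x * ENNReal.ofReal (f x) ≤ ENNReal.ofReal a) : MeanLE p f a :=
  ⟨0, by simpa using hf, by simpa using ha, by simpa using h⟩

lemma MeanLE.const (p : PMF α) (c : ℝ) : MeanLE p (fun _ => c) c :=
  ⟨-c, by simp, by simp, by simp⟩

lemma MeanLE.mono (h : MeanLE p f' a') (hb : ∀ x ∈ p.support, b ≤ f x)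
    (hf : ∀ x ∈ p.support, f x ≤ f' x) (ha : a' ≤ a) : MeanLE p f a := by
  obtain ⟨h1, h2⟩ := h.shift (b := -b) fun x hx => by linarith [hb x hx, hf x hx]
  refine ⟨-b, fun x hx => by simpa using hb x hx, by linarith, ?_⟩
  calc _ ≤ ∑' x, p x * ENNReal.ofReal (f' x + -b) :=
        tsum_le_support fun x hx => ENNReal.ofReal_le_ofReal (by linarith [hf x hx])
    _ ≤ _ := h2.trans (ENNReal.ofReal_le_ofReal (by linarith))

lemma MeanLE.le (h : MeanLE p f a') (ha : a' ≤ a) : MeanLE p f a := by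
  obtain ⟨b, hb, -⟩ := id h
  exact h.mono (b := -b) hb (fun _ _ => le_rfl) ha

lemma MeanLE.of_le (hb : ∀ x ∈ p.support, b ≤ f x) (h : ∀ x ∈ p.support, f x ≤ a) :
    MeanLE p f a :=
  (MeanLE.const p a).mono hb h le_rfl

lemma MeanLE.congr (h : MeanLE p f a) (hf : ∀ x ∈ p.support, f' x = f x) (ha : a' = a) :
    MeanLE p f' a' := by
  obtain ⟨b, hb, -⟩ := id h
  exact h.mono (b := -b) (fun x hx => hf x hx ▸ hb x hx) (fun x hx => (hf x hx).le) ha.ge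

lemma MeanLE.add (h : MeanLE p f a) (h' : MeanLE p f' a') :
    MeanLE p (fun x => f x + f' x) (a + a') := by
  obtain ⟨b, h0, ha, hs⟩ := h
  obtain ⟨b', h0', ha', hs'⟩ := h'
  refine ⟨b + b', fun x hx => by linarith [h0 x hx, h0' x hx], by linarith, ?_⟩
  calc _ = ∑' x, p x * (ENNReal.ofReal (f x + b) + ENNReal.ofReal (f' x + b')) := by
        refine tsum_congr_support fun x hx => ?_
        rw [← ENNReal.ofReal_add (by linarith [h0 x hx]) (by linarith [h0' x hx])]
        congr 1; ring
    _ ≤ ENNReal.ofReal (a + b) + ENNReal.ofReal (a' + b') := by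
        simp_rw [mul_add]
        rw [ENNReal.tsum_add]
        exact add_le_add hs hs'
    _ = _ := by
        rw [← ENNReal.ofReal_add (by linarith) (by linarith)]
        congr 1; ring

lemma MeanLE.add_const (h : MeanLE p f a) (c : ℝ) : MeanLE p (fun x => f x + c) (a + c) :=
  h.add (MeanLE.const p c)

lemma MeanLE.const_mul (h : MeanLE p f a) (hc : 0 ≤ c) :
    MeanLE p (fun x => c * f x) (c * a) := by
  obtain ⟨b, h0, ha, hs⟩ := h
  refine ⟨c * b, fun x hx => by nlinarith [h0 x hx], by nlinarith, ?_⟩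
  simp_rw [← mul_add, ENNReal.ofReal_mul hc]
  simp_rw [mul_left_comm _ (ENNReal.ofReal c)]
  rw [ENNReal.tsum_mul_left]
  gcongr

lemma MeanLE.sum {ι : Type*} {s : Finset ι} {f : ι → α → ℝ} {a : ι → ℝ}
    (h : ∀ i ∈ s, MeanLE p (f i) (a i)) :
    MeanLE p (fun x => ∑ i ∈ s, f i x) (∑ i ∈ s, a i) := by
  classical
  induction s using Finset.induction_on with
  | empty => simpa using MeanLE.const p 0
  | insert i s hi ih =>
    simp only [Finset.sum_insert hi]
    exact (h i (by simp)).add (ih fun j hj => h j (by simp [hj]))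

lemma MeanLE.bind {q : α → PMF β} {f : β → ℝ} {φ : α → ℝ}
    (h : ∀ x ∈ p.support, MeanLE (q x) f (φ x)) (hb : ∀ y ∈ (p.bind q).support, b ≤ f y)
    (h' : MeanLE p φ a) : MeanLE (p.bind q) f a := by
  have hx : ∀ x ∈ p.support, ∀ y ∈ (q x).support, - -b ≤ f y := fun x hx y hy => by
    rw [neg_neg]
    exact hb y ((PMF.mem_support_bind_iff _ _ _).2 ⟨x, hx, hy⟩)
  have h1 := fun x hxs => (h x hxs).shift (hx x hxs)
  obtain ⟨h2, h3⟩ := h'.shift fun x hxs => (h1 x hxs).1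
  refine ⟨-b, fun y hy => by simpa using hb y hy, h2, ?_⟩
  rw [tsum_bind_mul]
  exact (tsum_le_support fun x hxs => (h1 x hxs).2).trans h3

lemma MeanLE.map {φ : α → β} {f : β → ℝ} (h : MeanLE p (fun x => f (φ x)) a) :
    MeanLE (p.map φ) f a := by
  obtain ⟨b, h0, ha, hs⟩ := h
  refine ⟨b, fun y hy => ?_, ha, ?_⟩
  · obtain ⟨x, hx, rfl⟩ := (PMF.mem_support_map_iff _ _ _).1 hy
    exact h0 x hx
  · rwa [tsum_map_mul]

lemma MeanLE.of_map {φ : α → β} {f : β → ℝ} (h : MeanLE (p.map φ) f a) :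
    MeanLE p (fun x => f (φ x)) a := by
  obtain ⟨b, h0, ha, hs⟩ := h
  refine ⟨b, fun x hx => h0 _ ((PMF.mem_support_map_iff _ _ _).2 ⟨x, hx, rfl⟩), ha, ?_⟩
  rwa [tsum_map_mul] at hs

/-- A bounded function with known mean, multiplied by a constant of any sign. -/
lemma MeanLE.of_tsum_eq {B : ℝ} (hf : ∀ x ∈ p.support, 0 ≤ f x) (hB : ∀ x ∈ p.support, f x ≤ B)
    (ha : 0 ≤ a) (h : ∑' x, p x * ENNReal.ofReal (f x) = ENNReal.ofReal a) (c : ℝ) :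
    MeanLE p (fun x => c * (f x - a)) 0 := by
  have h1 : MeanLE p f a := MeanLE.of_tsum_le hf ha h.le
  obtain ⟨x₀, hx₀⟩ := p.support_nonempty
  have hB0 : 0 ≤ B := (hf x₀ hx₀).trans (hB x₀ hx₀)
  -- The equality for f gives an upper bound for the mean of B - f as well, which serves the
  -- negative multiples.
  have h3 : ∑' x, p x * ENNReal.ofReal (B - f x) + ENNReal.ofReal a = ENNReal.ofReal B := by
    rw [← h, ← ENNReal.tsum_add]
    simp_rw [← mul_add]
    rw [tsum_congr_support (F' := fun _ => ENNReal.ofReal B), ENNReal.tsum_mul_right, p.tsum_coe,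
      one_mul]
    intro x hx
    rw [← ENNReal.ofReal_add (by linarith [hB x hx]) (hf x hx)]
    congr 1; ring
  have haB : a ≤ B := (ENNReal.ofReal_le_ofReal_iff hB0).1 (h3 ▸ le_add_self)
  have h2 : MeanLE p (fun x => B - f x) (B - a) := by
    refine MeanLE.of_tsum_le (fun x hx => by linarith [hB x hx]) (by linarith) ?_
    have h4 : ENNReal.ofReal B = ENNReal.ofReal (B - a) + ENNReal.ofReal a := by
      rw [← ENNReal.ofReal_add (by linarith) ha]
      congr 1; ring
    rw [h4] at h3
    exact (ENNReal.add_left_inj ENNReal.ofReal_ne_top).1 h3 |>.le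
  rcases le_total 0 c with hc | hc
  · exact ((h1.add_const (-a)).const_mul hc).congr (fun x _ => by ring) (by ring)
  · exact ((h2.add_const (a - B)).const_mul (neg_nonneg.2 hc)).congr
      (fun x _ => by ring) (by ring)

/-- Completing the square. It supplies the lower bound that `MeanLE` requires when the linear
coefficient has any sign. -/
lemma quadratic_lower_bound (α : ℝ) {β : ℝ} (hβ : 0 < β) (s : ℝ) :
    -(α ^ 2 / (4 * β)) ≤ α * s + β * s ^ 2 := by
  have : α * s + β * s ^ 2 + α ^ 2 / (4 * β) = (2 * β * s + α) ^ 2 / (4 * β) := by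
    field_simp
    ring
  have h2 : 0 ≤ (2 * β * s + α) ^ 2 / (4 * β) := by positivity
  linarith

end Mean

/-! ### Expected backlogs -/

section Backlog

variable {V : Type*} {K : ℕ} (T : Traffic V K)

/-- Expected number of packets of a file with given observation. -/
def backlog (f : FileObs K) : ℝ := f.inMac + if f.active then 1 / T.η f.type else 0

/-- Expected number of packets of several files with given observations. -/
def totalBacklog (fs : List (FileObs K)) : ℝ := (fs.map (backlog T)).sum

/-- A bound for the mean file sizes. -/
def sizeBound : ℝ := ∑ i, 1 / T.η i

lemma one_div_eta_pos (i : Fin K) : 0 < 1 / T.η i := one_div_pos.2 (T.η_pos i)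

lemma one_div_eta_le (i : Fin K) : 1 / T.η i ≤ sizeBound T :=
  Finset.single_le_sum (f := fun i => 1 / T.η i) (fun i _ => (one_div_eta_pos T i).le)
    (Finset.mem_univ i)

lemma sizeBound_nonneg : 0 ≤ sizeBound T :=
  Finset.sum_nonneg fun i _ => (one_div_eta_pos T i).le

lemma inMac_le_backlog (f : FileObs K) : (f.inMac : ℝ) ≤ backlog T f := by
  unfold backlog
  split_ifs
  · linarith [one_div_eta_pos T f.type]
  · simp

lemma backlog_le (f : FileObs K) : backlog T f ≤ f.inMac + sizeBound T := by
  unfold backlog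
  split_ifs
  · linarith [one_div_eta_le T f.type]
  · linarith [sizeBound_nonneg T]

lemma backlog_obs_inject (t : Fin K) (u i r w : ℕ) :
    backlog T ((⟨t, u, i, r⟩ : FileRec K).inject w).obs
      = i + ((min (w - i) r : ℕ) + if w - i < r then 1 / T.η t else 0) := by
  rw [obs_inject_mk]
  by_cases h : r ≤ w - i
  · rw [if_pos h, if_neg (not_lt.2 h), min_eq_right h]
    simp [backlog]
  · rw [if_neg h, if_pos (not_le.1 h), min_eq_left (not_le.1 h).le]
    simp only [backlog, if_true]
    push_cast
    ring

lemma abs_backlog_inject_sub_le {f : FileObs K} {a : FileRec K}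
    (ha : a ∈ (hiddenFile T f).support) (w : ℕ) :
    |backlog T (a.inject w).obs - backlog T f| ≤ w + sizeBound T := by
  have hobs := obs_of_mem_hiddenFile T ha
  subst hobs
  rcases a with ⟨t, u, i, r⟩
  rw [backlog_obs_inject]
  have h1 := one_div_eta_pos T t
  have h2 := one_div_eta_le T t
  have h3 : ((min (w - i) r : ℕ) : ℝ) ≤ w := by exact_mod_cast (by omega)
  have h4 : (0 : ℝ) ≤ (min (w - i) r : ℕ) := by positivity
  simp only [backlog, FileRec.obs, decide_eq_true_eq]
  rw [abs_le]
  split_ifs <;> first | omega | (constructor <;> linarith)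

/-- Packets that are revealed, plus 1/η if some are still unseen, have mean 1/η. An arbitrary sign
of c is needed for the cross terms of a sum of several files. -/
lemma hiddenFile_mean (f : FileObs K) (w : ℕ) (c : ℝ) :
    MeanLE (hiddenFile T f) (fun a => c * (backlog T (a.inject w).obs - backlog T f)) 0 := by
  rcases f with ⟨t, u, i, b⟩
  cases b with
  | false =>
    rw [hiddenFile_inactive]
    refine (MeanLE.const _ 0).congr (fun a ha => ?_) rfl
    rw [PMF.mem_support_pure_iff] at ha
    subst ha
    rw [backlog_obs_inject]
    simp [backlog]
  | true =>
    rw [hiddenFile_active]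
    refine MeanLE.map ?_
    have h := MeanLE.of_tsum_eq (p := geometric (T.η t) (T.η_pos t) (T.η_le_one t))
      (f := fun r => ((min (w - i) r : ℕ) + if w - i < r then 1 / T.η t else 0))
      (B := w + 1 / T.η t) ?_ ?_ (one_div_eta_pos T t).le
      (tsum_geometric_mul_truncated _ _ (w - i)) c
    · refine h.congr (fun r _ => ?_) rfl
      rw [backlog_obs_inject]
      simp only [backlog, if_true]
      ring
    · intro r _
      have := one_div_eta_pos T t
      positivity
    · intro r _
      have h1 := one_div_eta_pos T t
      have h3 : ((min (w - i) r : ℕ) : ℝ) ≤ w := by exact_mod_cast (by omega)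
      split_ifs <;> linarith

lemma hiddenFile_mean_quadratic (f : FileObs K) {w Wcong : ℕ} (hw : w ≤ Wcong) (c : ℝ) {β : ℝ}
    (hβ : 0 < β) :
    MeanLE (hiddenFile T f) (fun a => c * (backlog T (a.inject w).obs - backlog T f)
      + β * (backlog T (a.inject w).obs - backlog T f) ^ 2) (β * (Wcong + sizeBound T) ^ 2) := by
  have h := (hiddenFile_mean T f w c).add_const (β * (Wcong + sizeBound T) ^ 2)
  refine h.mono (fun a _ => quadratic_lower_bound c hβ _) (fun a ha => ?_) (by simp)
  have h1 := abs_backlog_inject_sub_le T ha w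
  have h2 : (w : ℝ) ≤ Wcong := by exact_mod_cast hw
  have h3 : (backlog T (a.inject w).obs - backlog T f) ^ 2 ≤ (Wcong + sizeBound T) ^ 2 :=
    sq_le_sq' (by linarith [(abs_le.1 h1).1]) (by linarith [(abs_le.1 h1).2])
  linarith [mul_le_mul_of_nonneg_left h3 hβ.le]

/-- Injection of packets into the MAC layer does not change the expected backlog, with a variance
proportional to the number of files. -/
lemma hiddenList_mean_quadratic (fs : List (FileObs K)) {w : List ℕ} {Wcong : ℕ}
    (hl : w.length = fs.length) (hw : ∀ a ∈ w, a ≤ Wcong) (c : ℝ) {β : ℝ} (hβ : 0 < β) :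
    MeanLE (hiddenList T fs)
      (fun l => c * (totalBacklog T ((List.zipWith FileRec.inject l w).map FileRec.obs)
          - totalBacklog T fs)
        + β * (totalBacklog T ((List.zipWith FileRec.inject l w).map FileRec.obs)
          - totalBacklog T fs) ^ 2)
      (fs.length * (β * (Wcong + sizeBound T) ^ 2)) := by
  induction fs generalizing w c with
  | nil =>
    refine (MeanLE.const _ 0).congr (fun l hl => ?_) (by simp)
    rw [hiddenList, PMF.mem_support_pure_iff] at hl
    simp [hl, totalBacklog]
  | cons f fs ih =>
    cases w with
    | nil => simp at hl
    | cons a w =>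
      set s := β * (Wcong + sizeBound T) ^ 2 with hs
      rw [hiddenList]
      refine MeanLE.bind (φ := fun b => (c * (backlog T (b.inject a).obs - backlog T f)
        + β * (backlog T (b.inject a).obs - backlog T f) ^ 2) + fs.length * s) (fun b _ => ?_)
        (fun l _ => quadratic_lower_bound c hβ _) ?_
      · refine MeanLE.map ?_
        set ξ := backlog T (b.inject a).obs - backlog T f with hξ
        -- Expanding β(ξ + S)², with S the change of the other files, gives a cross term 2βξS. It is
        -- absorbed into the linear coefficient, whence the induction over all c.
        have := (ih (w := w) (by simpa using hl) (fun a ha => hw a (by simp [ha]))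
          (c + 2 * β * ξ)).add_const (c * ξ + β * ξ ^ 2)
        refine this.congr (fun l _ => ?_) (by ring)
        have e : totalBacklog T ((List.zipWith FileRec.inject (b :: l) (a :: w)).map FileRec.obs)
            - totalBacklog T (f :: fs) = ξ +
            (totalBacklog T ((List.zipWith FileRec.inject l w).map FileRec.obs)
              - totalBacklog T fs) := by
          simp only [totalBacklog, List.zipWith_cons_cons, List.map_cons, List.sum_cons, hξ]
          ring
        rw [e]
        ring
      · refine ((hiddenFile_mean_quadratic T f (hw a (by simp)) c hβ).add_const _).le ?_
        simp only [List.length_cons, Nat.cast_add, Nat.cast_one]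
        linarith

end Backlog

/-! ### Moments of the traffic that arrives in a slot. -/

section NewFiles

variable {V : Type*} {K : ℕ} (T : Traffic V K)

lemma meanSize_nonneg (s : V) : 0 ≤ T.meanSize s :=
  Finset.sum_nonneg fun i _ => div_nonneg ENNReal.toReal_nonneg (T.η_pos i).le

lemma newFile_mean (s : V) :
    MeanLE (T.newFile s) (fun a => backlog T (newObs a)) (T.meanSize s) := by
  have h1 : MeanLE (T.fileType s) (fun i => 1 / T.η i) (T.meanSize s) := by
    refine MeanLE.of_tsum_le (fun i _ => (one_div_eta_pos T i).le) (meanSize_nonneg T s) ?_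
    rw [tsum_fintype, Traffic.meanSize, ENNReal.ofReal_sum_of_nonneg
      fun i _ => div_nonneg ENNReal.toReal_nonneg (T.η_pos i).le]
    refine Finset.sum_le_sum fun i _ => ?_
    rw [div_eq_mul_one_div (ENNReal.toReal _), ENNReal.ofReal_mul ENNReal.toReal_nonneg,
      ENNReal.ofReal_toReal (PMF.apply_ne_top _ _)]
  have hnn : ∀ a : Fin K × ℕ, 0 ≤ backlog T (newObs a) := fun a =>
    le_trans (Nat.cast_nonneg _) (inMac_le_backlog T _)
  refine MeanLE.bind (fun i _ => ?_) (fun a _ => hnn a) h1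
  refine MeanLE.map (MeanLE.of_le (fun r _ => hnn _) fun r _ => ?_)
  have := one_div_eta_pos T i
  simp only [backlog, newObs, Nat.cast_zero, zero_add, decide_eq_true_eq]
  by_cases hr : 0 < r
  · rw [if_pos hr]
  · rw [if_neg hr]
    exact this.le

lemma length_of_mem_iidList {α : Type*} {p : PMF α} {k : ℕ} {l : List α}
    (h : l ∈ (iidList p k).support) : l.length = k := by
  induction k generalizing l with
  | zero =>
    rw [iidList, PMF.mem_support_pure_iff] at h
    simp [h]
  | succ k ih =>
    rw [iidList, PMF.mem_support_bind_iff] at h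
    obtain ⟨a, ha, h⟩ := h
    rw [PMF.mem_support_map_iff] at h
    obtain ⟨l, hl, rfl⟩ := h
    simp [ih hl]

lemma totalBacklog_cons (f : FileObs K) (fs : List (FileObs K)) :
    totalBacklog T (f :: fs) = backlog T f + totalBacklog T fs := by
  simp [totalBacklog]

lemma totalBacklog_append (fs gs : List (FileObs K)) :
    totalBacklog T (fs ++ gs) = totalBacklog T fs + totalBacklog T gs := by
  simp [totalBacklog]

lemma backlog_nonneg (f : FileObs K) : 0 ≤ backlog T f :=
  le_trans (Nat.cast_nonneg _) (inMac_le_backlog T _)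

lemma totalBacklog_nonneg (fs : List (FileObs K)) : 0 ≤ totalBacklog T fs :=
  List.sum_nonneg fun x hx => by
    obtain ⟨f, -, rfl⟩ := List.mem_map.1 hx
    exact backlog_nonneg T f

lemma sum_inMac_le_totalBacklog (fs : List (FileObs K)) :
    ((fs.map FileObs.inMac).sum : ℝ) ≤ totalBacklog T fs := by
  induction fs with
  | nil => simp [totalBacklog]
  | cons f fs ih =>
    rw [totalBacklog_cons, List.map_cons, List.sum_cons, Nat.cast_add]
    exact add_le_add (inMac_le_backlog T f) ih

lemma totalBacklog_le (fs : List (FileObs K)) :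
    totalBacklog T fs ≤ (fs.map FileObs.inMac).sum + fs.length * sizeBound T := by
  induction fs with
  | nil => simp [totalBacklog]
  | cons f fs ih =>
    rw [totalBacklog_cons, List.map_cons, List.sum_cons, Nat.cast_add, List.length_cons,
      Nat.cast_add]
    have := backlog_le T f
    rw [Nat.cast_one]
    linarith

lemma totalBacklog_new_le (l : List (Fin K × ℕ)) :
    totalBacklog T (l.map newObs) ≤ l.length * sizeBound T := by
  refine (totalBacklog_le T _).trans (le_of_eq ?_)
  have : ((l.map newObs).map FileObs.inMac).sum = 0 := by
    simp [newObs, Function.comp_def]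
  rw [this]
  simp

lemma iidList_mean (s : V) (k : ℕ) :
    MeanLE (iidList (T.newFile s) k) (fun l => totalBacklog T (l.map newObs))
      (k * T.meanSize s) := by
  induction k with
  | zero =>
    refine (MeanLE.const _ 0).congr (fun l hl => ?_) (by simp)
    rw [iidList, PMF.mem_support_pure_iff] at hl
    simp [hl, totalBacklog]
  | succ k ih =>
    rw [iidList]
    refine MeanLE.bind (φ := fun a => backlog T (newObs a) + k * T.meanSize s) (fun a _ => ?_)
      (fun l _ => totalBacklog_nonneg T _) ?_
    · refine MeanLE.map ((ih.add_const (backlog T (newObs a))).congr (fun l _ => ?_) (by ring))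
      rw [List.map_cons, totalBacklog_cons]
      ring
    · refine ((newFile_mean T s).add_const _).le (le_of_eq ?_)
      push_cast
      ring

/-- Second moment of the number of files that arrive at a node in a slot. -/
def arrivalSecondMoment (s : V) : ℝ := (∑' k : ℕ, T.arrivals s k * (k : ℝ≥0∞) ^ 2).toReal

lemma arrivals_mean_sq (s : V) :
    MeanLE (T.arrivals s) (fun k => (k : ℝ) ^ 2) (arrivalSecondMoment T s) := by
  refine MeanLE.of_tsum_le (fun _ _ => by positivity) ENNReal.toReal_nonneg ?_
  rw [arrivalSecondMoment, ENNReal.ofReal_toReal (T.secondMoment s)]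
  refine ENNReal.tsum_le_tsum fun k => ?_
  rw [ENNReal.ofReal_pow (by positivity), ENNReal.ofReal_natCast]

lemma arrivalRate_nonneg (s : V) : 0 ≤ T.arrivalRate s :=
  tsum_nonneg fun _ => mul_nonneg ENNReal.toReal_nonneg (Nat.cast_nonneg _)

lemma arrivals_mean (s : V) : MeanLE (T.arrivals s) (fun k => (k : ℝ)) (T.arrivalRate s) := by
  refine MeanLE.of_tsum_le (fun _ _ => by positivity) (arrivalRate_nonneg T s) ?_
  simp_rw [ENNReal.ofReal_natCast]
  have hfin : ∑' k : ℕ, T.arrivals s k * (k : ℝ≥0∞) ≠ ∞ := by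
    refine ne_top_of_le_ne_top (T.secondMoment s) (ENNReal.tsum_le_tsum fun k => ?_)
    gcongr
    rcases Nat.eq_zero_or_pos k with rfl | hk
    · simp
    · exact le_self_pow₀ (by exact_mod_cast hk) two_ne_zero
  have h : T.arrivalRate s = (∑' k : ℕ, T.arrivals s k * (k : ℝ≥0∞)).toReal := by
    rw [ENNReal.tsum_toReal_eq fun k => ENNReal.mul_ne_top (PMF.apply_ne_top _ _) (by simp)]
    simp [Traffic.arrivalRate, ENNReal.toReal_mul]
  rw [h, ENNReal.ofReal_toReal hfin]

lemma load_nonneg (s : V) : 0 ≤ T.load s :=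
  mul_nonneg (arrivalRate_nonneg T s) (meanSize_nonneg T s)

/-- Moments of the expected backlog of the new files at a source. -/
lemma newFilesAt_mean {sources : Finset V} {s : V} (hs : s ∈ sources) {α β γ : ℝ}
    (hα : 0 ≤ α) (hβ : 0 ≤ β) (hγ : 0 ≤ γ) :
    MeanLE (newFilesAt T sources s)
      (fun l => α * totalBacklog T (l.map newObs) + β * totalBacklog T (l.map newObs) ^ 2
        + γ * l.length)
      (α * T.load s + (β * sizeBound T ^ 2 * arrivalSecondMoment T s
        + γ * T.arrivalRate s)) := by
  have hnn : ∀ l : List (Fin K × ℕ), 0 ≤ α * totalBacklog T (l.map newObs)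
      + β * totalBacklog T (l.map newObs) ^ 2 + γ * l.length := fun l => by
    have := totalBacklog_nonneg T (l.map newObs)
    positivity
  rw [newFilesAt, if_pos hs]
  -- Given the number k of new files, the linear term needs the exact mean size, whereas the square
  -- may be bounded crudely by (k · `sizeBound`)².
  refine MeanLE.bind (φ := fun k => α * (k * T.meanSize s)
    + (β * (k * sizeBound T) ^ 2 + γ * k)) (fun k _ => ?_) (fun l _ => hnn l) ?_
  · refine (((iidList_mean T s k).const_mul hα).add_const
      (β * (k * sizeBound T) ^ 2 + γ * k)).mono (fun l _ => hnn l) (fun l hl => ?_) le_rfl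
    have h1 := totalBacklog_new_le T l
    have h0 := totalBacklog_nonneg T (l.map newObs)
    rw [length_of_mem_iidList hl] at h1 ⊢
    have h2 : totalBacklog T (l.map newObs) ^ 2 ≤ (k * sizeBound T) ^ 2 := by gcongr
    linarith [mul_le_mul_of_nonneg_left h2 hβ]
  · have h1 := (arrivals_mean T s).const_mul
      (add_nonneg (mul_nonneg hα (meanSize_nonneg T s)) hγ)
    have h2 := (arrivals_mean_sq T s).const_mul (mul_nonneg hβ (sq_nonneg (sizeBound T)))
    refine (h1.add h2).congr (fun k _ => by ring) ?_
    rw [Traffic.load]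
    ring

end NewFiles

/-! ### Balance of the queues in a slot. -/

section Balance

variable {V : Type*} {K : ℕ} (T : Traffic V K)

/-- A file is removed only when its backlog has become zero, so the removal does not affect the sum.
-/
lemma totalBacklog_serveObs {fs : List (FileObs K)} {k : List ℕ}
    (h : List.Forall₂ (fun a f => a ≤ FileObs.inMac f) k fs) :
    totalBacklog T (serveObs fs k) = totalBacklog T fs - k.sum := by
  induction h with
  | nil => simp [serveObs, totalBacklog]
  | @cons a f k fs hab _ ih =>
    have e : backlog T { f with inMac := f.inMac - a } = backlog T f - a := by
      unfold backlog
      push_cast [Nat.cast_sub hab]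
      ring
    rw [serveObs_cons, List.sum_cons, totalBacklog_cons, Nat.cast_add]
    split_ifs with hc
    · rw [totalBacklog_cons, ih, e]
      ring
    · rw [ih]
      have : backlog T { f with inMac := f.inMac - a } = 0 := by
        push Not at hc
        unfold backlog
        simp [hc.2]
        omega
      linarith

lemma sum_inMac_serveObs {fs : List (FileObs K)} {k : List ℕ}
    (h : List.Forall₂ (fun a f => a ≤ FileObs.inMac f) k fs) :
    ((serveObs fs k).map FileObs.inMac).sum + k.sum = (fs.map FileObs.inMac).sum := by
  induction h with
  | nil => simp [serveObs]
  | @cons a f k fs hab _ ih =>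
    rw [serveObs_cons]
    split_ifs with hc
    · simp only [List.map_cons, List.sum_cons]
      omega
    · push Not at hc
      simp only [List.map_cons, List.sum_cons]
      omega

lemma length_serveObs_le (fs : List (FileObs K)) (k : List ℕ) :
    (serveObs fs k).length ≤ fs.length := by
  refine (List.length_filter_le _ _).trans ?_
  simp

lemma sum_inMac_inject {l : List (FileRec K)} {w : List ℕ} (h : w.length = l.length) :
    ((l.map FileRec.obs).map FileObs.inMac).sum
      ≤ (((List.zipWith FileRec.inject l w).map FileRec.obs).map FileObs.inMac).sum := by
  induction l generalizing w with
  | nil => simp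
  | cons f l ih =>
    cases w with
    | nil => simp at h
    | cons a w =>
      have := ih (w := w) (by simpa using h)
      simp only [List.map_cons, List.sum_cons, List.zipWith_cons_cons]
      have : f.obs.inMac ≤ (f.inject a).obs.inMac := Nat.le_add_right _ _
      omega

variable [DecidableEq V] {N : Network V}

/-- Expected number of packets of destination `d` that are at the MAC layer of node `n` or belong
to files at `n`. -/
def expQueue (N : Network V) (o : ConfigObs V K) (n d : V) : ℝ :=
  o.transit n d + if n ∈ N.sources ∧ d = N.dest n then totalBacklog T (o.files n) else 0

lemma queue_le_expQueue (o : ConfigObs V K) (n d : V) :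
    (N.queue o n d : ℝ) ≤ expQueue T N o n d := by
  unfold Network.queue expQueue
  split_ifs
  · rw [Nat.cast_add]
    linarith [sum_inMac_le_totalBacklog T (o.files n)]
  · simp

lemma expQueue_nonneg (o : ConfigObs V K) (n d : V) : 0 ≤ expQueue T N o n d :=
  (Nat.cast_nonneg _).trans (queue_le_expQueue T o n d)

lemma length_le_queue {o : ConfigObs V K} {n : V} (hn : n ∈ N.sources)
    (h : ∀ f ∈ o.files n, 1 ≤ f.inMac) : (o.files n).length ≤ N.queue o n (N.dest n) := by
  rw [Network.queue, if_pos ⟨hn, rfl⟩]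
  exact (length_le_sum_inMac h).trans (Nat.le_add_left _ _)

/-- Each file adds at most `sizeBound` unseen packets on average and has at least one packet in the
queue. -/
lemma expQueue_le {o : ConfigObs V K} {n : V} (d : V)
    (h : ∀ f ∈ o.files n, 1 ≤ f.inMac) :
    expQueue T N o n d ≤ (1 + sizeBound T) * N.queue o n d := by
  have h0 := sizeBound_nonneg T
  by_cases hn : n ∈ N.sources ∧ d = N.dest n
  · obtain ⟨hn, rfl⟩ := hn
    have h1 := totalBacklog_le T (o.files n)
    have h2 : ((o.files n).length : ℝ) ≤ N.queue o n (N.dest n) := by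
      exact_mod_cast length_le_queue hn h
    have h3 : (N.queue o n (N.dest n) : ℝ)
        = o.transit n (N.dest n) + ((o.files n).map FileObs.inMac).sum := by
      rw [Network.queue, if_pos ⟨hn, rfl⟩]
      push_cast
      ring
    rw [expQueue, if_pos ⟨hn, rfl⟩]
    nlinarith [mul_le_mul_of_nonneg_right h2 h0]
  · rw [expQueue, if_neg hn, Network.queue, if_neg hn, add_zero, add_zero]
    nlinarith [Nat.cast_nonneg (α := ℝ) (o.transit n d)]

variable [Fintype V]

/-- Number of packets of destination `d` that node `n` receives from other nodes. -/
def inflow (N : Network V) (o : ConfigObs V K) (D : Decision V) (n d : V) : ℕ :=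
  ∑ i, if N.next d i = some n ∧ n ≠ d then N.sent o D i d else 0

lemma expQueue_afterObs {o : ConfigObs V K} {D : Decision V} {k : V → List ℕ}
    (hk : N.IsService o D k) (new : V → List (Fin K × ℕ)) (n d : V) :
    expQueue T N (afterObs N o D k new) n d = expQueue T N o n d - N.sent o D n d
      + inflow N o D n d
      + if n ∈ N.sources ∧ d = N.dest n then totalBacklog T ((new n).map newObs) else 0 := by
  have hq : N.sent o D n d ≤ N.queue o n d := min_le_right _ _
  have ht : (afterObs N o D k new).transit n d = o.transit n d
    - (N.sent o D n d - if n ∈ N.sources ∧ d = N.dest n then (k n).sum else 0)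
    + inflow N o D n d := rfl
  have hf : (afterObs N o D k new).files n
    = serveObs (o.files n) (k n) ++ (new n).map newObs := rfl
  rw [expQueue, expQueue, ht, hf]
  by_cases hn : n ∈ N.sources ∧ d = N.dest n
  · simp only [if_pos hn]
    rw [totalBacklog_append, totalBacklog_serveObs T (hk.le_inMac n)]
    obtain ⟨hn, rfl⟩ := hn
    -- These bounds ensure that the subtractions of natural numbers in `transitAfter` are not
    -- truncated.
    have h1 := hk.le_sent n hn
    have h2 := hk.sent_le n hn
    rw [Nat.cast_add, Nat.cast_sub (by omega), Nat.cast_sub h1]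
    ring
  · simp only [if_neg hn]
    rw [Network.queue, if_neg hn] at hq
    rw [Nat.cast_add, Nat.cast_sub (by omega), Nat.sub_zero]
    ring

/-- This prevents an expected queue from shrinking by more than a constant factor in one slot, as
the second-order bound requires. -/
lemma queue_afterObs {o : ConfigObs V K} {D : Decision V} {k : V → List ℕ}
    (hk : N.IsService o D k) (new : V → List (Fin K × ℕ)) (n d : V) :
    N.queue o n d ≤ N.queue (afterObs N o D k new) n d + N.sent o D n d := by
  have hq : N.sent o D n d ≤ N.queue o n d := min_le_right _ _
  have ht : (afterObs N o D k new).transit n d = o.transit n d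
    - (N.sent o D n d - if n ∈ N.sources ∧ d = N.dest n then (k n).sum else 0)
    + inflow N o D n d := rfl
  have hf : (afterObs N o D k new).files n
    = serveObs (o.files n) (k n) ++ (new n).map newObs := rfl
  unfold Network.queue at hq ⊢
  rw [ht, hf]
  by_cases hn : n ∈ N.sources ∧ d = N.dest n
  · simp only [if_pos hn] at hq ⊢
    have h3 := sum_inMac_serveObs (hk.le_inMac n)
    obtain ⟨hn, rfl⟩ := hn
    have h1 := hk.le_sent n hn
    have h2 := hk.sent_le n hn
    rw [List.map_append, List.sum_append]
    omega
  · simp only [if_neg hn] at hq ⊢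
    omega

end Balance

/-! ### Functions of logarithmic type -/

section LogType

/-- The properties of functions of logarithmic type that matter for stability. -/
structure IsLogType (g : ℝ → ℝ) (κ : ℝ) : Prop where
  pos : 0 < κ
  zero : g 0 = 0
  mono : MonotoneOn g (Ici 0)
  sub_le : ∀ x y, 0 ≤ x → x ≤ y → g y - g x ≤ κ * ((y - x) / (1 + x))
  tendsto : Tendsto g atTop atTop

/-- As h increases, replacing h(y) by h(x) only enlarges g(y) - g(x). The rest is log z ≤ z - 1 at z
= (1+y)/(1+x), together with h(x) ≥ h(0). -/
lemma isLogType_logType {h : ℝ → ℝ} (h_zero : 0 < h 0) (h_mono : MonotoneOn h (Ici 0))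
    (g_mono : MonotoneOn (logType h) (Ici 0)) (g_tendsto : Tendsto (logType h) atTop atTop) :
    IsLogType (logType h) (1 / h 0) where
  pos := by positivity
  zero := by simp [logType]
  mono := g_mono
  tendsto := g_tendsto
  sub_le x y hx hxy := by
    have h0 : h 0 ≤ h x := h_mono (mem_Ici.2 le_rfl) (mem_Ici.2 hx) hx
    have h1 : h x ≤ h y := h_mono (mem_Ici.2 hx) (mem_Ici.2 (hx.trans hxy)) hxy
    have hx0 : 0 < h x := h_zero.trans_le h0
    have l1 : 0 ≤ Real.log (1 + y) := Real.log_nonneg (by linarith)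
    have l2 : Real.log (1 + y) - Real.log (1 + x) ≤ (y - x) / (1 + x) := by
      rw [← Real.log_div (by linarith) (by linarith)]
      refine (Real.log_le_sub_one_of_pos (by apply div_pos <;> linarith)).trans (le_of_eq ?_)
      have : 1 + x ≠ 0 := by linarith
      field_simp
      ring
    have l3 : 0 ≤ (y - x) / (1 + x) := div_nonneg (by linarith) (by linarith)
    calc logType h y - logType h x ≤ Real.log (1 + y) / h x - Real.log (1 + x) / h x := by
          unfold logType
          gcongr
      _ = (Real.log (1 + y) - Real.log (1 + x)) / h x := by ring
      _ ≤ ((y - x) / (1 + x)) / h x := by gcongr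
      _ ≤ ((y - x) / (1 + x)) / h 0 := by gcongr
      _ = _ := by ring

variable {g : ℝ → ℝ} {κ : ℝ} (hg : IsLogType g κ)
include hg

lemma IsLogType.nonneg {x : ℝ} (hx : 0 ≤ x) : 0 ≤ g x := by
  rw [← hg.zero]
  exact hg.mono (mem_Ici.2 le_rfl) (mem_Ici.2 hx) hx

lemma IsLogType.le {x y : ℝ} (hx : 0 ≤ x) (hxy : x ≤ y) : g x ≤ g y :=
  hg.mono (mem_Ici.2 hx) (mem_Ici.2 (hx.trans hxy)) hxy

/-- Comparable arguments have close values. -/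
lemma IsLogType.le_add {x y L : ℝ} (hx : 0 ≤ x) (hL : 0 ≤ L) (hxy : x ≤ y)
    (hyx : y ≤ (1 + L) * x) : g y ≤ g x + κ * L := by
  have h1 := hg.sub_le x y hx hxy
  have h2 : (y - x) / (1 + x) ≤ L := by
    rw [div_le_iff₀ (by linarith)]
    nlinarith
  nlinarith [mul_le_mul_of_nonneg_left h2 hg.pos.le]

lemma IsLogType.intervalIntegrable {x y : ℝ} (hx : 0 ≤ x) (hy : 0 ≤ y) :
    IntervalIntegrable g volume x y := by
  refine (hg.mono.mono ?_).intervalIntegrable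
  intro z hz
  exact (le_min hx hy).trans hz.1

/-- The primitive of `g`. -/
def primitive (g : ℝ → ℝ) (x : ℝ) : ℝ := ∫ t in (0 : ℝ)..x, g t

lemma IsLogType.primitive_nonneg {x : ℝ} (hx : 0 ≤ x) : 0 ≤ primitive g x :=
  intervalIntegral.integral_nonneg hx fun _ ht => hg.nonneg ht.1

/-- The primitive of an increasing function is convex; this is the tangent inequality at y. -/
lemma IsLogType.primitive_sub_le {x y : ℝ} (hx : 0 ≤ x) (hy : 0 ≤ y) :
    primitive g y - primitive g x ≤ g y * (y - x) := by
  rw [primitive, primitive, intervalIntegral.integral_interval_sub_left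
    (hg.intervalIntegrable le_rfl hy) (hg.intervalIntegrable le_rfl hx)]
  rcases le_total x y with hxy | hxy
  · have := intervalIntegral.integral_mono_on hxy (hg.intervalIntegrable hx hy)
      (intervalIntegrable_const (c := g y)) fun t ht => hg.le (hx.trans ht.1) ht.2
    rw [intervalIntegral.integral_const, smul_eq_mul] at this
    linarith
  · have := intervalIntegral.integral_mono_on hxy (intervalIntegrable_const (c := g y))
      (hg.intervalIntegrable hy hx) fun t ht => hg.le hy ht.1
    rw [intervalIntegral.integral_const, smul_eq_mul] at this
    rw [intervalIntegral.integral_symm]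
    linarith

/-- Second-order bound for the primitive of a function of logarithmic type. -/
lemma IsLogType.primitive_le {x y c : ℝ} (hx : 0 ≤ x) (hy : 0 ≤ y) (hc : 1 ≤ c)
    (hxy : 1 + x ≤ c * (1 + y)) :
    primitive g y ≤ primitive g x + (g x * (y - x) + κ * c / (1 + x) * (y - x) ^ 2) := by
  have h1 := hg.primitive_sub_le hx hy
  -- The tangent at y is exchanged for the one at x. For y < x the increment of g is controlled by
  -- 1/(1+y), which the assumption on c compares with 1/(1+x).
  have h2 : (g y - g x) * (y - x) ≤ κ * c / (1 + x) * (y - x) ^ 2 := by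
    rcases le_total x y with h | h
    · have h3 := mul_le_mul_of_nonneg_right (hg.sub_le x y hx h) (sub_nonneg.2 h)
      have h4 : κ * ((y - x) / (1 + x)) * (y - x) = κ * 1 / (1 + x) * (y - x) ^ 2 := by ring
      rw [h4] at h3
      refine h3.trans ?_
      have := hg.pos
      gcongr
    · have h3 := mul_le_mul_of_nonneg_right (hg.sub_le y x hy h) (sub_nonneg.2 h)
      have h4 : κ * ((x - y) / (1 + y)) * (x - y) ≤ κ * c / (1 + x) * (y - x) ^ 2 := by
        have h5 : 1 / (1 + y) ≤ c / (1 + x) := by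
          rw [div_le_div_iff₀ (by linarith) (by linarith)]
          linarith
        have := hg.pos
        calc _ = κ * (1 / (1 + y)) * (y - x) ^ 2 := by ring
          _ ≤ κ * (c / (1 + x)) * (y - x) ^ 2 := by gcongr
          _ = _ := by ring
      nlinarith
  nlinarith

end LogType

/-! ### The capacity region -/

section Capacity

variable {V : Type*} [DecidableEq V] {N : Network V}

lemma dest_mem_dests {s : V} (hs : s ∈ N.sources) : N.dest s ∈ N.dests :=
  Finset.mem_image_of_mem _ hs

lemma mem_carried {i j d : V} : d ∈ N.carried i j ↔ d ∈ N.dests ∧ N.next d i = some j := by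
  simp [Network.carried]

lemma mem_links_of_next {d i j : V} (hd : d ∈ N.dests) (h : N.next d i = some j) :
    (i, j) ∈ N.links := by
  obtain ⟨s, hs, rfl⟩ := Finset.mem_image.1 hd
  exact N.next_link s hs i j h

variable [Fintype V]

lemma sum_links (N : Network V) (f : V → V → ℝ) :
    ∑ l ∈ N.links, f l.1 l.2 = ∑ i, ∑ j, if (i, j) ∈ N.links then f i j else 0 := by
  rw [← Finset.sum_product', Finset.univ_product_univ, ← Finset.sum_filter]
  congr 1
  ext l
  simp

/-- Summation by parts along the routes. -/
lemma sum_mul_flow (N : Network V) (S : Finset V) (u z : V → V → ℝ)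
    (hz : ∀ n, ∀ d ∈ S, N.next d n = none → z n d = 0) :
    ∑ n, ∑ d ∈ S, u n d * (z n d - ∑ i, if N.next d i = some n then z i d else 0)
      = ∑ i, ∑ j, ∑ d ∈ S, if N.next d i = some j then z i d * (u i d - u j d) else 0 := by
  have h1 : ∀ n, ∀ d ∈ S, u n d * z n d
      = ∑ j, if N.next d n = some j then z n d * u n d else 0 := by
    intro n d hd
    cases hnext : N.next d n with
    | none => simp [hz n d hd hnext]
    | some j => simp [mul_comm]
  have h2 : ∑ n, ∑ d ∈ S, u n d * z n d
      = ∑ i, ∑ j, ∑ d ∈ S, if N.next d i = some j then z i d * u i d else 0 := by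
    refine Finset.sum_congr rfl fun n _ => ?_
    rw [Finset.sum_comm]
    exact Finset.sum_congr rfl fun d hd => h1 n d hd
  have h3 : ∑ n, ∑ d ∈ S, u n d * ∑ i, (if N.next d i = some n then z i d else 0)
      = ∑ i, ∑ j, ∑ d ∈ S, if N.next d i = some j then z i d * u j d else 0 := by
    rw [Finset.sum_comm (s := Finset.univ (α := V)) (t := Finset.univ (α := V))]
    refine Finset.sum_congr rfl fun n _ => ?_
    rw [Finset.sum_comm]
    refine Finset.sum_congr rfl fun d _ => ?_
    rw [Finset.mul_sum]
    refine Finset.sum_congr rfl fun i _ => ?_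
    split_ifs <;> ring
  simp_rw [mul_sub, Finset.sum_sub_distrib]
  rw [h2, h3]
  simp_rw [← Finset.sum_sub_distrib]
  refine Finset.sum_congr rfl fun i _ => Finset.sum_congr rfl fun j _ =>
    Finset.sum_congr rfl fun d _ => ?_
  split_ifs <;> ring

/-- Loads in the capacity region satisfy the linear inequalities that are dual to
the existence of multicommodity flows. -/
theorem sum_load_le_of_mem_capacityRegion {ρ : V → ℝ} (hρ : ρ ∈ N.capacityRegion)
    {u W : V → V → ℝ} {M : ℝ} (hu : ∀ n d, 0 ≤ u n d) (hud : ∀ d ∈ N.dests, u d d = 0)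
    (hW : ∀ i j, 0 ≤ W i j)
    (huW : ∀ i j, ∀ d ∈ N.carried i j, u i d - u j d ≤ W i j)
    (hM : ∀ r ∈ N.rates, ∑ l ∈ N.links, (r l.1 l.2 : ℝ) * W l.1 l.2 ≤ M) :
    ∑ s ∈ N.sources, ρ s * u s (N.dest s) ≤ M := by
  obtain ⟨Ω, _, P, _, A, r, z, Q, hS⟩ := hρ
  set X : ℕ → Ω → ℝ := fun t ω => ∑ s ∈ N.sources, (A t ω s : ℝ) * u s (N.dest s) with hX
  set Φ : ℕ → Ω → ℝ := fun t ω => ∑ n, ∑ d ∈ N.dests, u n d * (Q t ω n d : ℝ) with hΦ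
  -- Arrivals raise the potential Φ by X, and transmissions lower it by at most M. The destination
  -- needs no balance equation, since u vanishes there.
  have hstep : ∀ t ω, Φ t ω + X t ω - M ≤ Φ (t + 1) ω := by
    intro t ω
    have h1 : ∀ n, ∀ d ∈ N.dests, u n d * (Q (t + 1) ω n d : ℝ) = u n d * (Q t ω n d : ℝ)
        - u n d * ((z t ω n d : ℝ)
          - ∑ i, if N.next d i = some n then (z t ω i d : ℝ) else 0)
        + u n d * (if n ∈ N.sources ∧ d = N.dest n then (A t ω n : ℝ) else 0) := by
      intro n d hd
      rcases eq_or_ne n d with rfl | hne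
      · simp [hud n hd]
      · have h2 := hS.queue_succ t ω n d hd hne
        have h3 : (Q (t + 1) ω n d : ℝ) + z t ω n d = Q t ω n d
            + (∑ i, if N.next d i = some n then (z t ω i d : ℝ) else 0)
            + if n ∈ N.sources ∧ d = N.dest n then (A t ω n : ℝ) else 0 := by
          exact_mod_cast h2
        have h4 : (Q (t + 1) ω n d : ℝ) = Q t ω n d
            + (∑ i, if N.next d i = some n then (z t ω i d : ℝ) else 0)
            + (if n ∈ N.sources ∧ d = N.dest n then (A t ω n : ℝ) else 0) - z t ω n d := by
          linarith
        rw [h4]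
        ring
    have h2 : Φ (t + 1) ω = Φ t ω
        - ∑ n, ∑ d ∈ N.dests, u n d * ((z t ω n d : ℝ)
          - ∑ i, if N.next d i = some n then (z t ω i d : ℝ) else 0)
        + ∑ n, ∑ d ∈ N.dests,
          u n d * (if n ∈ N.sources ∧ d = N.dest n then (A t ω n : ℝ) else 0) := by
      simp only [hΦ]
      rw [← Finset.sum_sub_distrib, ← Finset.sum_add_distrib]
      refine Finset.sum_congr rfl fun n _ => ?_
      rw [← Finset.sum_sub_distrib, ← Finset.sum_add_distrib]
      exact Finset.sum_congr rfl fun d hd => h1 n d hd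
    have h3 : ∑ n, ∑ d ∈ N.dests,
        u n d * (if n ∈ N.sources ∧ d = N.dest n then (A t ω n : ℝ) else 0) = X t ω := by
      simp only [hX]
      rw [← Finset.sum_filter_add_sum_filter_not Finset.univ (· ∈ N.sources)]
      have e1 : Finset.univ.filter (· ∈ N.sources) = N.sources := by ext; simp
      have e2 : ∑ n ∈ Finset.univ.filter (· ∉ N.sources), ∑ d ∈ N.dests,
          u n d * (if n ∈ N.sources ∧ d = N.dest n then (A t ω n : ℝ) else 0) = 0 :=
        Finset.sum_eq_zero fun n hn => Finset.sum_eq_zero fun d _ => by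
          simp [(Finset.mem_filter.1 hn).2]
      rw [e1, e2, add_zero]
      refine Finset.sum_congr rfl fun n hn => ?_
      simp only [hn, true_and]
      rw [Finset.sum_eq_single (N.dest n)]
      · simp [mul_comm]
      · intro d _ hd
        simp [hd]
      · intro h
        exact absurd (dest_mem_dests hn) h
    have h4 : ∑ n, ∑ d ∈ N.dests, u n d * ((z t ω n d : ℝ)
          - ∑ i, if N.next d i = some n then (z t ω i d : ℝ) else 0) ≤ M := by
      rw [sum_mul_flow N N.dests u (fun n d => (z t ω n d : ℝ)) fun n d hd h => by
        exact_mod_cast hS.sent_route t ω n d hd h]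
      refine le_trans ?_ (hM (r t ω) (hS.rate_mem t ω))
      rw [sum_links N fun i j => (r t ω i j : ℝ) * W i j]
      refine Finset.sum_le_sum fun i _ => Finset.sum_le_sum fun j _ => ?_
      rw [← Finset.sum_filter]
      change ∑ d ∈ N.carried i j, _ ≤ _
      split_ifs with hl
      · calc _ ≤ ∑ d ∈ N.carried i j, (z t ω i d : ℝ) * W i j :=
              Finset.sum_le_sum fun d hd =>
                mul_le_mul_of_nonneg_left (huW i j d hd) (Nat.cast_nonneg _)
          _ = (∑ d ∈ N.carried i j, z t ω i d : ℕ) * W i j := by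
              rw [← Finset.sum_mul]; push_cast; rfl
          _ ≤ _ := mul_le_mul_of_nonneg_right
              (by exact_mod_cast hS.sent_le_rate t ω i j hl) (hW i j)
      · rw [Finset.sum_eq_zero]
        intro d hd
        obtain ⟨h5, h6⟩ := mem_carried.1 hd
        exact absurd (mem_links_of_next h5 h6) hl
    linarith
  have hsum : ∀ t ω, ∑ k ∈ Finset.range t, X k ω - t * M ≤ Φ t ω := by
    intro t ω
    induction t with
    | zero =>
      simp only [Finset.range_zero, Finset.sum_empty, Nat.cast_zero, zero_mul, sub_zero]
      exact Finset.sum_nonneg fun n _ => Finset.sum_nonneg fun d _ =>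
        mul_nonneg (hu n d) (Nat.cast_nonneg _)
    | succ t ih =>
      have := hstep t ω
      rw [Finset.sum_range_succ]
      push_cast
      linarith
  set U : ℝ := ∑ n, ∑ d, u n d + 1 with hU
  have hU0 : 0 < U := by
    have : 0 ≤ ∑ n, ∑ d, u n d :=
      Finset.sum_nonneg fun n _ => Finset.sum_nonneg fun d _ => hu n d
    linarith
  have hΦle : ∀ t ω, Φ t ω ≤ U * (∑ n, ∑ d ∈ N.dests, Q t ω n d : ℕ) := by
    intro t ω
    push_cast
    simp only [hΦ]
    rw [Finset.mul_sum]
    refine Finset.sum_le_sum fun n _ => ?_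
    rw [Finset.mul_sum]
    refine Finset.sum_le_sum fun d _ => mul_le_mul_of_nonneg_right ?_ (Nat.cast_nonneg _)
    have h1 : u n d ≤ ∑ d, u n d :=
      Finset.single_le_sum (f := fun d => u n d) (fun d _ => hu n d) (Finset.mem_univ d)
    have h2 : ∑ d, u n d ≤ ∑ n, ∑ d, u n d :=
      Finset.single_le_sum (f := fun n => ∑ d, u n d)
        (fun n _ => Finset.sum_nonneg fun d _ => hu n d) (Finset.mem_univ n)
    linarith
  set φ : (V → ℕ) → ℝ := fun a => ∑ s ∈ N.sources, (a s : ℝ) * u s (N.dest s) with hφ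
  have hφm : Measurable φ := by
    refine Finset.measurable_sum _ fun s _ => ?_
    exact ((measurable_from_top (f := fun k : ℕ => (k : ℝ))).comp
      (measurable_pi_apply s)).mul_const _
  have hXm : ∀ t, Measurable (X t) := fun t => hφm.comp (hS.measurable_A t)
  have hint : Integrable (X 0) P :=
    integrable_finsetSum _ fun s hs => (hS.integrable_A s hs).mul_const _
  have hmean : ∫ ω, X 0 ω ∂P = ∑ s ∈ N.sources, ρ s * u s (N.dest s) := by
    simp only [hX]
    rw [integral_finsetSum _ fun s hs => (hS.integrable_A s hs).mul_const _]
    refine Finset.sum_congr rfl fun s hs => ?_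
    rw [integral_mul_const, hS.mean_A s hs]
  have hlln := strong_law_ae_real X hint
    (fun i j hij => (hS.indep_A.indepFun hij).comp hφm hφm)
    (fun i => (hS.identDistrib_A i).comp hφm)
  rw [hmean] at hlln
  by_contra hlt
  push Not at hlt
  set a := ∑ s ∈ N.sources, ρ s * u s (N.dest s) with ha
  -- If the claim failed, the law of large numbers would give Φ ≥ nε with probability tending to 1,
  -- so that the queues could not be tight. Exceptional events of probability 1/4 and 1/2 cannot
  -- cover everything.
  set ε := (a - M) / 2 with hε
  have hε0 : 0 < ε := by linarith
  have hmeas := tendstoInMeasure_of_tendsto_ae (μ := P)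
    (f := fun (n : ℕ) ω => (∑ i ∈ Finset.range n, X i ω) / n) (g := fun _ => a)
    (fun n => ((Finset.measurable_sum _ fun i _ => hXm i).div_const _).aestronglyMeasurable) hlln
  rw [tendstoInMeasure_iff_dist] at hmeas
  have h1 := hmeas ε hε0
  obtain ⟨B, hB⟩ := hS.queue_finite (1 / 2) (by simp)
  have h2 : ∀ᶠ n : ℕ in atTop, U * B < n * ε :=
    (tendsto_natCast_atTop_atTop.atTop_mul_const hε0).eventually (eventually_gt_atTop _)
  have h3 := (h1.eventually (gt_mem_nhds (show (0 : ℝ≥0∞) < 1 / 4 by simp))).and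
    (h2.and (eventually_gt_atTop 0))
  obtain ⟨n, hn1, hn2, hn0⟩ := h3.exists
  have hcover : (Set.univ : Set Ω) ⊆
      {ω | ε ≤ dist ((∑ i ∈ Finset.range n, X i ω) / n) a}
        ∪ {ω | B < ∑ m, ∑ d ∈ N.dests, Q n ω m d} := by
    intro ω _
    by_cases hω : ε ≤ dist ((∑ i ∈ Finset.range n, X i ω) / n) a
    · exact Or.inl hω
    · right
      rw [not_le, Real.dist_eq, abs_lt] at hω
      have hn0' : (0 : ℝ) < n := by exact_mod_cast hn0
      have h4 : M + ε < (∑ i ∈ Finset.range n, X i ω) / n := by linarith [hω.1]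
      rw [lt_div_iff₀ hn0'] at h4
      have h5 := hsum n ω
      have h6 := hΦle n ω
      have h7 : U * B < U * (∑ m, ∑ d ∈ N.dests, Q n ω m d : ℕ) := by nlinarith
      exact_mod_cast lt_of_mul_lt_mul_left h7 hU0.le
  have h5 : (1 : ℝ≥0∞) ≤ 1 / 4 + 1 / 2 := by
    calc (1 : ℝ≥0∞) = P Set.univ := measure_univ.symm
      _ ≤ _ := (measure_mono hcover).trans (measure_union_le _ _)
      _ ≤ _ := add_le_add hn1.le (hB n)
  have h6 : (1 / 4 + 1 / 2 : ℝ≥0∞) < 1 := by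
    rw [show (1 / 4 + 1 / 2 : ℝ≥0∞) = ENNReal.ofReal (1 / 4 + 1 / 2) by
      rw [ENNReal.ofReal_add (by norm_num) (by norm_num),
        ENNReal.ofReal_div_of_pos (by norm_num), ENNReal.ofReal_div_of_pos (by norm_num)]
      norm_num]
    rw [ENNReal.ofReal_lt_one]
    norm_num
  exact absurd h5 (not_le.2 h6)

end Capacity

/-! ### Max-weight scheduling against the capacity region. -/

section MaxWeight

variable {V : Type*} {N : Network V}

section

variable [Fintype V]

open Classical in
/-- Maximum of `u` over the nodes that lie downstream on the route to `d`. -/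
def downstreamMax (N : Network V) (u : V → V → ℝ) (n d : V) : ℝ :=
  (Finset.univ.filter fun m => N.Route d n m).sup'
    ⟨n, Finset.mem_filter.2 ⟨Finset.mem_univ _, Relation.ReflTransGen.refl⟩⟩ fun m => u m d

lemma le_downstreamMax (u : V → V → ℝ) {n m d : V} (h : N.Route d n m) :
    u m d ≤ downstreamMax N u n d :=
  Finset.le_sup' (fun m => u m d) (by
    classical
    rw [Finset.mem_filter]
    exact ⟨Finset.mem_univ _, h⟩)

lemma downstreamMax_le {u : V → V → ℝ} {n d : V} {a : ℝ} (h : ∀ m, N.Route d n m → u m d ≤ a) :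
    downstreamMax N u n d ≤ a :=
  Finset.sup'_le _ _ fun m hm => by
    classical
    rw [Finset.mem_filter] at hm
    exact h m hm.2

/-- The maximum seen from i is attained at i itself or already seen from j. So the potential falls
along a link by at most the positive part of the weight, and a long queue anywhere on a route is
felt at its source. -/
lemma downstreamMax_sub_le (u : V → V → ℝ) {i j d : V} (h : N.next d i = some j) :
    downstreamMax N u i d - downstreamMax N u j d ≤ max 0 (u i d - u j d) := by
  rw [sub_le_iff_le_add]
  refine downstreamMax_le fun m hm => ?_
  rcases Relation.ReflTransGen.cases_head hm with rfl | ⟨j', hj', hm'⟩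
  · have := le_downstreamMax u (N := N) (n := j) (d := d) (m := j) Relation.ReflTransGen.refl
    have := le_max_right 0 (u i d - u j d)
    linarith
  · obtain rfl : j = j' := by simpa using h.symm.trans hj'
    have := le_downstreamMax u (N := N) hm'
    have := le_max_left 0 (u i d - u j d)
    linarith

lemma downstreamMax_dest {u : V → V → ℝ} {s : V} (hs : s ∈ N.sources)
    (hu : u (N.dest s) (N.dest s) = 0) :
    downstreamMax N u (N.dest s) (N.dest s) = 0 := by
  refine le_antisymm (downstreamMax_le fun m hm => ?_)
    (hu.symm.le.trans (le_downstreamMax u Relation.ReflTransGen.refl))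
  rcases Relation.ReflTransGen.cases_head hm with rfl | ⟨j, hj, -⟩
  · exact hu.le
  · rw [N.next_dest s hs] at hj
    simp at hj

end

variable [DecidableEq V] {K : ℕ} {g : ℝ → ℝ} {o : ConfigObs V K} {D : Decision V}

lemma rateOut_eq_zero_of_next {n d : V} (h : N.next d n = none) : N.rateOut D n d = 0 := by
  simp [Network.rateOut, h]

lemma destWeight_le_linkWeight {i j d : V} (hd : d ∈ N.carried i j) :
    g (N.queue o i d) - g (N.queue o j d) ≤ N.linkWeight g o i j := by
  rw [Network.linkWeight, dif_pos ⟨d, hd⟩]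
  exact Finset.le_sup' (N.destWeight g o i j) hd

/-- Max-weight scheduling also maximizes the sum of the positive parts of the weights. -/
lemma sum_mul_max_linkWeight_le (hD : N.IsMaxWeight g o D) {r : V → V → ℕ} (hr : r ∈ N.rates) :
    ∑ l ∈ N.links, (r l.1 l.2 : ℝ) * max 0 (N.linkWeight g o l.1 l.2)
      ≤ ∑ l ∈ N.links, (D.rate l.1 l.2 : ℝ) * N.linkWeight g o l.1 l.2 := by
  classical
  -- The competing schedule silences the links of negative weight.
  refine le_trans (le_of_eq ?_) (hD.rate_max _ (N.rates_switchOff r hr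
    (fun i j => if 0 ≤ N.linkWeight g o i j then r i j else 0) fun i j => ?_))
  · refine Finset.sum_congr rfl fun l _ => ?_
    split_ifs with h
    · rw [max_eq_right h]
    · rw [max_eq_left (not_le.1 h).le]
      simp
  · split_ifs <;> simp

variable [Fintype V]

/-- The weight served by max-weight scheduling exceeds the weight of any load strictly inside of
the capacity region. -/
lemma sum_load_add_le {ρ ρ' : V → ℝ} {δ : ℝ} (hρ' : ρ' ∈ N.capacityRegion) (hδ : 0 ≤ δ)
    (hρ : ∀ s ∈ N.sources, 0 ≤ ρ s) (hle : ∀ s ∈ N.sources, ρ s + δ ≤ ρ' s)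
    (hg : ∀ k : ℕ, 0 ≤ g k) (hg0 : g 0 = 0) (hq : ∀ d, N.queue o d d = 0)
    (hD : N.IsMaxWeight g o D) {s n : V} (hs : s ∈ N.sources) (hn : N.Route (N.dest s) s n) :
    ∑ s ∈ N.sources, ρ s * g (N.queue o s (N.dest s)) + δ * g (N.queue o n (N.dest s))
      ≤ ∑ l ∈ N.links, (D.rate l.1 l.2 : ℝ) * N.linkWeight g o l.1 l.2 := by
  set u : V → V → ℝ := fun n d => g (N.queue o n d) with hu
  have hu0 : ∀ n d, 0 ≤ u n d := fun n d => hg _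
  have hself : ∀ n d, u n d ≤ downstreamMax N u n d := fun n d =>
    le_downstreamMax u Relation.ReflTransGen.refl
  have hnn : ∀ n d, 0 ≤ downstreamMax N u n d := fun n d => (hu0 n d).trans (hself n d)
  have hcap := sum_load_le_of_mem_capacityRegion hρ' (u := downstreamMax N u)
    (W := fun i j => max 0 (N.linkWeight g o i j)) hnn
    (fun d hd => by
      obtain ⟨s, hs, rfl⟩ := Finset.mem_image.1 hd
      exact downstreamMax_dest hs (by simp [hu, hq, hg0]))
    (fun i j => le_max_left _ _)
    (fun i j d hd => (downstreamMax_sub_le u (mem_carried.1 hd).2).trans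
      (max_le_max le_rfl (destWeight_le_linkWeight hd)))
    (fun r hr => sum_mul_max_linkWeight_le hD hr)
  refine le_trans ?_ hcap
  have h1 : ∑ s ∈ N.sources, ρ s * u s (N.dest s)
      ≤ ∑ s ∈ N.sources, ρ s * downstreamMax N u s (N.dest s) :=
    Finset.sum_le_sum fun s hs => mul_le_mul_of_nonneg_left (hself _ _) (hρ s hs)
  -- As n lies downstream of s, the surplus δ at the source s pays for the queue at n.
  have h2 : δ * u n (N.dest s) ≤ ∑ s ∈ N.sources, δ * downstreamMax N u s (N.dest s) :=
    (mul_le_mul_of_nonneg_left (le_downstreamMax u hn) hδ).trans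
      (Finset.single_le_sum (f := fun s => δ * downstreamMax N u s (N.dest s))
        (fun s _ => mul_nonneg hδ (hnn _ _)) hs)
  calc _ ≤ ∑ s ∈ N.sources, (ρ s + δ) * downstreamMax N u s (N.dest s) := by
        simp_rw [add_mul, Finset.sum_add_distrib]
        exact add_le_add h1 h2
    _ ≤ _ := Finset.sum_le_sum fun s hs => mul_le_mul_of_nonneg_right (hle s hs) (hnn _ _)

/-- The drift of the queues at the scheduled rates is the weight served by max-weight
scheduling. -/
lemma sum_mul_rate_eq (hD : N.IsMaxWeight g o D) :
    ∑ n, ∑ d, g (N.queue o n d) * ((N.rateOut D n d : ℝ)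
        - ∑ i, if N.next d i = some n then (N.rateOut D i d : ℝ) else 0)
      = ∑ l ∈ N.links, (D.rate l.1 l.2 : ℝ) * N.linkWeight g o l.1 l.2 := by
  rw [sum_mul_flow N Finset.univ (fun n d => g (N.queue o n d))
    (fun n d => (N.rateOut D n d : ℝ)) fun n d _ h => by
      simp [rateOut_eq_zero_of_next h],
    sum_links N fun i j => (D.rate i j : ℝ) * N.linkWeight g o i j]
  refine Finset.sum_congr rfl fun i _ => Finset.sum_congr rfl fun j _ => ?_
  by_cases hl : (i, j) ∈ N.links
  · have h1 := (mem_carried.1 (hD.serves_mem i j hl)).2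
    rw [if_pos hl, Finset.sum_eq_single (D.serves i j)]
    · rw [if_pos h1, ← hD.serves_max i j hl]
      simp [Network.rateOut, h1, Network.destWeight]
    · intro d _ hd
      split_ifs with h
      · simp [Network.rateOut, h, hd.symm]
      · rfl
    · simp
  · rw [if_neg hl]
    refine Finset.sum_eq_zero fun d _ => ?_
    split_ifs with h
    · simp [Network.rateOut, h, N.rates_support _ hD.rate_mem i j hl]
    · rfl

/-- A bound for the rates of the links. -/
def rateBound (N : Network V) : ℕ := ∑ r ∈ N.rates, ∑ i, ∑ j, r i j

lemma rateOut_le (hD : N.IsMaxWeight g o D) (n d : V) : N.rateOut D n d ≤ rateBound N := by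
  unfold Network.rateOut
  split
  · rename_i j _
    split_ifs
    · calc D.rate n j ≤ ∑ j, D.rate n j :=
            Finset.single_le_sum (f := fun j => D.rate n j) (fun _ _ => Nat.zero_le _)
              (Finset.mem_univ j)
        _ ≤ ∑ i, ∑ j, D.rate i j :=
            Finset.single_le_sum (f := fun i => ∑ j, D.rate i j) (fun _ _ => Nat.zero_le _)
              (Finset.mem_univ n)
        _ ≤ _ := Finset.single_le_sum (f := fun r : V → V → ℕ => ∑ i, ∑ j, r i j)
              (fun _ _ => Nat.zero_le _) hD.rate_mem
    · exact Nat.zero_le _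
  · exact Nat.zero_le _

lemma sent_le (hD : N.IsMaxWeight g o D) (n d : V) : N.sent o D n d ≤ rateBound N :=
  (min_le_left _ _).trans (rateOut_le hD n d)

lemma inflow_le (hD : N.IsMaxWeight g o D) (n d : V) :
    inflow N o D n d ≤ Fintype.card V * rateBound N := by
  calc inflow N o D n d ≤ ∑ _i : V, rateBound N := by
        refine Finset.sum_le_sum fun i _ => ?_
        split_ifs
        · exact sent_le hD i d
        · exact Nat.zero_le _
    _ = _ := by simp

variable (T : Traffic V K) {κ : ℝ}

/-- The first-order term of the drift. -/
lemma sum_first_order_le (hg : IsLogType g κ) (hq : ∀ d, N.queue o d d = 0)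
    (hpos : ∀ n, ∀ f ∈ o.files n, 1 ≤ f.inMac) (hD : N.IsMaxWeight g o D) :
    ∑ n, ∑ d, g (expQueue T N o n d) * ((inflow N o D n d : ℝ) - N.sent o D n d
        + if n ∈ N.sources ∧ d = N.dest n then T.load n else 0)
      ≤ ∑ n, ∑ _d : V, (κ * sizeBound T * (Fintype.card V * rateBound N + T.load n)
          + g (rateBound N) * rateBound N)
        + ∑ s ∈ N.sources, T.load s * g (N.queue o s (N.dest s))
        - ∑ l ∈ N.links, (D.rate l.1 l.2 : ℝ) * N.linkWeight g o l.1 l.2 := by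
  have hL := sizeBound_nonneg T
  have hload : ∑ s ∈ N.sources, T.load s * g (N.queue o s (N.dest s))
      = ∑ n, ∑ d, g (N.queue o n d)
        * (if n ∈ N.sources ∧ d = N.dest n then T.load n else 0) := by
    rw [← Finset.sum_filter_add_sum_filter_not Finset.univ (· ∈ N.sources)]
    have e1 : Finset.univ.filter (· ∈ N.sources) = N.sources := by ext; simp
    have e2 : ∑ n ∈ Finset.univ.filter (· ∉ N.sources), ∑ d, g (N.queue o n d)
        * (if n ∈ N.sources ∧ d = N.dest n then T.load n else 0) = 0 :=
      Finset.sum_eq_zero fun n hn => Finset.sum_eq_zero fun d _ => by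
        simp [(Finset.mem_filter.1 hn).2]
    rw [e1, e2, add_zero]
    refine Finset.sum_congr rfl fun n hn => ?_
    simp [hn, mul_comm]
  rw [hload, ← sum_mul_rate_eq hD, ← Finset.sum_add_distrib, ← Finset.sum_sub_distrib]
  refine Finset.sum_le_sum fun n _ => ?_
  rw [← Finset.sum_add_distrib, ← Finset.sum_sub_distrib]
  refine Finset.sum_le_sum fun d _ => ?_
  set x := expQueue T N o n d
  set q := N.queue o n d with hqdef
  have hqx : (q : ℝ) ≤ x := queue_le_expQueue T o n d
  have hxq : x ≤ (1 + sizeBound T) * q := expQueue_le T d (hpos n)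
  have hq0 : (0 : ℝ) ≤ q := Nat.cast_nonneg _
  have h1 : g x ≤ g q + κ * sizeBound T := hg.le_add hq0 hL hqx hxq
  have h2 : g q ≤ g x := hg.le hq0 hqx
  have hgq : 0 ≤ g q := hg.nonneg hq0
  set ℓ : ℝ := if n ∈ N.sources ∧ d = N.dest n then T.load n else 0 with hℓ
  have hℓ0 : 0 ≤ ℓ := by
    rw [hℓ]
    split_ifs
    · exact load_nonneg T n
    · exact le_rfl
  have hℓ1 : ℓ ≤ T.load n := by
    rw [hℓ]
    split_ifs
    · exact le_rfl
    · exact load_nonneg T n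
  have hin : (inflow N o D n d : ℝ) ≤ Fintype.card V * rateBound N := by
    exact_mod_cast inflow_le hD n d
  have hin0 : (0 : ℝ) ≤ inflow N o D n d := Nat.cast_nonneg _
  have hs0 : (0 : ℝ) ≤ N.sent o D n d := Nat.cast_nonneg _
  -- Packets that reach their destination leave the network. This does no harm because the queue
  -- there is empty and g(0) = 0.
  have h3 : g q * (inflow N o D n d : ℝ)
      ≤ g q * ∑ i, if N.next d i = some n then (N.rateOut D i d : ℝ) else 0 := by
    rcases eq_or_ne n d with rfl | hne
    · have : g q = 0 := by rw [hqdef, hq n, Nat.cast_zero, hg.zero]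
      simp [this]
    · refine mul_le_mul_of_nonneg_left ?_ hgq
      unfold inflow
      push_cast
      refine Finset.sum_le_sum fun i _ => ?_
      by_cases h : N.next d i = some n
      · simp only [h, hne, ne_eq, not_false_eq_true, and_self, if_true]
        exact_mod_cast min_le_left _ _
      · simp [h]
  -- Scheduled capacity is wasted only at queues shorter than the scheduled rate, where g is
  -- bounded.
  have h4 : g q * ((N.rateOut D n d : ℝ) - N.sent o D n d) ≤ g (rateBound N) * rateBound N := by
    have hR : N.rateOut D n d ≤ rateBound N := rateOut_le hD n d
    have hR' : (N.rateOut D n d : ℝ) ≤ rateBound N := by exact_mod_cast hR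
    have hgR : 0 ≤ g (rateBound N) := hg.nonneg (Nat.cast_nonneg _)
    by_cases h : N.rateOut D n d ≤ q
    · rw [Network.sent, min_eq_left h, sub_self, mul_zero]
      positivity
    · have h5 : g q ≤ g (rateBound N) :=
        hg.le hq0 (by exact_mod_cast (by omega : q ≤ rateBound N))
      calc g q * ((N.rateOut D n d : ℝ) - N.sent o D n d) ≤ g q * rateBound N :=
            mul_le_mul_of_nonneg_left (by linarith) hgq
        _ ≤ _ := mul_le_mul_of_nonneg_right h5 (Nat.cast_nonneg _)
  have h6 : (g x - g q) * ((inflow N o D n d : ℝ) + ℓ)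
      ≤ κ * sizeBound T * (Fintype.card V * rateBound N + T.load n) := by
    have := hg.pos
    apply mul_le_mul <;> linarith [mul_nonneg this.le hL]
  have h7 : g q * N.sent o D n d ≤ g x * N.sent o D n d := mul_le_mul_of_nonneg_right h2 hs0
  linarith

end MaxWeight

/-! ### Drift of the Lyapunov function and stability. -/

section Drift

variable {V : Type*} {N : Network V} {K : ℕ} {T : Traffic V K} {g : ℝ → ℝ} {κ : ℝ}

lemma arrivalSecondMoment_nonneg (n : V) : 0 ≤ arrivalSecondMoment T n := ENNReal.toReal_nonneg

lemma exists_uniform_gap {s : Finset V} {ρ ρ' : V → ℝ} (h : ∀ v ∈ s, ρ v < ρ' v) :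
    ∃ δ, 0 < δ ∧ ∀ v ∈ s, ρ v + δ ≤ ρ' v := by
  rcases s.eq_empty_or_nonempty with rfl | hs
  · exact ⟨1, one_pos, by simp⟩
  · obtain ⟨v, hv, hmin⟩ := s.exists_min_image (fun v => ρ' v - ρ v) hs
    exact ⟨ρ' v - ρ v, sub_pos.2 (h v hv), fun v' hv' => by linarith [hmin v' hv']⟩

variable [Fintype V]

/-- Ratio of the expected queue lengths before and after a slot. -/
def ratioBound (N : Network V) (T : Traffic V K) : ℝ := (1 + sizeBound T) * (1 + rateBound N)

lemma one_le_ratioBound (N : Network V) (T : Traffic V K) : 1 ≤ ratioBound N T := by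
  have h1 := sizeBound_nonneg T
  have h2 : (0 : ℝ) ≤ rateBound N := Nat.cast_nonneg _
  unfold ratioBound
  nlinarith

variable [DecidableEq V]

/-- Mean of the primitive of `g` at a queue after the injection of packets. -/
lemma hidden_mean_primitive (hg : IsLogType g κ) (mid : ConfigObs V K) {w : V → List ℕ}
    {Wcong : ℕ} (n d : V) (hl : (w n).length = (mid.files n).length)
    (hw : ∀ a ∈ w n, a ≤ Wcong) {x : ℝ} (hx : 0 ≤ x)
    (hxq : ∀ y, (N.queue mid n d : ℝ) ≤ y → 1 + x ≤ ratioBound N T * (1 + y)) :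
    MeanLE (hidden T mid) (fun c => primitive g (expQueue T N (c.inject w).obs n d))
      (primitive g x + (g x * (expQueue T N mid n d - x)
        + κ * ratioBound N T / (1 + x) * (expQueue T N mid n d - x) ^ 2)
        + if n ∈ N.sources ∧ d = N.dest n then (mid.files n).length
          * (κ * ratioBound N T / (1 + x) * (Wcong + sizeBound T) ^ 2) else 0) := by
  have hβ : 0 < κ * ratioBound N T / (1 + x) :=
    div_pos (mul_pos hg.pos (zero_lt_one.trans_le (one_le_ratioBound N T))) (by linarith)
  set β := κ * ratioBound N T / (1 + x) with hβdef
  set s := expQueue T N mid n d - x with hs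
  rw [hidden]
  refine MeanLE.map ?_
  set ψ : List (FileRec K) → ℝ := fun l => primitive g (mid.transit n d
    + if n ∈ N.sources ∧ d = N.dest n then
        totalBacklog T ((List.zipWith FileRec.inject l (w n)).map FileRec.obs) else 0) with hψ
  change MeanLE _ (fun fs : V → List (FileRec K) => ψ (fs n)) _
  refine MeanLE.of_map (φ := fun fs : V → List (FileRec K) => fs n) ?_
  rw [indep_map_apply]
  have hnn : ∀ l, 0 ≤ ψ l := fun l => hg.primitive_nonneg (by
    split_ifs
    · exact add_nonneg (Nat.cast_nonneg _) (totalBacklog_nonneg T _)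
    · simp)
  by_cases hn : n ∈ N.sources ∧ d = N.dest n
  · rw [if_pos hn]
    -- The primitive is expanded about the old queue x. With s the change before injection and ξ the
    -- one caused by it, β(s + ξ)² contributes 2βs to the coefficient of ξ.
    have h1 := (hiddenList_mean_quadratic T (mid.files n) hl hw (g x + 2 * β * s) hβ).add_const
      (primitive g x + (g x * s + β * s ^ 2))
    refine h1.mono (fun l _ => hnn l) (fun l hlm => ?_) (by linarith)
    have hobs := obs_of_mem_hiddenList T hlm
    have hlen : (w n).length = l.length := by rw [hl, ← hobs, List.length_map]
    set fin := (List.zipWith FileRec.inject l (w n)).map FileRec.obs with hfin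
    have hqy : (N.queue mid n d : ℝ) ≤ mid.transit n d + totalBacklog T fin := by
      have h2 := sum_inMac_inject hlen
      rw [hobs, ← hfin] at h2
      have h3 := sum_inMac_le_totalBacklog T fin
      rw [Network.queue, if_pos hn, Nat.cast_add]
      have h4 : (((mid.files n).map FileObs.inMac).sum : ℝ) ≤ (fin.map FileObs.inMac).sum := by
        exact_mod_cast h2
      linarith
    have h5 := hg.primitive_le hx (y := mid.transit n d + totalBacklog T fin)
      (add_nonneg (Nat.cast_nonneg _) (totalBacklog_nonneg T _)) (one_le_ratioBound N T)
      (hxq _ hqy)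
    rw [← hβdef] at h5
    have e : (mid.transit n d + totalBacklog T fin : ℝ) - x
        = s + (totalBacklog T fin - totalBacklog T (mid.files n)) := by
      rw [hs, expQueue, if_pos hn]
      ring
    rw [e] at h5
    simp only [hψ, if_pos hn]
    rw [← hfin]
    refine h5.trans (le_of_eq ?_)
    ring
  · rw [if_neg hn, add_zero]
    refine MeanLE.of_le (fun l _ => hnn l) fun l _ => ?_
    simp only [hψ, if_neg hn, add_zero]
    have hq : N.queue mid n d = mid.transit n d := by rw [Network.queue, if_neg hn, add_zero]
    have he : expQueue T N mid n d = mid.transit n d := by rw [expQueue, if_neg hn, add_zero]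
    have h5 := hg.primitive_le hx (y := mid.transit n d) (Nat.cast_nonneg _)
      (one_le_ratioBound N T) (hxq _ (by rw [hq]))
    rw [← hβdef] at h5
    rwa [hs, he]

/-- A bound for the second-order term of the drift of a queue. -/
def secondOrderBound (N : Network V) (T : Traffic V K) (κ : ℝ) (Wcong : ℕ) (n : V) : ℝ :=
  κ * ratioBound N T * (2 * ((Fintype.card V + 1) * rateBound N) ^ 2
    + 2 * sizeBound T ^ 2 * arrivalSecondMoment T n
    + (Wcong + sizeBound T) ^ 2 * T.arrivalRate n + (Wcong + sizeBound T) ^ 2)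

/-- Mean of the bound of `hidden_mean_primitive` over the arrivals. -/
lemma newFiles_mean_quadratic (hg : IsLogType g κ) {Wcong : ℕ} {o : ConfigObs V K}
    {D : Decision V} {k : V → List ℕ} (hpos : ∀ n, ∀ f ∈ o.files n, 1 ≤ f.inMac)
    (hD : N.IsMaxWeight g o D) (hk : N.IsService o D k) (n d : V) :
    MeanLE (T.newFiles N.sources)
      (fun new => primitive g (expQueue T N o n d) + (g (expQueue T N o n d)
          * (expQueue T N (afterObs N o D k new) n d - expQueue T N o n d)
        + κ * ratioBound N T / (1 + expQueue T N o n d)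
          * (expQueue T N (afterObs N o D k new) n d - expQueue T N o n d) ^ 2)
        + if n ∈ N.sources ∧ d = N.dest n then ((afterObs N o D k new).files n).length
          * (κ * ratioBound N T / (1 + expQueue T N o n d) * (Wcong + sizeBound T) ^ 2) else 0)
      (primitive g (expQueue T N o n d) + g (expQueue T N o n d)
          * ((inflow N o D n d : ℝ) - N.sent o D n d
            + if n ∈ N.sources ∧ d = N.dest n then T.load n else 0)
        + secondOrderBound N T κ Wcong n) := by
  set x := expQueue T N o n d with hx
  have hx0 : 0 ≤ x := expQueue_nonneg T o n d
  have hκ := hg.pos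
  have hc : 0 < κ * ratioBound N T :=
    mul_pos hκ (zero_lt_one.trans_le (one_le_ratioBound N T))
  set β := κ * ratioBound N T / (1 + x) with hβ
  have hβ0 : 0 < β := div_pos hc (by linarith)
  have hβ1 : β ≤ κ * ratioBound N T := div_le_self hc.le (by linarith)
  set M2 : ℝ := (Wcong + sizeBound T) ^ 2 with hM2
  have hM20 : 0 ≤ M2 := sq_nonneg _
  have hgx : 0 ≤ g x := hg.nonneg hx0
  have hP : 0 ≤ primitive g x := hg.primitive_nonneg hx0
  set δ : ℝ := (inflow N o D n d : ℝ) - N.sent o D n d with hδ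
  have hδsq : δ ^ 2 ≤ ((Fintype.card V + 1) * rateBound N : ℝ) ^ 2 := by
    have h1 : (inflow N o D n d : ℝ) ≤ Fintype.card V * rateBound N := by
      exact_mod_cast inflow_le hD n d
    have h2 : (N.sent o D n d : ℝ) ≤ rateBound N := by exact_mod_cast sent_le hD n d
    have h3 : (0 : ℝ) ≤ inflow N o D n d := Nat.cast_nonneg _
    have h4 : (0 : ℝ) ≤ N.sent o D n d := Nat.cast_nonneg _
    have h5 : (0 : ℝ) ≤ Fintype.card V * rateBound N := by positivity
    exact sq_le_sq' (by linarith) (by linarith)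
  have hm2 := arrivalSecondMoment_nonneg (T := T) n
  have hra := arrivalRate_nonneg T n
  have hdiff : ∀ new : V → List (Fin K × ℕ), expQueue T N (afterObs N o D k new) n d - x
      = δ + if n ∈ N.sources ∧ d = N.dest n then totalBacklog T ((new n).map newObs) else 0 := by
    intro new
    rw [expQueue_afterObs T hk new n d, ← hx, hδ]
    ring
  simp_rw [hdiff]
  have hlower : ∀ s : ℝ, ∀ a : ℝ, 0 ≤ a →
      primitive g x + -(g x ^ 2 / (4 * β)) ≤ primitive g x + (g x * s + β * s ^ 2) + a := by
    intro s a ha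
    linarith [quadratic_lower_bound (g x) hβ0 s]
  by_cases hn : n ∈ N.sources ∧ d = N.dest n
  · simp only [if_pos hn]
    have hmean := newFilesAt_mean T hn.1 hgx (mul_nonneg zero_le_two hβ0.le)
      (mul_nonneg hβ0.le hM20)
    rw [← indep_map_apply (newFilesAt T N.sources) n] at hmean
    have h1 := hmean.of_map.add_const
      (primitive g x + g x * δ + 2 * β * δ ^ 2 + (o.files n).length * (β * M2))
    rw [newFiles_eq]
    refine h1.mono (fun new _ => hlower _ _ (by positivity)) (fun new _ => ?_) ?_
    · set Z := totalBacklog T ((new n).map newObs)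
      have hlen : (((afterObs N o D k new).files n).length : ℝ)
          ≤ (o.files n).length + (new n).length := by
        have h2 := length_serveObs_le (o.files n) (k n)
        have h3 : ((afterObs N o D k new).files n).length
            = (serveObs (o.files n) (k n)).length + (new n).length := by
          change (serveObs (o.files n) (k n) ++ (new n).map newObs).length = _
          simp
        rw [h3]
        exact_mod_cast Nat.add_le_add_right h2 _
      have h4 := mul_le_mul_of_nonneg_right hlen (mul_nonneg hβ0.le hM20)
      have h5 : β * (δ + Z) ^ 2 ≤ 2 * β * δ ^ 2 + 2 * β * Z ^ 2 := by
        nlinarith [mul_nonneg hβ0.le (sq_nonneg (δ - Z))]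
      linarith
    -- The variance of injection grows with the number of files, hence at most like x; the factor
    -- 1/(1+x) in β compensates it exactly.
    · have h6 : (o.files n).length * β ≤ κ * ratioBound N T := by
        have h7 : ((o.files n).length : ℝ) ≤ x := by
          have h8 : ((o.files n).length : ℝ) ≤ N.queue o n d := by
            rw [hn.2]
            exact_mod_cast length_le_queue hn.1 (hpos n)
          exact h8.trans (queue_le_expQueue T o n d)
        rw [hβ, mul_div_assoc', div_le_iff₀ (by linarith)]
        nlinarith
      have h9 := mul_le_mul_of_nonneg_right h6 hM20
      have h10 : β * δ ^ 2 ≤ κ * ratioBound N T * ((Fintype.card V + 1) * rateBound N) ^ 2 :=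
        mul_le_mul hβ1 hδsq (sq_nonneg _) hc.le
      have h11 := mul_le_mul_of_nonneg_right hβ1
        (mul_nonneg (sq_nonneg (sizeBound T)) hm2)
      have h12 := mul_le_mul_of_nonneg_right hβ1 (mul_nonneg hM20 hra)
      unfold secondOrderBound
      rw [← hM2]
      linarith
  · simp only [if_neg hn, add_zero]
    refine MeanLE.of_le (b := primitive g x + -(g x ^ 2 / (4 * β)))
      (fun new _ => by linarith [hlower δ 0 le_rfl]) fun new _ => ?_
    have h10 : β * δ ^ 2 ≤ κ * ratioBound N T * ((Fintype.card V + 1) * rateBound N) ^ 2 :=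
      mul_le_mul hβ1 hδsq (sq_nonneg _) hc.le
    have h11 : 0 ≤ κ * ratioBound N T * (((Fintype.card V + 1) * rateBound N) ^ 2
        + 2 * sizeBound T ^ 2 * arrivalSecondMoment T n + M2 * T.arrivalRate n + M2) := by
      positivity
    unfold secondOrderBound
    rw [← hM2]
    linarith

variable {Wcong : ℕ} (C : Control N K g Wcong)

/-- The rest of a slot after the transmissions have been decided. -/
def Control.obsStepAfter (T : Traffic V K) (o : ConfigObs V K) (m : C.Mem) (D : Decision V)
    (k : V → List ℕ) : PMF (ConfigObs V K × C.Mem) :=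
  (T.newFiles N.sources).bind fun new =>
  (C.window o m D k (afterObs N o D k new)).bind fun w =>
  ((hidden T (afterObs N o D k new)).map fun c => (c.inject w).obs).bind fun fin =>
  (C.update o m D k (afterObs N o D k new) fin).map fun m' => (fin, m')

/-- The drift of a single queue. -/
lemma Control.obsStepAfter_mean (hg : IsLogType g κ) {o : ConfigObs V K} (m : C.Mem)
    {D : Decision V} {k : V → List ℕ} (hpos : ∀ n, ∀ f ∈ o.files n, 1 ≤ f.inMac)
    (hD : N.IsMaxWeight g o D) (hk : N.IsService o D k) (n d : V) :
    MeanLE (C.obsStepAfter T o m D k) (fun y => primitive g (expQueue T N y.1 n d))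
      (primitive g (expQueue T N o n d) + g (expQueue T N o n d)
          * ((inflow N o D n d : ℝ) - N.sent o D n d
            + if n ∈ N.sources ∧ d = N.dest n then T.load n else 0)
        + secondOrderBound N T κ Wcong n) := by
  have hnn : ∀ o' : ConfigObs V K, 0 ≤ primitive g (expQueue T N o' n d) := fun o' =>
    hg.primitive_nonneg (expQueue_nonneg T o' n d)
  refine MeanLE.bind (fun new _ => ?_) (fun y _ => hnn y.1)
    (newFiles_mean_quadratic hg (Wcong := Wcong) hpos hD hk n d)
  refine MeanLE.bind (fun w hw => ?_) (fun y _ => hnn y.1) (MeanLE.const _ _)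
  refine MeanLE.bind (φ := fun fin => primitive g (expQueue T N fin n d)) (fun fin _ => ?_)
    (fun y _ => hnn y.1) ?_
  · exact MeanLE.map (MeanLE.const _ (primitive g (expQueue T N fin n d)))
  · refine MeanLE.map (hidden_mean_primitive hg _ n d (C.window_length _ _ _ _ _ w hw n)
      (fun a ha => (C.window_mem _ _ _ _ _ w hw n a ha).2) (expQueue_nonneg T o n d)
      fun y hy => ?_)
    -- A queue loses at most `rateBound` packets in a slot and injection only adds to it. With the
    -- comparison of expected and real queues this yields the factor `ratioBound`.
    have h1 : (N.queue o n d : ℝ) ≤ N.queue (afterObs N o D k new) n d + rateBound N := by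
      exact_mod_cast (queue_afterObs hk new n d).trans (Nat.add_le_add_left (sent_le hD n d) _)
    have h2 := expQueue_le T (N := N) d (hpos n)
    have h3 := sizeBound_nonneg T
    have h4 : (0 : ℝ) ≤ rateBound N := Nat.cast_nonneg _
    have h5 : (0 : ℝ) ≤ y := (Nat.cast_nonneg _).trans hy
    unfold ratioBound
    calc 1 + expQueue T N o n d ≤ 1 + (1 + sizeBound T) * (y + rateBound N) := by
          have h6 : (N.queue o n d : ℝ) ≤ y + rateBound N := by linarith
          have h7 := mul_le_mul_of_nonneg_left h6 (by linarith : 0 ≤ 1 + sizeBound T)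
          linarith
      _ ≤ (1 + sizeBound T) * (1 + (y + rateBound N)) := by nlinarith
      _ ≤ (1 + sizeBound T) * ((1 + rateBound N) * (1 + y)) := by
          refine mul_le_mul_of_nonneg_left ?_ (by linarith)
          nlinarith
      _ = _ := by ring

/-- The Lyapunov function. -/
def lyapunov (N : Network V) (T : Traffic V K) (g : ℝ → ℝ) (o : ConfigObs V K) : ℝ :=
  ∑ n, ∑ d, primitive g (expQueue T N o n d)

lemma lyapunov_nonneg (hg : IsLogType g κ) (o : ConfigObs V K) : 0 ≤ lyapunov N T g o :=
  Finset.sum_nonneg fun n _ => Finset.sum_nonneg fun d _ =>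
    hg.primitive_nonneg (expQueue_nonneg T o n d)

/-- A bound for the drift of the Lyapunov function. -/
def driftBound (N : Network V) (T : Traffic V K) (g : ℝ → ℝ) (κ : ℝ) (Wcong : ℕ) : ℝ :=
  ∑ n, ∑ _d : V, (κ * sizeBound T * (Fintype.card V * rateBound N + T.load n)
    + g (rateBound N) * rateBound N) + ∑ n, ∑ _d : V, secondOrderBound N T κ Wcong n

/-- The drift of the Lyapunov function. -/
lemma Control.obsStep_mean (hg : IsLogType g κ) {x : ConfigObs V K × C.Mem}
    (hx : x ∈ C.obsStates T) {B : ℝ}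
    (hB : ∀ D, N.IsMaxWeight g x.1 D →
      ∑ s ∈ N.sources, T.load s * g (N.queue x.1 s (N.dest s))
        - ∑ l ∈ N.links, (D.rate l.1 l.2 : ℝ) * N.linkWeight g x.1 l.1 l.2 ≤ B) :
    MeanLE (C.obsStep T x) (fun y => lyapunov N T g y.1)
      (lyapunov N T g x.1 + (driftBound N T g κ Wcong + B)) := by
  obtain ⟨o, m⟩ := x
  obtain ⟨⟨c, hc, rfl⟩, -⟩ := hx
  have hpos : ∀ n, ∀ f ∈ c.obs.files n, 1 ≤ f.inMac := by
    intro n f hf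
    obtain ⟨f', hf', rfl⟩ := List.mem_map.1 hf
    exact hc.inMac_pos n f' hf'
  have hq : ∀ d, N.queue c.obs d d = 0 := by
    intro d
    by_contra h
    exact (hc.queue_route h).1 rfl
  refine MeanLE.bind (fun D hD => ?_) (fun y _ => lyapunov_nonneg hg y.1) (MeanLE.const _ _)
  refine MeanLE.bind (fun k hk => ?_) (fun y _ => lyapunov_nonneg hg y.1) (MeanLE.const _ _)
  have hD' := C.schedule_maxWeight _ _ D hD
  have hk' := C.serve_nonidling _ _ _ k hk
  refine (MeanLE.sum fun n _ => MeanLE.sum fun d _ =>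
    C.obsStepAfter_mean (T := T) hg m hpos hD' hk' n d).le ?_
  have h1 := sum_first_order_le T hg hq hpos hD'
  have h2 := hB D hD'
  have e : ∀ a b c : V → V → ℝ, ∑ n, ∑ d, (a n d + b n d + c n d)
      = ∑ n, ∑ d, a n d + ∑ n, ∑ d, b n d + ∑ n, ∑ d, c n d := fun a b c => by
    simp only [Finset.sum_add_distrib]
  refine (e _ _ fun n _ => secondOrderBound N T κ Wcong n).le.trans ?_
  unfold lyapunov driftBound
  linarith

/-- The laws of the observed chain are dominated by a finite measure. -/
theorem Control.dominated_obsStep (hg : IsLogType g κ) (hρ : N.StrictlyInside T.load)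
    {x : ConfigObs V K × C.Mem} (hx : x ∈ C.obsStates T) : Dominated (C.obsStep T) x := by
  obtain ⟨ρ', hρ', hlt⟩ := hρ
  obtain ⟨δ, hδ, hle⟩ := exists_uniform_gap hlt
  set A := driftBound N T g κ Wcong
  -- Beyond length B a queue contributes δ g(q) ≥ A + 1, which outweighs the constant part A of the
  -- drift and leaves -1.
  obtain ⟨B, hB⟩ := eventually_atTop.1
    ((hg.tendsto.comp tendsto_natCast_atTop_atTop).eventually_ge_atTop ((A + 1) / δ))
  refine dominated_of_drift (I := C.obsStates T)
    (F := {x ∈ C.obsStates T | ∀ n d, N.queue x.1 n d ≤ B})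
    (V := fun y => ENNReal.ofReal (lyapunov N T g y.1))
    (fun x hx y hy => C.obsStates_invariant hx hy) (C.finite_obsStates T B) (fun _ h => h.1)
    (fun x hx => ?_) (fun x hx hxF => ?_) hx
  -- For finiteness a crude bound suffices: the weight served is nonnegative and may be dropped.
  · have h := C.obsStep_mean hg hx
      (B := ∑ s ∈ N.sources, T.load s * g (N.queue x.1 s (N.dest s))) fun D hD => by
        obtain ⟨r, hr⟩ := N.rates_nonempty
        have h1 := sum_mul_max_linkWeight_le hD hr
        have h2 : 0 ≤ ∑ l ∈ N.links, (r l.1 l.2 : ℝ) * max 0 (N.linkWeight g x.1 l.1 l.2) :=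
          Finset.sum_nonneg fun l _ => mul_nonneg (Nat.cast_nonneg _) (le_max_left _ _)
        linarith
    exact ne_top_of_le_ne_top ENNReal.ofReal_ne_top
      (h.tsum_ofReal_le fun y _ => lyapunov_nonneg hg y.1)
  · have hxF' : ∃ n d, B < N.queue x.1 n d := by
      by_contra hne
      push Not at hne
      exact hxF ⟨hx, hne⟩
    obtain ⟨n, d, hnd⟩ := hxF'
    obtain ⟨c, hc, hcx⟩ := hx.1
    rw [← hcx] at hnd
    obtain ⟨-, s, hs, rfl, hr⟩ := hc.queue_route (Nat.ne_of_gt (Nat.zero_lt_of_lt hnd))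
    have hq : ∀ d, N.queue x.1 d d = 0 := by
      intro d
      by_contra h
      rw [← hcx] at h
      exact (hc.queue_route h).1 rfl
    have hbig : A + 1 ≤ δ * g (N.queue x.1 n (N.dest s)) := by
      have := hB _ hnd.le
      rw [hcx, Function.comp_apply, div_le_iff₀ hδ] at this
      linarith
    have h := C.obsStep_mean hg hx (B := -(A + 1)) fun D hD => by
      have := sum_load_add_le hρ' hδ.le (fun s _ => load_nonneg T s) hle
        (fun k => hg.nonneg (Nat.cast_nonneg k)) hg.zero hq hD hs hr
      linarith
    have h' : MeanLE (C.obsStep T x) (fun y => lyapunov N T g y.1) (lyapunov N T g x.1 - 1) :=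
      h.le (by linarith)
    -- The mean after the slot is nonnegative, so the drift itself forces the Lyapunov function to
    -- be at least 1 here; hence `ENNReal.ofReal` truncates nothing.
    have h0 : 0 ≤ lyapunov N T g x.1 - 1 := by
      simpa using (h'.shift (b := 0) fun y _ => by simpa using lyapunov_nonneg hg y.1).1
    calc _ ≤ ENNReal.ofReal (lyapunov N T g x.1 - 1) + 1 := by
          gcongr
          exact h'.tsum_ofReal_le fun y _ => lyapunov_nonneg hg y.1
      _ = ENNReal.ofReal (lyapunov N T g x.1) := by
          rw [← ENNReal.ofReal_one, ← ENNReal.ofReal_add h0 zero_le_one]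
          congr 1
          ring

/-- The network is stable for every load strictly inside of the capacity region. -/
theorem Control.stable (hg : IsLogType g κ) (hρ : N.StrictlyInside T.load) : C.Stable T := by
  rintro ⟨c, m⟩ hc hm
  have h : Dominated (C.step T) (c, m) :=
    dominated_of_obs T C hc.rest_type (C.dominated_obsStep hg hρ ⟨⟨c, hc, rfl⟩, hm⟩)
  exact ⟨h.reachesPositiveRecurrent, h.remainsFinite _⟩

end Drift

end FlowNet

end

theorem theorem1 {V : Type*} [Fintype V] [DecidableEq V] (N : Network V)
    {K : ℕ} (T : Traffic V K)
    (h : ℝ → ℝ) (h_zero : 0 < h 0) (h_mono : MonotoneOn h (Set.Ici 0))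
    (g_mono : MonotoneOn (logType h) (Set.Ici 0))
    (g_concave : ConcaveOn ℝ (Set.Ici 0) (logType h))
    (g_smooth : ContDiffOn ℝ 1 (logType h) (Set.Ioi 0))
    (g_tendsto : Tendsto (logType h) atTop atTop)
    (Wcong : ℕ) (C : Control N K (logType h) Wcong)
    (hρ : N.StrictlyInside T.load) :
    C.Stable T := by
  exact C.stable (isLogType_logType h_zero h_mono g_mono g_tendsto) hρ
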